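/- **Theorem (Sampled-data observer for hyperbolic PDE–ODE loops).** *Plant.* Let $c>0$, $r=c^{-1}$, $z_i\in(0,1]$ ($1\le i\le N_1$), $a,\gamma_i\in C^0([0,1])$, $b_i,\beta_i\in C^1([0,1])$, $q_j\in\mathbb R^{\bar n}$, $\bar b_{j,i},\bar\beta_{j,i}\in\mathbb R$ ($1\le j\le k$), $\tilde F:\mathbb R^{\bar n}\times C^0([0,1])\times\mathbb R^m\to\mathbb R^{\bar n}$, $g:[0,1]\times\mathbb R^{\bar n}\to\mathbb R$. Consider, for $t\ge0$, $z\in[0,1]$, $$\dot{\bar x}(t)=\tilde F(\bar x(t),v[t],u(t)),\qquad v(t,0)=0,$$ $$v_t+cv_z=a(z)v+g(z,\bar x(t))+\sum_{i=1}^{N_1}b_i(z)v(t,z_i)+\sum_{i=1}^{N_2}\beta_i(z)\int_0^1\gamma_i(s)v(t,s)\,ds,$$ where $v[t]=v(t,\cdot)$, with output $$Y_j(\bar x,v[t])=q_j^T\bar x+\sum_i\bar b_{j,i}v(t,z_i)+\sum_i\bar\beta_{j,i}\int_0^1\gamma_i(s)v(t,s)\,ds.$$ A pair $(v_0,\bar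 x_0)\in C^1([0,1])\times\mathbb R^{\bar n}$ is *compatible* if $v_0(0)=0$ and $cv_0'(0)=g(0,\bar x_0)+\sum_i b_i(0)v_0(z_i)+\sum_i\beta_i(0)\int_0^1\gamma_i v_0\,ds$. Put $C(z)=\exp(r\int_0^z a)$ and, for $x=(\bar x,\eta,\lambda)\in\mathbb R^n$, $n=\bar n+N_1+N_2$, $$\bar g(z,x)=g(z,\bar x)+\sum_i b_i(z)\eta_i+\sum_i\beta_i(z)\lambda_i,$$ $$\tilde g(z,x)=a(z)g(z,\bar x)-c\,\partial_zg(z,\bar x)+\sum_i(ab_i-cb_i')(z)\eta_i+\sum_i(a\beta_i-c\beta_i')(z)\lambda_i .$$ $|\cdot|$ is the Euclidean norm, $\|\cdot\|$ the sup norm on $C^0([-r,0];\mathbb R^p)$, $\|\cdot\|_\infty$ the sup norm on $C^0([0,1])$, $x_t(\theta)=x(t+\theta)$ for $\theta\in[-r,0]$. Class $K$ is the set of increasing continuous $\rho:\mathbb R_+\to\mathbb R_+$ with $\rho(0)=0$; $K_\infty$ is the set of unbounded $\rho\in K$. $L^\infty_{loc}$ denotes measurable, locally bounded signals on $\mathbb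 R_+$. *Assumptions.* (A1) $\tilde F$ is continuous, $g\in C^1$, $\tilde F(0,0,0)=0$, $g(z,0)=0$ for all $z$, and for some $L>0$: $|\tilde F(x,v,u)-\tilde F(y,w,u)|\le L\|v-w\|_\infty+L|x-y|$ and $|g(z,x)-g(z,y)|\le L|x-y|$ for all arguments. (A2) There is $G>0$ such that for every compatible $(v_0,\bar x_0)$ there are $\bar x\in C^0([-r,0];\mathbb R^{\bar n})$, $\eta\in C^0([-r,0];\mathbb R^{N_1})$, $\lambda\in C^0([-r,0];\mathbb R^{N_2})$ with $\bar x(0)=\bar x_0$, $\eta_i(0)=v_0(z_i)$, $\lambda_i(0)=\int_0^1\gamma_iv_0$, $\|\bar x\|+\|\eta\|+\|\lambda\|\le G(\|v_0\|_\infty+\|v_0'\|_\infty+|\bar x_0|)$ and $v_0(s)=\int_{-rs}^0\frac{C(s)}{C(cp+s)}\bar g(cp+s,\bar x(p),\eta(p),\lambda(p))\,dp$ for all $s\in[0,1]$. (A3) For some $L>0$, $|\partial_zg(z,x)-\partial_zg(z,y)|\le L|x-y|$ for all $z\in[0,1]$, $x,y\in\mathbb R^{\bar n}$. *Associated delay system.*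 For $x=(\bar x,\eta,\lambda)\in C^0([-r,0];\mathbb R^n)$, $u\in\mathbb R^m$ let $f=(f_1,f_2,f_3)$, where $f_1(x,u)=\tilde F(\bar x(0),\nu,u)$ with $\nu(z)=\int_{-rz}^0\frac{C(z)}{C(cp+z)}\bar g(cp+z,x(p))\,dp$, $$f_{2,i}(x)=\bar g(z_i,x(0))-C(z_i)\bar g(0,x(-rz_i))+\int_{-rz_i}^0\tfrac{C(z_i)}{C(z_i+cp)}\tilde g(z_i+cp,x(p))\,dp,$$ $$f_{3,i}(x)=\int_0^1\gamma_i(z)\big(\bar g(z,x(0))-C(z)\bar g(0,x(-rz))\big)dz+\int_0^1\!\int_{-rz}^0\tfrac{\gamma_i(z)C(z)}{C(z+cp)}\tilde g(z+cp,x(p))\,dp\,dz,$$ and let $h_j(x)=q_j^T\bar x(0)+\sum_i\bar b_{j,i}\eta_i(0)+\sum_i\bar\beta_{j,i}\lambda_i(0)$, $R_j(x,u)=q_j^Tf_1+\sum_i\bar b_{j,i}f_{2,i}+\sum_i\bar\beta_{j,i}f_{3,i}$. *Continuous-time observer.* Let $F:C^0([-r,0];\mathbb R^l)\times\mathbb R^k\times\mathbb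 R^m\to\mathbb R^l$ and $\Psi:C^0([-r,0];\mathbb R^l)\to C^0([-r,0];\mathbb R^n)$ be continuous with $F(0,0,0)=0$, $\Psi(0)=0$, such that for every bounded $\Omega$ the set $F(\Omega)$ is bounded and there is $L_\Omega\ge0$ with $(z(0)-\bar z(0))^T(F(z,y,u)-F(\bar z,y,u))\le L_\Omega\|z-\bar z\|^2$ whenever $(z,y,u),(\bar z,y,u)\in\Omega$. Suppose that $\dot z=F(z_t,y,u)$, $\hat x_t=\Psi(z_t)$ is a robust exponential observer for $\dot x=f(x_t,u)$, $y=h(x_t)+\xi$: there are $\gamma,\sigma>0$ and $\alpha\in K_\infty$ such that for all initial histories $x_0,z_0$ and all $u,\xi\in L^\infty_{loc}$ the solution of $\dot x=f(x_t,u)$, $\dot z=F(z_t,h(x_t)+\xi,u)$ exists for all $t\ge0$ and $$\|\Psi(z_t)-x_t\|\le e^{-\sigma t}\alpha(\|x_0\|+\|z_0\|)+\gamma\sup_{0\le s\le t}|\xi(s)|e^{-\sigma(t-s)}\qquad\forall t\ge0 .$$ Suppose moreover that for every bounded $S\subset C^0([-r,0];\mathbb R^l)\times\mathbb R^m$ there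 is $L_S\ge0$ with $|R(\Psi(z),u)-R(\Psi(\bar z),u)|\le L_S\|z-\bar z\|$ for all $(z,u),(\bar z,u)\in S$. *Conclusion.* Then there are constants $\delta,P,\omega>0$ and $\bar a\in K_\infty$, with $\bar a$ linear if $\alpha$ is linear, such that for every sequence $\tau_0=0$, $\tau_i\to+\infty$, $0<\tau_{i+1}-\tau_i\le\delta$, every compatible $(v_0,\bar x_0)$, every $z_0\in C^0([-r,0];\mathbb R^l)$, $u\in C^0(\mathbb R_+;\mathbb R^m)$ and $\xi\in L^\infty_{loc}(\mathbb R_+;\mathbb R^k)$, the plant with initial condition $(\bar x_0,v_0)$, coupled with the sampled-data observer $$\dot z(t)=F(z_t,w(t),u(t)),\quad \dot w(t)=R(\Psi(z_t),u(t))\ \ (t\in[\tau_i,\tau_{i+1})),\quad w(\tau_i)=Y(\bar x(\tau_i),v[\tau_i])+\xi(\tau_i),$$ with initial history $z_0$, has a solution $(\bar x,v,z,w)$ defined for all $t\ge0$, with $\bar x\in C^1(\mathbb R_+)$ and $v\in C^1(\mathbb R_+\times[0,1])$. Every solution defined on an interval $[0,T)$ extends to a solution on $[0,\infty)$ and satisfies,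 for all its times $t$, with $\hat x_t=\Psi(z_t)$ and $H$ the projection $(\bar x,\eta,\lambda)\mapsto\bar x$, $$|\bar x(t)-H\hat x_t(0)|+\|v[t]-\hat v[t]\|_\infty\le e^{-\omega t}\,\bar a\big(\|v_0\|_\infty+\|v_0'\|_\infty+|\bar x_0|+\|z_0\|\big)+P\sup_{0\le s\le t}|\xi(s)|e^{-\omega(t-s)},$$ where $\hat v(t,z)=\int_{t-rz}^t\frac{C(z)}{C(z-c(t-p))}\,\bar g\big(z-c(t-p),\hat x_t(p-t)\big)\,dp$. -/

import Mathlib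

open Set Filter Topology MeasureTheory

noncomputable section

namespace SampledData

/-! ### Function spaces, signals and comparison functions -/

/-- `ℝⁿ` with its Euclidean norm. -/
abbrev Eu (n : ℕ) : Type := EuclideanSpace ℝ (Fin n)

open Classical in
/-- The restriction of `f` to `s`, as an element of `C⁰(s; E)`. It is used only for functions that
are continuous on `s`; the value in the other case is a placeholder. -/
def restrictC {E : Type*} [NormedAddCommGroup E] (s : Set ℝ) (f : ℝ → E) : C(s, E) :=
  if h : ContinuousOn f s then ⟨s.domRestrict f, h.domRestrict⟩ else 0

theorem restrictC_apply {E : Type*} [NormedAddCommGroup E] {s : Set ℝ} {f : ℝ → E}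
    (h : ContinuousOn f s) (t : s) : restrictC s f t = f t := by
  rw [restrictC, dif_pos h]
  rfl

/-- `C⁰([-r, 0]; E)`, with the norm `max_θ |x(θ)|`. -/
abbrev Hist (r : ℝ) (E : Type*) [NormedAddCommGroup E] : Type _ := C(Icc (-r) (0 : ℝ), E)

/-- The `r`-history `x_t`, i.e. `x_t(θ) = x(t + θ)` for `θ ∈ [-r, 0]`. -/
def hist {E : Type*} [NormedAddCommGroup E] (r : ℝ) (x : ℝ → E) (t : ℝ) : Hist r E :=
  restrictC (Icc (-r) 0) (fun θ => x (t + θ))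

/-- `C⁰([0, 1])`, with the sup norm. -/
abbrev Prof : Type := C(Icc (0 : ℝ) 1, ℝ)

/-- The element of `C⁰([0, 1])` given by a function that is continuous on `[0, 1]`. -/
def prof (f : ℝ → ℝ) : Prof := restrictC (Icc 0 1) f

/-- Class `K`: increasing continuous functions `ρ : ℝ₊ → ℝ₊` with `ρ(0) = 0`. -/
structure ClassK (ρ : ℝ → ℝ) : Prop where
  cont : ContinuousOn ρ (Ici 0)
  mono : StrictMonoOn ρ (Ici 0)
  zero : ρ 0 = 0

/-- Class `K_∞`. -/
structure ClassKInf (ρ : ℝ → ℝ) : Prop extends ClassK ρ where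
  unbounded : Tendsto ρ atTop atTop

/-- `ρ` is linear on `ℝ₊`. -/
def IsLinearOnNonneg (ρ : ℝ → ℝ) : Prop := ∃ m : ℝ, ∀ s, 0 ≤ s → ρ s = m * s

/-- `L^∞_loc(ℝ₊; V)`: Lebesgue measurable, locally bounded signals with values in `V`
(only the values at times `t ≥ 0` are relevant). -/
structure LocBddInput {E : Type*} [NormedAddCommGroup E] (V : Set E) (u : ℝ → E) : Prop where
  mem : ∀ t, 0 ≤ t → u t ∈ V
  meas : AEStronglyMeasurable u (volume.restrict (Ici (0 : ℝ)))
  bdd : ∀ T : ℝ, ∃ M : ℝ, ∀ t ∈ Icc 0 T, ‖u t‖ ≤ M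

/-- The fading-memory supremum `sup_{0 ≤ s ≤ t} |ξ(s)| exp(-ω (t - s))`. -/
def fadingSup {E : Type*} [NormedAddCommGroup E] (ω : ℝ) (ξ : ℝ → E) (t : ℝ) : ℝ :=
  sSup ((fun s => ‖ξ s‖ * Real.exp (-ω * (t - s))) '' Icc 0 t)

/-- Sampling sequences of diameter at most `δ`. -/
structure IsSampling (δ : ℝ) (τ : ℕ → ℝ) : Prop where
  zero : τ 0 = 0
  tendsto : Tendsto τ atTop atTop
  step_pos : ∀ i, 0 < τ (i + 1) - τ i
  step_le : ∀ i, τ (i + 1) - τ i ≤ δ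

/-! ### Delay systems and robust exponential observers -/

/-- `x` is (locally) absolutely continuous on `[s, T)` and `ẋ(t) = rhs t` for almost every `t`. -/
def SolvesAE {E : Type*} [NormedAddCommGroup E] [NormedSpace ℝ E]
    (x rhs : ℝ → E) (s T : ℝ) : Prop :=
  (∀ T' ∈ Ioo s T, AbsolutelyContinuousOnInterval x s T') ∧
    ∀ᵐ t : ℝ, t ∈ Ioo s T → HasDerivAt x (rhs t) t

/-- `x : [-r, T) → E` is a solution with initial history `φ` of the functional differential
equation whose right-hand side along `x` is `rhs`. -/
structure IsDelaySolution {E : Type*} [NormedAddCommGroup E] [NormedSpace ℝ E]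
    (r T : ℝ) (φ : Hist r E) (x rhs : ℝ → E) : Prop where
  cont : ContinuousOn x (Ico (-r) T)
  init : ∀ θ : Icc (-r) (0 : ℝ), x θ = φ θ
  ode : SolvesAE x rhs 0 T

section REO

variable {X Y Z V W : Type*}
  [NormedAddCommGroup X] [InnerProductSpace ℝ X] [NormedAddCommGroup Y] [InnerProductSpace ℝ Y]
  [NormedAddCommGroup Z] [InnerProductSpace ℝ Z] [NormedAddCommGroup V] [InnerProductSpace ℝ V]
  [NormedAddCommGroup W] [InnerProductSpace ℝ W]

/-- `(x, z)` is a solution on `[0, ∞)` of the plant `ẋ = f(x_t, u, d)` together with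
`ż = F(z_t, h(x_t) + ξ, u)`, with initial condition `(x₀, z₀)`. -/
def IsREOSolution (r : ℝ) (f : Hist r X → V → W → X) (h : Hist r X → Y)
    (F : Hist r Z → Y → V → Z) (x₀ : Hist r X) (z₀ : Hist r Z)
    (u : ℝ → V) (d : ℝ → W) (ξ : ℝ → Y) (x : ℝ → X) (z : ℝ → Z) : Prop :=
  ∀ T > 0, IsDelaySolution r T x₀ x (fun t => f (hist r x t) (u t) (d t)) ∧
    IsDelaySolution r T z₀ z (fun t => F (hist r z t) (h (hist r x t) + ξ t) (u t))

/-- The system `ż = F(z_t, y, u)`, `x̂_t = Ψ(z_t)` is a robust exponential observer for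
`ẋ = f(x_t, u, d)`, `y = h(x_t) + ξ`, with inputs `u ∈ U`, `d ∈ D`, and the estimate holds with the
constants `γ, σ` and the functions `g, a`. -/
structure IsREOWith (r : ℝ) (U : Set V) (D : Set W) (f : Hist r X → V → W → X) (h : Hist r X → Y)
    (F : Hist r Z → Y → V → Z) (Ψ : Hist r Z → Hist r X) (γ σ : ℝ) (g a : ℝ → ℝ) : Prop where
  F_cont : ContinuousOn (fun p : Hist r Z × Y × V => F p.1 p.2.1 p.2.2) {p | p.2.2 ∈ U}
  Ψ_cont : Continuous Ψ
  F_zero : F 0 0 0 = 0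
  Ψ_zero : Ψ 0 = 0
  F_bdd : ∀ Ω : Set (Hist r Z × Y × V), Ω ⊆ {p | p.2.2 ∈ U} → Bornology.IsBounded Ω →
    Bornology.IsBounded ((fun p : Hist r Z × Y × V => F p.1 p.2.1 p.2.2) '' Ω)
  F_oneSided : ∀ Ω : Set (Hist r Z × Y × V), Ω ⊆ {p | p.2.2 ∈ U} → Bornology.IsBounded Ω →
    ∃ L : ℝ, 0 ≤ L ∧ ∀ (z z' : Hist r Z) (y : Y) (u : V), (z, y, u) ∈ Ω → (z', y, u) ∈ Ω →
      ∀ θ₀ : Icc (-r) (0 : ℝ), (θ₀ : ℝ) = 0 →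
        inner ℝ (z θ₀ - z' θ₀) (F z y u - F z' y u) ≤ L * ‖z - z'‖ ^ 2
  γ_pos : 0 < γ
  σ_pos : 0 < σ
  g_classK : ClassK g
  a_classKInf : ClassKInf a
  exists_solution : ∀ (x₀ : Hist r X) (z₀ : Hist r Z) (u : ℝ → V) (d : ℝ → W) (ξ : ℝ → Y),
    LocBddInput U u → LocBddInput D d → LocBddInput univ ξ →
      ∃ (x : ℝ → X) (z : ℝ → Z), IsREOSolution r f h F x₀ z₀ u d ξ x z
  estimate : ∀ (x₀ : Hist r X) (z₀ : Hist r Z) (u : ℝ → V) (d : ℝ → W) (ξ : ℝ → Y),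
    LocBddInput U u → LocBddInput D d → LocBddInput univ ξ →
      ∀ (x : ℝ → X) (z : ℝ → Z), IsREOSolution r f h F x₀ z₀ u d ξ x z →
        ∀ t, 0 ≤ t → ‖Ψ (hist r z t) - hist r x t‖ ≤
          Real.exp (-σ * t) * a (‖x₀‖ + ‖z₀‖) + γ * fadingSup σ ξ t +
            sSup ((fun s => g ‖d s‖) '' Icc 0 t)

end REO

/-! ### The PDE-ODE loop -/

/-- The data of the loop
`dx̄/dt = F̃(x̄, v[t], u)`,
`v_t + c v_z = a(z) v + g(z, x̄) + ∑ b_i(z) v(t, z_i) + ∑ β_i(z) ∫₀¹ γ_i(s) v(t, s) ds`, `v(t,0) = 0`,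
with output
`y_j = q_jᵀ x̄ + ∑ b̄_{j,i} v(t, z_i) + ∑ β̄_{j,i} ∫₀¹ γ_i(s) v(t, s) ds`.
Functions on `[0, 1]` are given by their values on `[0, 1]` (other values are irrelevant). -/
structure Loop (nb N₁ N₂ m k : ℕ) where
  c : ℝ
  c_pos : 0 < c
  Ft : Eu nb → Prof → Eu m → Eu nb
  g : ℝ → Eu nb → ℝ
  a : ℝ → ℝ
  a_cont : ContinuousOn a (Icc 0 1)
  zpt : Fin N₁ → ℝ
  zpt_mem : ∀ i, zpt i ∈ Ioc (0 : ℝ) 1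
  b : Fin N₁ → ℝ → ℝ
  b_C1 : ∀ i, ContDiffOn ℝ 1 (b i) (Icc 0 1)
  β : Fin N₂ → ℝ → ℝ
  β_C1 : ∀ i, ContDiffOn ℝ 1 (β i) (Icc 0 1)
  γ : Fin N₂ → ℝ → ℝ
  γ_cont : ∀ i, ContinuousOn (γ i) (Icc 0 1)
  q : Fin k → Eu nb
  bOut : Fin k → Fin N₁ → ℝ
  βOut : Fin k → Fin N₂ → ℝ

/-- The stacked state `x = (x̄, η, λ) ∈ ℝ^{n̄ + N₁ + N₂}`, with the Euclidean norm. -/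
abbrev St (nb N₁ N₂ : ℕ) : Type := EuclideanSpace ℝ (Fin nb ⊕ Fin N₁ ⊕ Fin N₂)

section Components

variable {nb N₁ N₂ : ℕ}

/-- The stacked vector `(x̄, η, λ)`. -/
def stack (xb : Eu nb) (η : Eu N₁) (l : Eu N₂) : St nb N₁ N₂ :=
  WithLp.toLp 2 (Sum.elim (fun i => xb i) (Sum.elim (fun i => η i) (fun i => l i)))

/-- `x̄ = H x`, where `H` is the matrix with `H (x̄, η, λ) = x̄`. -/
def xPart (x : St nb N₁ N₂) : Eu nb := WithLp.toLp 2 (fun i => x (Sum.inl i))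

theorem xPart_stack (xb : Eu nb) (η : Eu N₁) (l : Eu N₂) : xPart (stack xb η l) = xb := by
  ext i
  rfl

/-- The component `η` of `(x̄, η, λ)`. -/
def ηPart (x : St nb N₁ N₂) : Eu N₁ := WithLp.toLp 2 (fun i => x (Sum.inr (Sum.inl i)))

/-- The component `λ` of `(x̄, η, λ)`. -/
def lPart (x : St nb N₁ N₂) : Eu N₂ := WithLp.toLp 2 (fun i => x (Sum.inr (Sum.inr i)))

end Components

namespace Loop

variable {nb N₁ N₂ m k : ℕ} (P : Loop nb N₁ N₂ m k)

/-- The delay `r = c⁻¹`. -/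
def r : ℝ := P.c⁻¹

theorem neg_r_le : -P.r ≤ 0 := by
  have := inv_pos.mpr P.c_pos
  unfold r
  linarith

/-- The value `x(p)`, `p ∈ [-r, 0]`, of a history `x`. -/
def ev {E : Type*} [NormedAddCommGroup E] (x : Hist P.r E) (p : ℝ) : E :=
  IccExtend P.neg_r_le x p

/-- `∂g/∂z (z, x̄)` for `z ∈ [0, 1]`. -/
def gz (z : ℝ) (xb : Eu nb) : ℝ := derivWithin (fun s => P.g s xb) (Icc 0 1) z

/-- Regularity and global Lipschitz assumption on `F̃` and `g`. -/
structure A1 : Prop where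
  F_cont : Continuous (fun p : Eu nb × Prof × Eu m => P.Ft p.1 p.2.1 p.2.2)
  g_C1 : ContDiffOn ℝ 1 (fun p : ℝ × Eu nb => P.g p.1 p.2) (Icc 0 1 ×ˢ univ)
  F_zero : P.Ft 0 0 0 = 0
  g_zero : ∀ z ∈ Icc (0 : ℝ) 1, P.g z 0 = 0
  lipschitz : ∃ L : ℝ, 0 < L ∧
    (∀ (x y : Eu nb) (v w : Prof) (u : Eu m),
      ‖P.Ft x v u - P.Ft y w u‖ ≤ L * ‖v - w‖ + L * ‖x - y‖) ∧
    (∀ (x y : Eu nb), ∀ z ∈ Icc (0 : ℝ) 1, |P.g z x - P.g z y| ≤ L * ‖x - y‖)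

/-- `∂g/∂z` is globally Lipschitz in `x̄`, uniformly in `z ∈ [0, 1]`. -/
def A3 : Prop := ∃ L : ℝ, 0 < L ∧
  ∀ (x y : Eu nb), ∀ z ∈ Icc (0 : ℝ) 1, |P.gz z x - P.gz z y| ≤ L * ‖x - y‖

/-- The `C¹([0, 1])` initial profiles `v₀` and initial vectors `x̄₀` that satisfy the compatibility
conditions. -/
structure Compatible (v₀ : ℝ → ℝ) (xb₀ : Eu nb) : Prop where
  C1 : ContDiffOn ℝ 1 v₀ (Icc 0 1)
  deriv_zero : P.c * derivWithin v₀ (Icc 0 1) 0 =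
    P.g 0 xb₀ + ∑ i, P.b i 0 * v₀ (P.zpt i) + ∑ i, P.β i 0 * ∫ s in (0 : ℝ)..1, P.γ i s * v₀ s
  zero : v₀ 0 = 0

/-- `C(z) = exp (r ∫₀ᶻ a(s) ds)`. -/
def Cf (z : ℝ) : ℝ := Real.exp (P.r * ∫ s in (0 : ℝ)..z, P.a s)

/-- `ḡ(z, x̄, η, λ) = g(z, x̄) + ∑ b_i(z) η_i + ∑ β_i(z) λ_i`. -/
def gbar (z : ℝ) (xb : Eu nb) (η : Eu N₁) (l : Eu N₂) : ℝ :=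
  P.g z xb + ∑ i, P.b i z * η i + ∑ i, P.β i z * l i

/-- `ḡ(z, x)` for the stacked vector `x`. -/
def gbarS (z : ℝ) (x : St nb N₁ N₂) : ℝ := P.gbar z (xPart x) (ηPart x) (lPart x)

/-- `g̃(z, x) = a(z) g(z, x̄) - c ∂g/∂z(z, x̄) + ∑ (a b_j - c b_j')(z) η_j + ∑ (a β_j - c β_j')(z) λ_j`. -/
def gtildeS (z : ℝ) (x : St nb N₁ N₂) : ℝ :=
  P.a z * P.g z (xPart x) - P.c * P.gz z (xPart x) +
    ∑ j, (P.a z * P.b j z - P.c * derivWithin (P.b j) (Icc 0 1) z) * ηPart x j +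
    ∑ j, (P.a z * P.β j z - P.c * derivWithin (P.β j) (Icc 0 1) z) * lPart x j

/-- Every admissible initial condition of the loop is generated by a history `(x̄, η, λ)` on
`[-r, 0]`, with a linear bound. -/
def A2 : Prop := ∃ G : ℝ, 0 < G ∧ ∀ (v₀ : ℝ → ℝ) (xb₀ : Eu nb), P.Compatible v₀ xb₀ →
  ∃ (xb : Hist P.r (Eu nb)) (η : Hist P.r (Eu N₁)) (l : Hist P.r (Eu N₂)),
    P.ev xb 0 = xb₀ ∧
    (∀ i, P.ev η 0 i = v₀ (P.zpt i)) ∧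
    (∀ i, P.ev l 0 i = ∫ z in (0 : ℝ)..1, P.γ i z * v₀ z) ∧
    ‖xb‖ + ‖η‖ + ‖l‖ ≤ G * (‖prof v₀‖ + ‖prof (derivWithin v₀ (Icc 0 1))‖ + ‖xb₀‖) ∧
    ∀ s ∈ Icc (0 : ℝ) 1, v₀ s = ∫ p in (-(P.r * s))..0,
      P.Cf s / P.Cf (P.c * p + s) * P.gbar (P.c * p + s) (P.ev xb p) (P.ev η p) (P.ev l p)

/-! The associated system with distributed delays. -/

/-- `f₁(x, u, d) = F̃(x̄(0), v, u) + d`, with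
`v(z) = ∫_{-rz}^0 C(z) / C(cp + z) ḡ(cp + z, x(p)) dp`. -/
def f₁ (x : Hist P.r (St nb N₁ N₂)) (u : Eu m) (d : Eu nb) : Eu nb :=
  P.Ft (xPart (P.ev x 0))
    (prof (fun z => ∫ p in (-(P.r * z))..0,
      P.Cf z / P.Cf (P.c * p + z) * P.gbarS (P.c * p + z) (P.ev x p))) u + d

/-- The components `f_{2,i}`. -/
def f₂ (x : Hist P.r (St nb N₁ N₂)) : Eu N₁ := WithLp.toLp 2 fun i =>
  P.gbarS (P.zpt i) (P.ev x 0) - P.Cf (P.zpt i) * P.gbarS 0 (P.ev x (-(P.r * P.zpt i))) +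
    ∫ p in (-(P.r * P.zpt i))..0, P.Cf (P.zpt i) / P.Cf (P.zpt i + P.c * p) *
      P.gtildeS (P.zpt i + P.c * p) (P.ev x p)

/-- The components `f_{3,i}`. -/
def f₃ (x : Hist P.r (St nb N₁ N₂)) : Eu N₂ := WithLp.toLp 2 fun i =>
  (∫ z in (0 : ℝ)..1, P.γ i z *
      (P.gbarS z (P.ev x 0) - P.Cf z * P.gbarS 0 (P.ev x (-(P.r * z))))) +
    ∫ z in (0 : ℝ)..1, ∫ p in (-(P.r * z))..0, P.γ i z * P.Cf z / P.Cf (z + P.c * p) *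
      P.gtildeS (z + P.c * p) (P.ev x p)

/-- The right-hand side `f = (f₁, f₂, f₃)` of the delay system. -/
def f (x : Hist P.r (St nb N₁ N₂)) (u : Eu m) (d : Eu nb) : St nb N₁ N₂ :=
  stack (P.f₁ x u d) (P.f₂ x) (P.f₃ x)

/-- The output functional `h_j(x) = q_jᵀ x̄(0) + ∑ b̄_{j,i} η_i(0) + ∑ β̄_{j,i} λ_i(0)`. -/
def h (x : Hist P.r (St nb N₁ N₂)) : Eu k := WithLp.toLp 2 fun j =>
  inner ℝ (P.q j) (xPart (P.ev x 0)) + ∑ i, P.bOut j i * ηPart (P.ev x 0) i +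
    ∑ i, P.βOut j i * lPart (P.ev x 0) i

/-- The functional `R_j = q_jᵀ f₁ + ∑ b̄_{j,i} f_{2,i} + ∑ β̄_{j,i} f_{3,i}`. -/
def R (x : Hist P.r (St nb N₁ N₂)) (u : Eu m) (d : Eu nb) : Eu k := WithLp.toLp 2 fun j =>
  inner ℝ (P.q j) (P.f₁ x u d) + ∑ i, P.bOut j i * P.f₂ x i + ∑ i, P.βOut j i * P.f₃ x i

/-- The (noise-free) output of the loop at a state `(x̄, v)`. -/
def output (xb : Eu nb) (v : ℝ → ℝ) : Eu k := WithLp.toLp 2 fun j =>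
  inner ℝ (P.q j) xb + ∑ i, P.bOut j i * v (P.zpt i) +
    ∑ i, P.βOut j i * ∫ s in (0 : ℝ)..1, P.γ i s * v s

/-- `(x̄, v)` is a classical solution on `[0, T)` of the loop with initial condition `(x̄₀, v₀)` and
input `u`; it has class `C¹` on `[0, T)`, respectively on `[0, T) × [0, 1]`. -/
structure IsPDESolution (T : ℝ) (xb₀ : Eu nb) (v₀ : ℝ → ℝ) (u : ℝ → Eu m)
    (xb : ℝ → Eu nb) (v : ℝ → ℝ → ℝ) : Prop where
  xb_C1 : ContDiffOn ℝ 1 xb (Ico 0 T)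
  v_C1 : ContDiffOn ℝ 1 (fun p : ℝ × ℝ => v p.1 p.2) (Ico 0 T ×ˢ Icc 0 1)
  xb_init : xb 0 = xb₀
  v_init : ∀ z ∈ Icc (0 : ℝ) 1, v 0 z = v₀ z
  ode : ∀ t ∈ Ico 0 T, derivWithin xb (Ici 0) t = P.Ft (xb t) (prof (v t)) (u t)
  pde : ∀ t ∈ Ico 0 T, ∀ z ∈ Icc (0 : ℝ) 1,
    derivWithin (fun s => v s z) (Ici 0) t + P.c * derivWithin (v t) (Icc 0 1) z =
      P.a z * v t z + P.g z (xb t) + ∑ i, P.b i z * v t (P.zpt i) +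
        ∑ i, P.β i z * ∫ s in (0 : ℝ)..1, P.γ i s * v t s
  boundary : ∀ t ∈ Ico 0 T, v t 0 = 0

section Observer

variable {l : ℕ}

/-- `(x̄, v, z, w)` is a solution on `[0, T)` of the loop together with the sampled-data observer
`ż = F(z_t, w, u)`, and `ẇ = R(Ψ(z_t), u, 0)` on `[τ_i, τ_{i+1})` with `w(τ_i)` reset to the measured
output at time `τ_i`. -/
structure IsSolution (F : Hist P.r (Eu l) → Eu k → Eu m → Eu l)
    (Ψ : Hist P.r (Eu l) → Hist P.r (St nb N₁ N₂)) (τ : ℕ → ℝ)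
    (xb₀ : Eu nb) (v₀ : ℝ → ℝ) (z₀ : Hist P.r (Eu l)) (u : ℝ → Eu m) (ξ : ℝ → Eu k) (T : ℝ)
    (xb : ℝ → Eu nb) (v : ℝ → ℝ → ℝ) (z : ℝ → Eu l) (w : ℝ → Eu k) : Prop where
  pde : P.IsPDESolution T xb₀ v₀ u xb v
  z_eq : IsDelaySolution P.r T z₀ z (fun t => F (hist P.r z t) (w t) (u t))
  w_reset : ∀ i, τ i < T → w (τ i) = P.output (xb (τ i)) (v (τ i)) + ξ (τ i)
  w_eq : ∀ i, τ i < T →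
    SolvesAE w (fun t => P.R (Ψ (hist P.r z t)) (u t) 0) (τ i) (min (τ (i + 1)) T)

/-- The reconstructed profile
`v̂(t, z) = ∫_{t-rz}^t C(z) / C(z - c(t - p)) ḡ(z - c(t - p), x̂(p)) dp`, where `x̂(p)`,
`p ∈ [t - r, t]`, is given by `x̂_t = Ψ(z_t)`; the argument `xh` is the history `x̂_t`. -/
def vhat (xh : Hist P.r (St nb N₁ N₂)) (t z : ℝ) : ℝ :=
  ∫ p in (t - P.r * z)..t, P.Cf z / P.Cf (z - P.c * (t - p)) *
    P.gbarS (z - P.c * (t - p)) (P.ev xh (p - t))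

/-- The observation error `|x̄(t) - H x̂(t)| + ‖v[t] - v̂[t]‖_∞` at time `t`. -/
def error (Ψ : Hist P.r (Eu l) → Hist P.r (St nb N₁ N₂))
    (xb : ℝ → Eu nb) (v : ℝ → ℝ → ℝ) (z : ℝ → Eu l) (t : ℝ) : ℝ :=
  ‖xb t - xPart (P.ev (Ψ (hist P.r z t)) 0)‖ +
    ‖prof (v t) - prof (P.vhat (Ψ (hist P.r z t)) t)‖

end Observer

end Loop

end SampledData

end

open Set SampledData

noncomputable section

namespace SampledData

/-! ### Absolutely continuous functions -/

/-! Along a characteristic of the transport equation, v/C has derivative ψ = ḡ/C. Integrating back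
to the boundary z = 0 or to time 0, where (A2) supplies a history on [-r, 0] generating the initial
profile, writes v[t] as the profile of the r-history of x = (x̄, η, λ), with η and λ the
measurements of v. The loop is thus the delay system ẋ = f(x_t, u) in disguise.
`IsPDESolution.eq_profile` and `exists_solution_of_delay` give the two directions, and
`IntegralForm.eqOn`, uniqueness for a Volterra equation, identifies every classical solution with
one trajectory x. The output is a linear map of x(t), with derivative R(x_t, u) along x.

For the observer, w is a noisy output with noise w - h(x_t). Between samples this noise equals
ξ(τ_i) + ∫ (R(Ψ(z_s), u) - R(x_s, u)) ds, and R is globally Lipschitz in the history, with constant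
L, by (A1) and (A3). In the weight exp(σt) the noise is therefore at most exp(σδ) (X + Lδ S), where
X and S are the weighted suprema of ξ and of the observer error. The robust observer estimate bounds
S by its initial term plus γ times the noise. When γLδ exp(σδ) ≤ 1/2 the term in S is absorbed, and
the rate ω = σ is kept (`IsPredictor.norm_sub_le`).

Existence needs care because F is merely continuous and one-sided Lipschitz. The observer hypothesis
yields a global z for every locally bounded input w; `eqOn_of_oneSided` and
`exists_modulus_of_oneSided` make z unique and continuous in w. Hence w ↦ R(Ψ(z_t), u) is a causal
continuous operator of linear growth with gain Lγ, but not a Lipschitz one. The equation for w is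
solved over each sampling interval by Tonelli's delayed approximations and Arzelà–Ascoli
(`CausalOp.exists_extension`). For a solution given on [0, T), the small-gain estimate bounds w, so
the same continuation applies (`exists_extension_of_isPredictor`). -/

theorem _root_.AbsolutelyContinuousOnInterval.of_dist_le {X Y : Type*} [PseudoMetricSpace X]
    [PseudoMetricSpace Y] {f : ℝ → X} {g : ℝ → Y} {a b K : ℝ}
    (hf : AbsolutelyContinuousOnInterval f a b)
    (h : ∀ s ∈ uIcc a b, ∀ t ∈ uIcc a b, dist (g s) (g t) ≤ K * dist (f s) (f t)) :
    AbsolutelyContinuousOnInterval g a b := by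
  unfold AbsolutelyContinuousOnInterval at hf ⊢
  refine squeeze_zero' (Eventually.of_forall fun _ => Finset.sum_nonneg fun _ _ => dist_nonneg) ?_
    (by simpa using hf.const_mul K)
  rw [eventually_inf_principal]
  filter_upwards with I hI
  rw [Finset.mul_sum]
  exact Finset.sum_le_sum fun i hi => h _ (hI.1 i hi).1 _ (hI.1 i hi).2

theorem ae_ne_real (a : ℝ) : ∀ᵐ t : ℝ, t ≠ a := by
  simp [ae_iff, measure_singleton]

/-- The primitive of the bounded function g is Lipschitz, so its difference with f is absolutely
continuous with derivative zero almost everywhere, hence constant. -/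
theorem _root_.AbsolutelyContinuousOnInterval.sub_eq_integral {E : Type*} [NormedAddCommGroup E]
    [NormedSpace ℝ E] [CompleteSpace E] {f g : ℝ → E} {a b M : ℝ} (hab : a ≤ b)
    (hf : AbsolutelyContinuousOnInterval f a b)
    (hg : ∀ᵐ t : ℝ, t ∈ Ioo a b → HasDerivAt f (g t) t)
    (hi : IntervalIntegrable g volume a b) (hM : ∀ t ∈ Icc a b, ‖g t‖ ≤ M) :
    f b - f a = ∫ t in a..b, g t := by
  have hsub : ∀ s ∈ uIcc a b, ∀ t ∈ uIcc a b, IntervalIntegrable g volume s t := fun s hs t ht =>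
    hi.mono_set (uIcc_subset_uIcc hs ht)
  have hac : AbsolutelyContinuousOnInterval (fun t => ∫ s in a..t, g s) a b := by
    have hlip : LipschitzOnWith (Real.toNNReal M) (fun t => ∫ s in a..t, g s) (uIcc a b) := by
      refine LipschitzOnWith.of_dist_le_mul fun s hs t ht => ?_
      have hM0 : 0 ≤ M := (norm_nonneg _).trans (hM a (left_mem_Icc.2 hab))
      rw [dist_comm, dist_eq_norm, intervalIntegral.integral_interval_sub_left
        (hsub _ left_mem_uIcc _ ht) (hsub _ left_mem_uIcc _ hs), Real.coe_toNNReal _ hM0,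
        dist_comm, Real.dist_eq]
      refine intervalIntegral.norm_integral_le_of_norm_le_const fun p hp => hM p ?_
      have := uIcc_subset_uIcc hs ht (uIoc_subset_uIcc hp)
      rwa [uIcc_of_le hab] at this
    exact hlip.absolutelyContinuousOnInterval
  obtain ⟨C, hC⟩ := (hf.sub hac).const_of_ae_hasDerivAt_zero (by
    filter_upwards [hg, hi.ae_hasDerivAt_integral, ae_ne_real a, ae_ne_real b]
      with t h1 h2 ha hb ht
    have ht' := ht
    rw [uIcc_of_le hab] at ht'
    have h3 := (h1 ⟨lt_of_le_of_ne ht'.1 ha.symm, lt_of_le_of_ne ht'.2 hb⟩).sub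
      (h2 ht a left_mem_uIcc)
    simpa using! h3)
  have h1 := hC a left_mem_uIcc
  have h2 := hC b right_mem_uIcc
  simp only [Pi.sub_apply, intervalIntegral.integral_same, sub_zero] at h1 h2
  rw [h1, ← h2]
  abel

/-- The fundamental theorem is applied to the real function ‖f‖², whose derivative is 2⟨f, f'⟩; only
an upper bound on this inner product is required, which is what a one-sided Lipschitz condition
provides. -/
theorem _root_.AbsolutelyContinuousOnInterval.normSq_sub_le {E : Type*} [NormedAddCommGroup E]
    [InnerProductSpace ℝ E] {f g : ℝ → E} {β : ℝ → ℝ} {a b : ℝ} (hab : a ≤ b)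
    (hf : AbsolutelyContinuousOnInterval f a b)
    (hg : ∀ᵐ t : ℝ, t ∈ Ioo a b → HasDerivAt f (g t) t)
    (hβ : IntervalIntegrable β volume a b)
    (hle : ∀ t ∈ Ioo a b, 2 * inner ℝ (f t) (g t) ≤ β t) :
    ‖f b‖ ^ 2 - ‖f a‖ ^ 2 ≤ ∫ t in a..b, β t := by
  obtain ⟨C, hC⟩ := hf.exists_bound
  have hac : AbsolutelyContinuousOnInterval (fun t => ‖f t‖ ^ 2) a b := by
    refine hf.of_dist_le (K := 2 * C) fun s hs t ht => ?_
    have h1 : |‖f s‖ - ‖f t‖| ≤ dist (f s) (f t) := by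
      rw [dist_eq_norm]; exact abs_norm_sub_norm_le _ _
    rw [Real.dist_eq, show ‖f s‖ ^ 2 - ‖f t‖ ^ 2 = (‖f s‖ + ‖f t‖) * (‖f s‖ - ‖f t‖) by ring, abs_mul,
      abs_of_nonneg (by positivity)]
    have := hC s hs
    have := hC t ht
    have := norm_nonneg (f s)
    have := norm_nonneg (f t)
    exact mul_le_mul (by linarith) h1 (abs_nonneg _) (by linarith)
  rw [← hac.integral_deriv_eq_sub]
  refine intervalIntegral.integral_mono_ae_restrict hab hac.intervalIntegrable_deriv hβ ?_
  rw [EventuallyLE, ae_restrict_iff' measurableSet_Icc]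
  filter_upwards [hg, ae_ne_real a, ae_ne_real b] with t h1 ha hb ht
  have ht' : t ∈ Ioo a b := ⟨lt_of_le_of_ne ht.1 ha.symm, lt_of_le_of_ne ht.2 hb⟩
  rw [(h1 ht').norm_sq.deriv]
  exact hle t ht'

/-! ### Histories -/

theorem exists_continuous_eqOn_Icc {E : Type*} [TopologicalSpace E] {x : ℝ → E} {a b : ℝ}
    (hab : a ≤ b) (hx : ContinuousOn x (Icc a b)) :
    ∃ y : ℝ → E, Continuous y ∧ EqOn y x (Icc a b) := by
  refine ⟨IccExtend hab ((Icc a b).domRestrict x), ?_, fun t ht => ?_⟩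
  · exact (continuousOn_iff_continuous_domRestrict.1 hx).Icc_extend'
  · rw [IccExtend_of_mem _ _ ht, domRestrict_apply]

section Hist

variable {E : Type*} [NormedAddCommGroup E] {r T t : ℝ} {x y : ℝ → E}

theorem hist_apply (hx : ContinuousOn x (Icc (t - r) t)) (θ : Icc (-r) (0 : ℝ)) :
    hist r x t θ = x (t + θ) := by
  refine restrictC_apply (f := fun θ => x (t + θ)) (hx.comp (by fun_prop) fun s hs => ?_) θ
  exact ⟨by linarith [hs.1], by linarith [hs.2]⟩

/-- No continuity is required: functions that agree on the window are both continuous there, or both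
give the placeholder. -/
theorem hist_congr (h : EqOn x y (Icc (t - r) t)) : hist r x t = hist r y t := by
  have h' : ∀ θ ∈ Icc (-r) 0, x (t + θ) = y (t + θ) := fun θ hθ =>
    h ⟨by linarith [hθ.1], by linarith [hθ.2]⟩
  by_cases hc : ContinuousOn (fun θ => x (t + θ)) (Icc (-r) 0)
  · have hc' : ContinuousOn (fun θ => y (t + θ)) (Icc (-r) 0) :=
      hc.congr fun θ hθ => (h' θ hθ).symm
    ext θ
    rw [hist, hist, restrictC_apply hc, restrictC_apply hc', h' θ θ.2]
  · have hc' : ¬ ContinuousOn (fun θ => y (t + θ)) (Icc (-r) 0) := fun hy =>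
      hc (hy.congr h')
    rw [hist, hist, restrictC, restrictC, dif_neg hc, dif_neg hc']

theorem norm_hist_le {M : ℝ} (hM : 0 ≤ M) (h : ∀ p ∈ Icc (t - r) t, ‖x p‖ ≤ M)
    (hx : ContinuousOn x (Icc (t - r) t)) : ‖hist r x t‖ ≤ M := by
  refine (ContinuousMap.norm_le _ hM).2 fun θ => ?_
  rw [hist_apply hx]
  exact h _ ⟨by linarith [θ.2.1], by linarith [θ.2.2]⟩

theorem norm_hist_sub_le {M : ℝ} (hM : 0 ≤ M) (h : ∀ p ∈ Icc (t - r) t, ‖x p - y p‖ ≤ M)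
    (hx : ContinuousOn x (Icc (t - r) t)) (hy : ContinuousOn y (Icc (t - r) t)) :
    ‖hist r x t - hist r y t‖ ≤ M := by
  refine (ContinuousMap.norm_le _ hM).2 fun θ => ?_
  rw [ContinuousMap.sub_apply, hist_apply hx, hist_apply hy]
  exact h _ ⟨by linarith [θ.2.1], by linarith [θ.2.2]⟩

theorem continuous_hist (hx : Continuous x) : Continuous (hist r x) := by
  let φ : C(ℝ × Icc (-r) (0 : ℝ), E) := ⟨fun p => x (p.1 + p.2), by fun_prop⟩
  have h : hist r x = φ.curry := by
    funext t
    ext θ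
    rw [hist_apply hx.continuousOn]
    rfl
  rw [h]
  exact φ.curry.continuous

/-- Near t the signal may be replaced by a globally continuous one that agrees with it up to some T'
> t. -/
theorem continuousOn_hist (hr : 0 ≤ r) (hx : ContinuousOn x (Ico (-r) T)) :
    ContinuousOn (hist r x) (Ico 0 T) := by
  intro t ht
  obtain ⟨T', h1, h2⟩ := exists_between ht.2
  obtain ⟨y, hy, hxy⟩ := exists_continuous_eqOn_Icc (a := -r) (b := T') (by linarith [ht.1])
    (hx.mono fun s hs => ⟨hs.1, hs.2.trans_lt h2⟩)
  refine ((continuous_hist (r := r) hy).continuousWithinAt (s := Ico 0 T)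
    (x := t)).congr_of_eventuallyEq ?_ ?_
  · have : Iio T' ∈ 𝓝[Ico 0 T] t := mem_nhdsWithin_of_mem_nhds (Iio_mem_nhds h1)
    filter_upwards [this, self_mem_nhdsWithin] with s hs hs0
    exact hist_congr fun p hp => (hxy ⟨by linarith [hp.1, hs0.1], hp.2.trans (le_of_lt hs)⟩).symm
  · exact hist_congr fun p hp => (hxy ⟨by linarith [hp.1, ht.1], hp.2.trans (le_of_lt h1)⟩).symm

end Hist

/-! ### A Gronwall argument with exponential weights -/

/-- By compactness S = max M(p) exp(-κp) is finite, and `H` at the maximiser gives S ≤ S/2 + ε. A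
large κ > 0 yields Gronwall-type uniqueness and dependence; κ = -σ yields the decay in the
small-gain estimate. -/
theorem le_of_weighted_contraction {M : ℝ → ℝ} {T κ ε : ℝ} (hM : ContinuousOn M (Icc 0 T))
    (hM0 : ∀ t ∈ Icc 0 T, 0 ≤ M t)
    (H : ∀ S, 0 ≤ S → (∀ p ∈ Icc 0 T, M p ≤ S * Real.exp (κ * p)) →
      ∀ t ∈ Icc 0 T, M t ≤ (S / 2 + ε) * Real.exp (κ * t)) :
    ∀ t ∈ Icc 0 T, M t ≤ 2 * ε * Real.exp (κ * t) := by
  intro t ht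
  have hc : ContinuousOn (fun p => M p * Real.exp (-(κ * p))) (Icc 0 T) :=
    hM.mul (by fun_prop)
  obtain ⟨p₀, hp₀, hmax⟩ := isCompact_Icc.exists_isMaxOn ⟨t, ht⟩ hc
  set S := M p₀ * Real.exp (-(κ * p₀)) with hS
  have hb : ∀ p ∈ Icc 0 T, M p ≤ S * Real.exp (κ * p) := fun p hp => by
    have h1 : M p * Real.exp (-(κ * p)) ≤ S := hmax hp
    calc M p = M p * Real.exp (-(κ * p)) * Real.exp (κ * p) := by
          rw [mul_assoc, ← Real.exp_add]; simp
      _ ≤ _ := by gcongr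
  have hS0 : 0 ≤ S := mul_nonneg (hM0 _ hp₀) (Real.exp_pos _).le
  have h1 : S ≤ S / 2 + ε := by
    calc S ≤ ((S / 2 + ε) * Real.exp (κ * p₀)) * Real.exp (-(κ * p₀)) := by
          rw [hS]; gcongr; exact H S hS0 hb _ hp₀
      _ = S / 2 + ε := by rw [mul_assoc, ← Real.exp_add]; simp
  have h2 : S ≤ 2 * ε := by linarith
  exact (hb t ht).trans (by gcongr)

/-- One integration in time costs a factor 1/κ in the weighted norm, which is what makes Volterra
operators contract. -/
theorem integral_exp_mul_le {κ : ℝ} (hκ : 0 < κ) (s t : ℝ) :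
    ∫ p in s..t, Real.exp (κ * p) ≤ Real.exp (κ * t) / κ := by
  rw [intervalIntegral.integral_comp_mul_left (fun p => Real.exp p) hκ.ne']
  simp only [integral_exp, smul_eq_mul]
  rw [div_eq_inv_mul]
  gcongr
  linarith [Real.exp_pos (κ * s)]

/-! ### Fading-memory suprema -/

section FadingSup

variable {E : Type*} [NormedAddCommGroup E] {ω t : ℝ} {ξ : ℝ → E}

/-- A real `sSup` is meaningful only for a bounded set, so local boundedness of the signal
accompanies every lower bound on `fadingSup`. -/
theorem bddAbove_fading {M : ℝ} (hω : 0 ≤ ω) (hξ : ∀ s ∈ Icc 0 t, ‖ξ s‖ ≤ M) :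
    BddAbove ((fun s => ‖ξ s‖ * Real.exp (-ω * (t - s))) '' Icc 0 t) := by
  refine ⟨M, ?_⟩
  rintro _ ⟨s, hs, rfl⟩
  have h1 : Real.exp (-ω * (t - s)) ≤ 1 := by
    rw [Real.exp_le_one_iff]
    nlinarith [hs.2]
  calc ‖ξ s‖ * Real.exp (-ω * (t - s)) ≤ ‖ξ s‖ * 1 := by gcongr
    _ ≤ M := by simpa using hξ s hs

theorem le_fadingSup {M : ℝ} (hω : 0 ≤ ω) (hξ : ∀ s ∈ Icc 0 t, ‖ξ s‖ ≤ M) {s : ℝ}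
    (hs : s ∈ Icc 0 t) : ‖ξ s‖ * Real.exp (-ω * (t - s)) ≤ fadingSup ω ξ t :=
  le_csSup (bddAbove_fading hω hξ) ⟨s, hs, rfl⟩

theorem fadingSup_le {B : ℝ} (ht : 0 ≤ t)
    (h : ∀ s ∈ Icc 0 t, ‖ξ s‖ * Real.exp (-ω * (t - s)) ≤ B) : fadingSup ω ξ t ≤ B := by
  refine csSup_le ⟨_, 0, ⟨le_rfl, ht⟩, rfl⟩ ?_
  rintro _ ⟨s, hs, rfl⟩
  exact h s hs

end FadingSup

/-! ### Parametric integrals along characteristics -/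

theorem hasFDerivAt_of_partials {k k₁ k₂ : ℝ → ℝ → ℝ}
    (h₁ : ∀ t y, HasDerivAt (fun t => k t y) (k₁ t y) t)
    (h₂ : ∀ t y, HasDerivAt (fun y => k t y) (k₂ t y) y)
    (c₁ : Continuous fun p : ℝ × ℝ => k₁ p.1 p.2) (c₂ : Continuous fun p : ℝ × ℝ => k₂ p.1 p.2)
    (p : ℝ × ℝ) :
    HasFDerivAt (fun p : ℝ × ℝ => k p.1 p.2)
      (k₁ p.1 p.2 • ContinuousLinearMap.fst ℝ ℝ ℝ + k₂ p.1 p.2 • ContinuousLinearMap.snd ℝ ℝ ℝ)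
      p := by
  have hs : Continuous fun a : ℝ => ContinuousLinearMap.toSpanSingleton ℝ a :=
    (ContinuousLinearMap.toSpanSingletonCLE (𝕜 := ℝ) (E := ℝ)).continuous
  have h := hasStrictFDerivAt_uncurry_coprod (𝕜 := ℝ) (u := p) (f := k)
    (f₁ := fun t y => ContinuousLinearMap.toSpanSingleton ℝ (k₁ t y))
    (f₂ := fun t y => ContinuousLinearMap.toSpanSingleton ℝ (k₂ t y))
    (Eventually.of_forall fun v => (h₁ v.1 v.2).hasFDerivAt)
    (Eventually.of_forall fun v => (h₂ v.1 v.2).hasFDerivAt)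
    (hs.comp c₁).continuousAt (hs.comp c₂).continuousAt
  have h' : HasFDerivAt (fun p : ℝ × ℝ => k p.1 p.2)
    ((ContinuousLinearMap.toSpanSingleton ℝ (k₁ p.1 p.2)).coprod
      (ContinuousLinearMap.toSpanSingleton ℝ (k₂ p.1 p.2))) p := h.hasFDerivAt
  refine h'.congr_fderiv ?_
  ext <;> simp

theorem contDiff_of_partials {k k₁ k₂ : ℝ → ℝ → ℝ}
    (h₁ : ∀ t y, HasDerivAt (fun t => k t y) (k₁ t y) t)
    (h₂ : ∀ t y, HasDerivAt (fun y => k t y) (k₂ t y) y)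
    (c₁ : Continuous fun p : ℝ × ℝ => k₁ p.1 p.2) (c₂ : Continuous fun p : ℝ × ℝ => k₂ p.1 p.2) :
    ContDiff ℝ 1 (fun p : ℝ × ℝ => k p.1 p.2) := by
  rw [contDiff_one_iff_fderiv]
  refine ⟨fun p => (hasFDerivAt_of_partials h₁ h₂ c₁ c₂ p).differentiableAt, ?_⟩
  rw [funext fun p => (hasFDerivAt_of_partials h₁ h₂ c₁ c₂ p).fderiv]
  exact (c₁.smul continuous_const).add (c₂.smul continuous_const)

section CharIntegral

variable {G G' : ℝ → ℝ → ℝ} (c : ℝ)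

/-- `∫₀ᵗ G(y + c p, p) dp`. -/
def charInt (G : ℝ → ℝ → ℝ) (c t y : ℝ) : ℝ := ∫ p in (0 : ℝ)..t, G (y + c * p) p

theorem continuous_charInt (hG : Continuous fun p : ℝ × ℝ => G p.1 p.2) :
    Continuous fun p : ℝ × ℝ => charInt G c p.1 p.2 := by
  refine intervalIntegral.continuous_parametric_intervalIntegral_of_continuous
    (f := fun (p : ℝ × ℝ) q => G (p.2 + c * q) q) ?_ continuous_fst
  exact hG.comp (f := fun q : (ℝ × ℝ) × ℝ => (q.1.2 + c * q.2, q.2)) (by fun_prop)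

theorem hasDerivAt_charInt_fst (hG : Continuous fun p : ℝ × ℝ => G p.1 p.2) (t y : ℝ) :
    HasDerivAt (fun t => charInt G c t y) (G (y + c * t) t) t := by
  have hc : Continuous fun p => G (y + c * p) p :=
    hG.comp (f := fun q : ℝ => (y + c * q, q)) (by fun_prop)
  exact intervalIntegral.integral_hasDerivAt_right (hc.intervalIntegrable _ _)
    hc.stronglyMeasurable.stronglyMeasurableAtFilter hc.continuousAt

/-- Differentiation under the integral; the dominating constant is the maximum of the derivative
over a compact neighbourhood. -/
theorem hasDerivAt_charInt_snd (hG : Continuous fun p : ℝ × ℝ => G p.1 p.2)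
    (hG' : Continuous fun p : ℝ × ℝ => G' p.1 p.2)
    (hd : ∀ s p, HasDerivAt (fun s => G s p) (G' s p) s) (t y : ℝ) :
    HasDerivAt (fun y => charInt G c t y) (charInt G' c t y) y := by
  have hc : ∀ y, Continuous fun p => G (y + c * p) p := fun y =>
    hG.comp (f := fun q : ℝ => (y + c * q, q)) (by fun_prop)
  have hc' : ∀ y, Continuous fun p => G' (y + c * p) p := fun y =>
    hG'.comp (f := fun q : ℝ => (y + c * q, q)) (by fun_prop)
  have hcc : Continuous fun q : ℝ × ℝ => G' (q.1 + c * q.2) q.2 :=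
    hG'.comp (f := fun q : ℝ × ℝ => (q.1 + c * q.2, q.2)) (by fun_prop)
  obtain ⟨B, hB⟩ := ((isCompact_closedBall y 1).prod (isCompact_uIcc (a := 0)
    (b := t))).exists_bound_of_continuousOn hcc.continuousOn
  refine (intervalIntegral.hasDerivAt_integral_of_dominated_loc_of_deriv_le
    (F := fun y p => G (y + c * p) p) (F' := fun y p => G' (y + c * p) p) (bound := fun _ => B)
    (Metric.closedBall_mem_nhds y one_pos) (Eventually.of_forall fun y =>
      (hc y).aestronglyMeasurable) ((hc y).intervalIntegrable _ _) (hc' y).aestronglyMeasurable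
    (Eventually.of_forall fun p hp y' hy' => hB (y', p) ⟨hy', uIoc_subset_uIcc hp⟩)
    intervalIntegrable_const (Eventually.of_forall fun p _ y' _ => ?_)).2
  have := (hd (y' + c * p) p).scomp y' ((hasDerivAt_id y').add_const (c * p))
  simpa [Function.comp_def] using this

end CharIntegral

/-! ### Components of the stacked state -/

section Components

variable {nb N₁ N₂ : ℕ}

theorem norm_le_sum_abs {ι : Type*} [Fintype ι] (x : EuclideanSpace ℝ ι) : ‖x‖ ≤ ∑ i, |x i| := by
  classical
  have h : x = ∑ i, x i • EuclideanSpace.single i (1 : ℝ) := by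
    ext j
    simp [Finset.sum_apply, Pi.single_apply]
  conv_lhs => rw [h]
  refine (norm_sum_le _ _).trans (Finset.sum_le_sum fun i _ => ?_)
  simp [norm_smul]

theorem abs_apply_le_norm {ι : Type*} [Fintype ι] (x : EuclideanSpace ℝ ι) (i : ι) :
    |x i| ≤ ‖x‖ := by
  simpa using PiLp.norm_apply_le x i

theorem norm_xPart_le (x : St nb N₁ N₂) : ‖xPart x‖ ≤ ‖x‖ := by
  rw [EuclideanSpace.norm_eq, EuclideanSpace.norm_eq]
  refine Real.sqrt_le_sqrt ?_
  rw [Fintype.sum_sum_type]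
  exact le_add_of_nonneg_right (by positivity)

theorem abs_ηPart_le (x : St nb N₁ N₂) (i : Fin N₁) : |ηPart x i| ≤ ‖x‖ :=
  abs_apply_le_norm x _

theorem abs_lPart_le (x : St nb N₁ N₂) (i : Fin N₂) : |lPart x i| ≤ ‖x‖ :=
  abs_apply_le_norm x _

theorem xPart_sub (x y : St nb N₁ N₂) : xPart (x - y) = xPart x - xPart y := rfl

theorem ηPart_sub (x y : St nb N₁ N₂) : ηPart (x - y) = ηPart x - ηPart y := rfl

theorem lPart_sub (x y : St nb N₁ N₂) : lPart (x - y) = lPart x - lPart y := rfl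

@[fun_prop]
theorem continuous_xPart : Continuous (xPart : St nb N₁ N₂ → Eu nb) := by
  unfold xPart
  fun_prop

theorem continuous_stack :
    Continuous fun p : Eu nb × Eu N₁ × Eu N₂ => stack p.1 p.2.1 p.2.2 := by
  unfold stack
  refine (PiLp.continuous_toLp 2 _).comp (continuous_pi fun i => ?_)
  rcases i with i | i | i <;> simp only [Sum.elim_inl, Sum.elim_inr] <;> fun_prop

theorem stack_sub (a a' : Eu nb) (b b' : Eu N₁) (d d' : Eu N₂) :
    stack a b d - stack a' b' d' = stack (a - a') (b - b') (d - d') := by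
  ext i
  rcases i with i | i | i <;> rfl

theorem norm_stack_le (a : Eu nb) (b : Eu N₁) (d : Eu N₂) :
    ‖stack a b d‖ ≤ ‖a‖ + ‖b‖ + ‖d‖ := by
  have h : ‖stack a b d‖ ^ 2 = ‖a‖ ^ 2 + (‖b‖ ^ 2 + ‖d‖ ^ 2) := by
    rw [EuclideanSpace.norm_sq_eq, EuclideanSpace.norm_sq_eq, EuclideanSpace.norm_sq_eq,
      EuclideanSpace.norm_sq_eq, Fintype.sum_sum_type, Fintype.sum_sum_type]
    rfl
  refine abs_le_of_sq_le_sq' ?_ (by positivity) |>.2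
  rw [h]
  nlinarith [norm_nonneg a, norm_nonneg b, norm_nonneg d, mul_nonneg (norm_nonneg a) (norm_nonneg b),
    mul_nonneg (norm_nonneg a) (norm_nonneg d), mul_nonneg (norm_nonneg b) (norm_nonneg d)]

end Components

/-! ### Extending data from [0, 1] to the real line -/

/-- The projection of `ℝ` onto `[0, 1]`. -/
def unitClamp (s : ℝ) : ℝ := max 0 (min 1 s)

@[fun_prop]
theorem continuous_unitClamp : Continuous unitClamp := by
  unfold unitClamp
  fun_prop

theorem unitClamp_mem (s : ℝ) : unitClamp s ∈ Icc (0 : ℝ) 1 :=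
  ⟨le_max_left _ _, max_le zero_le_one (min_le_left _ _)⟩

theorem unitClamp_of_mem {s : ℝ} (hs : s ∈ Icc (0 : ℝ) 1) : unitClamp s = s := by
  rw [unitClamp, min_eq_right hs.2, max_eq_right hs.1]

/-- The coefficients are controlled on [0, 1] only. Clamping the argument makes them continuous on
ℝ, so that two-sided derivatives and parametric integrals can be used throughout. -/
theorem continuous_comp_unitClamp {f : ℝ → ℝ} (hf : ContinuousOn f (Icc 0 1)) :
    Continuous fun s => f (unitClamp s) :=
  hf.comp_continuous continuous_unitClamp unitClamp_mem

theorem exists_common_bound {ι : Type*} [Finite ι] {f : ι → ℝ → ℝ}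
    (hf : ∀ i, ContinuousOn (f i) (Icc 0 1)) :
    ∃ B : ℝ, 0 ≤ B ∧ ∀ i, ∀ z ∈ Icc (0 : ℝ) 1, |f i z| ≤ B := by
  have := Fintype.ofFinite ι
  choose B hB using fun i => isCompact_Icc.exists_bound_of_continuousOn (hf i)
  have hB0 : ∀ i, 0 ≤ B i := fun i => (norm_nonneg _).trans (hB i 0 ⟨le_rfl, zero_le_one⟩)
  refine ⟨∑ i, B i, Finset.sum_nonneg fun i _ => hB0 i, fun i z hz => (hB i z hz).trans ?_⟩
  exact Finset.single_le_sum (fun j _ => hB0 j) (Finset.mem_univ i)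

namespace Loop

variable {nb N₁ N₂ m k : ℕ} (P : Loop nb N₁ N₂ m k)

theorem r_pos : 0 < P.r := inv_pos.2 P.c_pos

theorem r_mul_c : P.r * P.c = 1 := inv_mul_cancel₀ P.c_pos.ne'

/-! ### The integrating factor -/

/-- An extension of `C` to the real line. -/
def CE (z : ℝ) : ℝ := Real.exp (P.r * ∫ s in (0 : ℝ)..z, P.a (unitClamp s))

theorem CE_pos (z : ℝ) : 0 < P.CE z := Real.exp_pos _

theorem CE_zero : P.CE 0 = 1 := by simp [CE]

theorem CE_eq {z : ℝ} (hz : z ∈ Icc (0 : ℝ) 1) : P.CE z = P.Cf z := by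
  unfold CE Cf
  congr 2
  refine intervalIntegral.integral_congr fun s hs => ?_
  rw [uIcc_of_le hz.1] at hs
  simp only [unitClamp_of_mem ⟨hs.1, hs.2.trans hz.2⟩]

theorem hasDerivAt_CE (z : ℝ) :
    HasDerivAt P.CE (P.CE z * (P.r * P.a (unitClamp z))) z := by
  have hc := continuous_comp_unitClamp P.a_cont
  exact (((intervalIntegral.integral_hasDerivAt_right (hc.intervalIntegrable 0 z)
    hc.stronglyMeasurable.stronglyMeasurableAtFilter hc.continuousAt).const_mul P.r).exp)

@[fun_prop]
theorem continuous_CE : Continuous P.CE :=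
  continuous_iff_continuousAt.2 fun z => (P.hasDerivAt_CE z).continuousAt

theorem contDiff_CE : ContDiff ℝ 1 P.CE := by
  rw [contDiff_one_iff_deriv]
  refine ⟨fun z => (P.hasDerivAt_CE z).differentiableAt, ?_⟩
  rw [funext fun z => (P.hasDerivAt_CE z).deriv]
  exact P.continuous_CE.mul (continuous_const.mul (continuous_comp_unitClamp P.a_cont))

/-! ### Regularity of the source terms -/

variable {P}

theorem continuousOn_b (i : Fin N₁) : ContinuousOn (P.b i) (Icc 0 1) := (P.b_C1 i).continuousOn

theorem continuousOn_β (i : Fin N₂) : ContinuousOn (P.β i) (Icc 0 1) := (P.β_C1 i).continuousOn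

theorem continuousOn_db (i : Fin N₁) :
    ContinuousOn (fun z => P.a z * P.b i z - P.c * derivWithin (P.b i) (Icc 0 1) z) (Icc 0 1) :=
  (P.a_cont.mul (continuousOn_b i)).sub (continuousOn_const.mul
    ((P.b_C1 i).continuousOn_derivWithin (uniqueDiffOn_Icc zero_lt_one) le_rfl))

theorem continuousOn_dβ (i : Fin N₂) :
    ContinuousOn (fun z => P.a z * P.β i z - P.c * derivWithin (P.β i) (Icc 0 1) z) (Icc 0 1) :=
  (P.a_cont.mul (continuousOn_β i)).sub (continuousOn_const.mul
    ((P.β_C1 i).continuousOn_derivWithin (uniqueDiffOn_Icc zero_lt_one) le_rfl))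

theorem hasDerivWithinAt_g (hA1 : P.A1) {z : ℝ} (hz : z ∈ Icc (0 : ℝ) 1) (x : Eu nb) :
    HasDerivWithinAt (fun s => P.g s x) (fderivWithin ℝ (fun p : ℝ × Eu nb => P.g p.1 p.2)
      (Icc 0 1 ×ˢ univ) (z, x) (1, 0)) (Icc 0 1) z := by
  have hm : (z, x) ∈ Icc (0 : ℝ) 1 ×ˢ (univ : Set (Eu nb)) := ⟨hz, mem_univ _⟩
  have h1 := (hA1.g_C1.differentiableOn one_ne_zero (z, x) hm).hasFDerivWithinAt
  have h2 : HasDerivWithinAt (fun s : ℝ => (s, x)) (1, 0) (Icc 0 1) z :=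
    (hasDerivWithinAt_id z _).prodMk (hasDerivWithinAt_const z _ x)
  have h3 : MapsTo (fun s : ℝ => (s, x)) (Icc 0 1) (Icc (0 : ℝ) 1 ×ˢ (univ : Set (Eu nb))) :=
    fun s hs => ⟨hs, mem_univ _⟩
  exact h1.comp_hasDerivWithinAt z h2 h3

theorem gz_eq (hA1 : P.A1) {z : ℝ} (hz : z ∈ Icc (0 : ℝ) 1) (x : Eu nb) :
    P.gz z x = fderivWithin ℝ (fun p : ℝ × Eu nb => P.g p.1 p.2) (Icc 0 1 ×ˢ univ) (z, x) (1, 0) :=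
  (hasDerivWithinAt_g hA1 hz x).derivWithin (uniqueDiffOn_Icc zero_lt_one z hz)

/-- `gz` is defined for one x̄ at a time; joint continuity comes from reading it as the derivative
of the C¹ map g within [0, 1] × ℝⁿ̄, applied to (1, 0). -/
theorem continuous_gz (hA1 : P.A1) :
    Continuous fun p : ℝ × Eu nb => P.gz (unitClamp p.1) p.2 := by
  have h1 := hA1.g_C1.continuousOn_fderivWithin
    ((uniqueDiffOn_Icc zero_lt_one).prod uniqueDiffOn_univ) le_rfl
  have h2 : Continuous fun p : ℝ × Eu nb => fderivWithin ℝ (fun p : ℝ × Eu nb => P.g p.1 p.2)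
      (Icc 0 1 ×ˢ univ) (unitClamp p.1, p.2) :=
    h1.comp_continuous (by fun_prop) fun p => ⟨unitClamp_mem _, mem_univ _⟩
  rw [funext fun p : ℝ × Eu nb => gz_eq hA1 (unitClamp_mem p.1) p.2]
  fun_prop

theorem continuous_gE (hA1 : P.A1) :
    Continuous fun p : ℝ × Eu nb => P.g (unitClamp p.1) p.2 :=
  hA1.g_C1.continuousOn.comp_continuous (f := fun p : ℝ × Eu nb => (unitClamp p.1, p.2))
    (by fun_prop) fun p => ⟨unitClamp_mem _, mem_univ _⟩

theorem continuous_gbarE (hA1 : P.A1) :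
    Continuous fun p : ℝ × St nb N₁ N₂ => P.gbarS (unitClamp p.1) p.2 := by
  have h0 : Continuous fun p : ℝ × St nb N₁ N₂ => P.g (unitClamp p.1) (xPart p.2) :=
    (continuous_gE hA1).comp (f := fun p : ℝ × St nb N₁ N₂ => (p.1, xPart p.2)) (by fun_prop)
  have h1 := fun i => continuous_comp_unitClamp (continuousOn_b (P := P) i)
  have h2 := fun i => continuous_comp_unitClamp (continuousOn_β (P := P) i)
  unfold gbarS gbar
  refine (h0.add (continuous_finsetSum _ fun i _ => ?_)).add
    (continuous_finsetSum _ fun i _ => ?_)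
  · exact ((h1 i).comp continuous_fst).mul (by fun_prop)
  · exact ((h2 i).comp continuous_fst).mul (by fun_prop)

theorem continuous_gtildeE (hA1 : P.A1) :
    Continuous fun p : ℝ × St nb N₁ N₂ => P.gtildeS (unitClamp p.1) p.2 := by
  have h0 : Continuous fun p : ℝ × St nb N₁ N₂ => P.g (unitClamp p.1) (xPart p.2) :=
    (continuous_gE hA1).comp (f := fun p : ℝ × St nb N₁ N₂ => (p.1, xPart p.2)) (by fun_prop)
  have h0' : Continuous fun p : ℝ × St nb N₁ N₂ => P.gz (unitClamp p.1) (xPart p.2) :=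
    (continuous_gz hA1).comp (f := fun p : ℝ × St nb N₁ N₂ => (p.1, xPart p.2)) (by fun_prop)
  have h1 := fun i => continuous_comp_unitClamp (continuousOn_db (P := P) i)
  have h2 := fun i => continuous_comp_unitClamp (continuousOn_dβ (P := P) i)
  have h3 := continuous_comp_unitClamp P.a_cont
  unfold gtildeS
  refine (((((h3.comp continuous_fst).mul h0).sub (continuous_const.mul h0')).add
    (continuous_finsetSum _ fun i _ => ?_)).add (continuous_finsetSum _ fun i _ => ?_))
  · exact ((h1 i).comp continuous_fst).mul (by fun_prop)
  · exact ((h2 i).comp continuous_fst).mul (by fun_prop)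

theorem exists_lipschitz_gbarS (hA1 : P.A1) : ∃ L : ℝ, 0 ≤ L ∧ ∀ z ∈ Icc (0 : ℝ) 1,
    ∀ x y : St nb N₁ N₂, |P.gbarS z x - P.gbarS z y| ≤ L * ‖x - y‖ := by
  obtain ⟨L, hL, -, hg⟩ := hA1.lipschitz
  obtain ⟨B, hB0, hB⟩ := exists_common_bound (continuousOn_b (P := P))
  obtain ⟨B', hB0', hB'⟩ := exists_common_bound (continuousOn_β (P := P))
  refine ⟨L + N₁ * B + N₂ * B', by positivity, fun z hz x y => ?_⟩
  have e : P.gbarS z x - P.gbarS z y = (P.g z (xPart x) - P.g z (xPart y)) +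
      ∑ i, P.b i z * ηPart (x - y) i + ∑ i, P.β i z * lPart (x - y) i := by
    simp only [gbarS, gbar, ηPart_sub, lPart_sub, PiLp.sub_apply, mul_sub, Finset.sum_sub_distrib]
    ring
  have h1 : |P.g z (xPart x) - P.g z (xPart y)| ≤ L * ‖x - y‖ := by
    refine (hg _ _ z hz).trans ?_
    rw [← xPart_sub]
    gcongr
    exact norm_xPart_le _
  have h2 : |∑ i, P.b i z * ηPart (x - y) i| ≤ N₁ * B * ‖x - y‖ := by
    refine (Finset.abs_sum_le_sum_abs _ _).trans ((Finset.sum_le_sum fun i _ => ?_).trans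
      (b := ∑ _i : Fin N₁, B * ‖x - y‖) (by simp [mul_assoc]))
    rw [abs_mul]
    exact mul_le_mul (hB i z hz) (abs_ηPart_le _ _) (abs_nonneg _) hB0
  have h3 : |∑ i, P.β i z * lPart (x - y) i| ≤ N₂ * B' * ‖x - y‖ := by
    refine (Finset.abs_sum_le_sum_abs _ _).trans ((Finset.sum_le_sum fun i _ => ?_).trans
      (b := ∑ _i : Fin N₂, B' * ‖x - y‖) (by simp [mul_assoc]))
    rw [abs_mul]
    exact mul_le_mul (hB' i z hz) (abs_lPart_le _ _) (abs_nonneg _) hB0'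
  rw [e]
  refine (abs_add_three _ _ _).trans ?_
  linarith

/-- This is the only point at which (A3) is opened: `gtildeS` contains ∂g/∂z, which (A1) alone does
not make globally Lipschitz. -/
theorem exists_lipschitz_gtildeS (hA1 : P.A1) (hA3 : P.A3) : ∃ L : ℝ, 0 ≤ L ∧
    ∀ z ∈ Icc (0 : ℝ) 1, ∀ x y : St nb N₁ N₂, |P.gtildeS z x - P.gtildeS z y| ≤ L * ‖x - y‖ := by
  obtain ⟨L, hL, -, hg⟩ := hA1.lipschitz
  obtain ⟨L', hL', hgz⟩ := hA3
  obtain ⟨A, hA⟩ := isCompact_Icc.exists_bound_of_continuousOn P.a_cont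
  have hA0 : 0 ≤ A := (norm_nonneg _).trans (hA 0 ⟨le_rfl, zero_le_one⟩)
  obtain ⟨B, hB0, hB⟩ := exists_common_bound (continuousOn_db (P := P))
  obtain ⟨B', hB0', hB'⟩ := exists_common_bound (continuousOn_dβ (P := P))
  have hc := P.c_pos
  refine ⟨A * L + P.c * L' + N₁ * B + N₂ * B', by positivity, fun z hz x y => ?_⟩
  have e : P.gtildeS z x - P.gtildeS z y = P.a z * (P.g z (xPart x) - P.g z (xPart y)) -
      P.c * (P.gz z (xPart x) - P.gz z (xPart y)) +
      ∑ i, (P.a z * P.b i z - P.c * derivWithin (P.b i) (Icc 0 1) z) * ηPart (x - y) i +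
      ∑ i, (P.a z * P.β i z - P.c * derivWithin (P.β i) (Icc 0 1) z) * lPart (x - y) i := by
    simp only [gtildeS, ηPart_sub, lPart_sub, PiLp.sub_apply, mul_sub, Finset.sum_sub_distrib]
    ring
  have h0 : |P.a z * (P.g z (xPart x) - P.g z (xPart y))| ≤ A * (L * ‖x - y‖) := by
    rw [abs_mul]
    refine mul_le_mul (hA z hz) ((hg _ _ z hz).trans ?_) (abs_nonneg _) hA0
    rw [← xPart_sub]
    gcongr
    exact norm_xPart_le _
  have h1 : |P.c * (P.gz z (xPart x) - P.gz z (xPart y))| ≤ P.c * (L' * ‖x - y‖) := by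
    rw [abs_mul, abs_of_pos hc]
    refine mul_le_mul_of_nonneg_left ((hgz _ _ z hz).trans ?_) hc.le
    rw [← xPart_sub]
    gcongr
    exact norm_xPart_le _
  have h2 : |∑ i, (P.a z * P.b i z - P.c * derivWithin (P.b i) (Icc 0 1) z) * ηPart (x - y) i|
      ≤ N₁ * B * ‖x - y‖ := by
    refine (Finset.abs_sum_le_sum_abs _ _).trans ((Finset.sum_le_sum fun i _ => ?_).trans
      (b := ∑ _i : Fin N₁, B * ‖x - y‖) (by simp [mul_assoc]))
    rw [abs_mul]
    exact mul_le_mul (hB i z hz) (abs_ηPart_le _ _) (abs_nonneg _) hB0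
  have h3 : |∑ i, (P.a z * P.β i z - P.c * derivWithin (P.β i) (Icc 0 1) z) * lPart (x - y) i|
      ≤ N₂ * B' * ‖x - y‖ := by
    refine (Finset.abs_sum_le_sum_abs _ _).trans ((Finset.sum_le_sum fun i _ => ?_).trans
      (b := ∑ _i : Fin N₂, B' * ‖x - y‖) (by simp [mul_assoc]))
    rw [abs_mul]
    exact mul_le_mul (hB' i z hz) (abs_lPart_le _ _) (abs_nonneg _) hB0'
  rw [e]
  have := abs_sub (P.a z * (P.g z (xPart x) - P.g z (xPart y)))
    (P.c * (P.gz z (xPart x) - P.gz z (xPart y)))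
  refine (abs_add_three _ _ _).trans ?_
  linarith

/-! ### The normalised source term -/

variable (P) in
/-- The derivative `∂ψ/∂s` of `ψ(s, x) = ḡ(s, x) / C(s)`, extended continuously from `[0, 1]`. -/
def psiD (s : ℝ) (x : St nb N₁ N₂) : ℝ := -(P.r * P.gtildeS (unitClamp s) x / P.CE s)

variable (P) in
/-- A `C¹` extension in `s` of `ψ(s, x) = ḡ(s, x) / C(s)` from `[0, 1]` to the real line. -/
def psi (s : ℝ) (x : St nb N₁ N₂) : ℝ := P.gbarS 0 x + ∫ σ in (0 : ℝ)..s, P.psiD σ x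

theorem continuous_psiD (hA1 : P.A1) :
    Continuous fun p : ℝ × St nb N₁ N₂ => P.psiD p.1 p.2 := by
  unfold psiD
  have := continuous_gtildeE hA1
  refine (Continuous.div (by fun_prop) (by fun_prop) fun p => (P.CE_pos _).ne').neg

theorem continuous_psi (hA1 : P.A1) :
    Continuous fun p : ℝ × St nb N₁ N₂ => P.psi p.1 p.2 := by
  unfold psi
  have h0 : Continuous fun x : St nb N₁ N₂ => P.gbarS 0 x := by
    have := (continuous_gbarE hA1).comp (f := fun x : St nb N₁ N₂ => ((0 : ℝ), x)) (by fun_prop)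
    simpa only [Function.comp_def, unitClamp_of_mem (left_mem_Icc.2 (zero_le_one' ℝ))] using this
  refine (h0.comp continuous_snd).add ?_
  refine intervalIntegral.continuous_parametric_intervalIntegral_of_continuous
    (f := fun (p : ℝ × St nb N₁ N₂) σ => P.psiD σ p.2) ?_ continuous_fst
  exact (continuous_psiD hA1).comp (f := fun q : (ℝ × St nb N₁ N₂) × ℝ => (q.2, q.1.2))
    (by fun_prop)

theorem hasDerivAt_psi (hA1 : P.A1) (s : ℝ) (x : St nb N₁ N₂) :
    HasDerivAt (fun s => P.psi s x) (P.psiD s x) s := by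
  have hc : Continuous fun s => P.psiD s x :=
    (continuous_psiD hA1).comp (f := fun s : ℝ => (s, x)) (by fun_prop)
  exact (intervalIntegral.integral_hasDerivAt_right (hc.intervalIntegrable 0 s)
    hc.stronglyMeasurable.stronglyMeasurableAtFilter hc.continuousAt).const_add _

theorem hasDerivAt_gbarS (hA1 : P.A1) {z : ℝ} (hz : z ∈ Ioo (0 : ℝ) 1) (x : St nb N₁ N₂) :
    HasDerivAt (fun z => P.gbarS z x) (P.gz z (xPart x) +
      ∑ i, derivWithin (P.b i) (Icc 0 1) z * ηPart x i +
      ∑ i, derivWithin (P.β i) (Icc 0 1) z * lPart x i) z := by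
  have hn : Icc (0 : ℝ) 1 ∈ 𝓝 z := Icc_mem_nhds hz.1 hz.2
  have hz' := Ioo_subset_Icc_self hz
  have h0 := (hasDerivWithinAt_g hA1 hz' (xPart x)).hasDerivAt hn
  rw [← gz_eq hA1 hz'] at h0
  have h1 : ∀ i, HasDerivAt (P.b i) (derivWithin (P.b i) (Icc 0 1) z) z := fun i =>
    (((P.b_C1 i).differentiableOn one_ne_zero z hz').hasDerivWithinAt).hasDerivAt hn
  have h2 : ∀ i, HasDerivAt (P.β i) (derivWithin (P.β i) (Icc 0 1) z) z := fun i =>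
    (((P.β_C1 i).differentiableOn one_ne_zero z hz').hasDerivWithinAt).hasDerivAt hn
  unfold gbarS gbar
  exact (h0.add (HasDerivAt.fun_sum fun i _ => (h1 i).mul_const _)).add
    (HasDerivAt.fun_sum fun i _ => (h2 i).mul_const _)

/-- Since rc = 1, the derivative of ḡ/C is (∂ḡ/∂z - r a ḡ)/C = -r g̃/C, which is `psiD`; and C(0) =
1 fixes the constant. Defining `psi` as a primitive, and not as the quotient, makes it
differentiable in s on the whole line. -/
theorem psi_eq (hA1 : P.A1) {s : ℝ} (hs : s ∈ Icc (0 : ℝ) 1) (x : St nb N₁ N₂) :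
    P.psi s x = P.gbarS s x / P.CE s := by
  have hc : Continuous fun s => P.psiD s x :=
    (continuous_psiD hA1).comp (f := fun s : ℝ => (s, x)) (by fun_prop)
  have hcg : Continuous fun s => P.gbarS (unitClamp s) x :=
    (continuous_gbarE hA1).comp (f := fun s : ℝ => (s, x)) (by fun_prop)
  have h := intervalIntegral.integral_eq_sub_of_hasDerivAt_of_le (a := 0) (b := s)
    (f := fun s => P.gbarS s x / P.CE s) (f' := fun s => P.psiD s x) hs.1 ?_ ?_
    (hc.intervalIntegrable _ _)
  · rw [psi, h, P.CE_zero]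
    ring
  · refine ContinuousOn.div (hcg.continuousOn.congr fun z hz => ?_) P.continuous_CE.continuousOn
      fun z _ => (P.CE_pos z).ne'
    simp only [unitClamp_of_mem ⟨hz.1, hz.2.trans hs.2⟩]
  · intro z hz
    have hz1 : z ∈ Ioo (0 : ℝ) 1 := ⟨hz.1, hz.2.trans_le hs.2⟩
    have hz2 := unitClamp_of_mem (Ioo_subset_Icc_self hz1)
    refine ((hasDerivAt_gbarS hA1 hz1 x).div (P.hasDerivAt_CE z) (P.CE_pos z).ne').congr_deriv ?_
    have hC := (P.CE_pos z).ne'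
    have hrc := P.r_mul_c
    rw [psiD, hz2]
    simp only [gtildeS, gbarS, gbar, sub_mul, Finset.sum_sub_distrib, mul_assoc,
      ← Finset.mul_sum]
    field_simp
    linear_combination (-P.gz z (xPart x) - ∑ i, derivWithin (P.b i) (Icc 0 1) z * ηPart x i -
      ∑ i, derivWithin (P.β i) (Icc 0 1) z * lPart x i) * hrc

theorem psiD_eq {s : ℝ} (hs : s ∈ Icc (0 : ℝ) 1) (x : St nb N₁ N₂) :
    P.c * P.psiD s x = -(P.gtildeS s x / P.CE s) := by
  rw [psiD, unitClamp_of_mem hs]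
  linear_combination (-(P.gtildeS s x / P.CE s)) * P.r_mul_c

end Loop

/-! ### Continuous profiles -/

theorem prof_apply {f : ℝ → ℝ} (hf : ContinuousOn f (Icc 0 1)) (z : Icc (0 : ℝ) 1) :
    prof f z = f z := restrictC_apply hf z

theorem prof_congr {f f' : ℝ → ℝ} (h : EqOn f f' (Icc 0 1)) : prof f = prof f' := by
  by_cases hf : ContinuousOn f (Icc 0 1)
  · have hf' : ContinuousOn f' (Icc 0 1) := hf.congr fun z hz => (h hz).symm
    ext z
    rw [prof_apply hf, prof_apply hf', h z.2]
  · have hf' : ¬ ContinuousOn f' (Icc 0 1) := fun h' => hf (h'.congr h)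
    rw [prof, prof, restrictC, restrictC, dif_neg hf, dif_neg hf']

theorem norm_prof_sub_le {f f' : ℝ → ℝ} {M : ℝ} (hf : ContinuousOn f (Icc 0 1))
    (hf' : ContinuousOn f' (Icc 0 1)) (hM : 0 ≤ M) (h : ∀ z ∈ Icc (0 : ℝ) 1, |f z - f' z| ≤ M) :
    ‖prof f - prof f'‖ ≤ M := by
  refine (ContinuousMap.norm_le _ hM).2 fun z => ?_
  rw [ContinuousMap.sub_apply, prof_apply hf, prof_apply hf']
  exact h z z.2

namespace Loop

variable {nb N₁ N₂ m k : ℕ} (P : Loop nb N₁ N₂ m k)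

theorem ev_of_mem {E : Type*} [NormedAddCommGroup E] (φ : Hist P.r E) {p : ℝ}
    (hp : p ∈ Icc (-P.r) 0) : P.ev φ p = φ ⟨p, hp⟩ := IccExtend_of_mem _ _ hp

theorem continuous_ev {E : Type*} [NormedAddCommGroup E] (φ : Hist P.r E) :
    Continuous (P.ev φ) := φ.continuous.Icc_extend'

theorem norm_ev_sub_le {E : Type*} [NormedAddCommGroup E] (φ φ' : Hist P.r E) (p : ℝ) :
    ‖P.ev φ p - P.ev φ' p‖ ≤ ‖φ - φ'‖ :=
  (φ - φ').norm_coe_le_norm (projIcc _ _ P.neg_r_le p)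

theorem ev_hist {E : Type*} [NormedAddCommGroup E] {x : ℝ → E} {t p : ℝ}
    (hx : ContinuousOn x (Icc (t - P.r) t)) (hp : p ∈ Icc (-P.r) 0) :
    P.ev (hist P.r x t) p = x (t + p) := by
  rw [ev_of_mem _ _ hp, hist_apply hx]

/-! ### The profile generated by a history, and its rate of change -/

/-- The profile `v(z) = ∫_{-rz}^0 C(z) / C(cp + z) ḡ(cp + z, x(p)) dp` generated by a history. -/
def profile (φ : Hist P.r (St nb N₁ N₂)) (z : ℝ) : ℝ :=
  ∫ p in (-(P.r * z))..0, P.Cf z / P.Cf (P.c * p + z) * P.gbarS (P.c * p + z) (P.ev φ p)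

/-- The time derivative at `z` of the profile generated by the current history. -/
def rate (φ : Hist P.r (St nb N₁ N₂)) (z : ℝ) : ℝ :=
  P.gbarS z (P.ev φ 0) - P.Cf z * P.gbarS 0 (P.ev φ (-(P.r * z))) +
    ∫ p in (-(P.r * z))..0, P.Cf z / P.Cf (z + P.c * p) * P.gtildeS (z + P.c * p) (P.ev φ p)

variable {P}

theorem mem_Icc_of_mem {z p : ℝ} (hz : z ∈ Icc (0 : ℝ) 1) (hp : p ∈ Icc (-(P.r * z)) 0) :
    z + P.c * p ∈ Icc (0 : ℝ) 1 := by
  have h1 := P.r_mul_c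
  have h2 := P.c_pos
  have h3 : P.c * (-(P.r * z)) ≤ P.c * p := mul_le_mul_of_nonneg_left hp.1 h2.le
  have h4 : P.c * p ≤ 0 := mul_nonpos_of_nonneg_of_nonpos h2.le hp.2
  have h5 : P.c * (-(P.r * z)) = -z := by linear_combination -z * h1
  exact ⟨by linarith, by linarith [hz.2]⟩

theorem neg_r_mul_mem {z : ℝ} (hz : z ∈ Icc (0 : ℝ) 1) : -(P.r * z) ∈ Icc (-P.r) 0 := by
  have := P.r_pos
  exact ⟨by nlinarith [hz.2], by nlinarith [hz.1]⟩

theorem profile_eq (hA1 : P.A1) (φ : Hist P.r (St nb N₁ N₂)) {z : ℝ} (hz : z ∈ Icc (0 : ℝ) 1) :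
    P.profile φ z = P.CE z * ∫ p in (-(P.r * z))..0, P.psi (z + P.c * p) (P.ev φ p) := by
  rw [profile, ← intervalIntegral.integral_const_mul]
  refine intervalIntegral.integral_congr fun p hp => ?_
  rw [uIcc_of_le (neg_r_mul_mem hz).2] at hp
  have h := mem_Icc_of_mem hz hp
  simp only [psi_eq hA1 h, add_comm (P.c * p) z, P.CE_eq hz, P.CE_eq h]
  ring

/-- The g̃ term of the rate is the integral of c ∂ψ/∂s up to sign, so the rate involves only `psi`
and `psiD`, both jointly continuous everywhere. -/
theorem rate_eq (hA1 : P.A1) (φ : Hist P.r (St nb N₁ N₂)) {z : ℝ} (hz : z ∈ Icc (0 : ℝ) 1) :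
    P.rate φ z = P.CE z * (P.psi z (P.ev φ 0) - P.psi 0 (P.ev φ (-(P.r * z))) -
      P.c * ∫ p in (-(P.r * z))..0, P.psiD (z + P.c * p) (P.ev φ p)) := by
  have hC := (P.CE_pos z).ne'
  have e : ∫ p in (-(P.r * z))..0, P.Cf z / P.Cf (z + P.c * p) * P.gtildeS (z + P.c * p) (P.ev φ p)
      = -(P.CE z * (P.c * ∫ p in (-(P.r * z))..0, P.psiD (z + P.c * p) (P.ev φ p))) := by
    rw [← intervalIntegral.integral_const_mul, ← intervalIntegral.integral_const_mul,
      ← intervalIntegral.integral_neg]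
    refine intervalIntegral.integral_congr fun p hp => ?_
    rw [uIcc_of_le (neg_r_mul_mem hz).2] at hp
    have h := mem_Icc_of_mem hz hp
    simp only [psiD_eq h, ← P.CE_eq hz, ← P.CE_eq h]
    ring
  rw [rate, e, psi_eq hA1 hz, psi_eq hA1 ⟨le_rfl, zero_le_one⟩, P.CE_zero, ← P.CE_eq hz]
  field_simp
  ring

theorem continuous_psi_ev (hA1 : P.A1) (φ : Hist P.r (St nb N₁ N₂)) :
    Continuous fun q : ℝ × ℝ => P.psi (q.1 + P.c * q.2) (P.ev φ q.2) :=
  (continuous_psi hA1).comp (f := fun q : ℝ × ℝ => (q.1 + P.c * q.2, P.ev φ q.2))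
    (by have := P.continuous_ev φ; fun_prop)

theorem continuous_psiD_ev (hA1 : P.A1) (φ : Hist P.r (St nb N₁ N₂)) :
    Continuous fun q : ℝ × ℝ => P.psiD (q.1 + P.c * q.2) (P.ev φ q.2) :=
  (continuous_psiD hA1).comp (f := fun q : ℝ × ℝ => (q.1 + P.c * q.2, P.ev φ q.2))
    (by have := P.continuous_ev φ; fun_prop)

theorem continuousOn_profile (hA1 : P.A1) (φ : Hist P.r (St nb N₁ N₂)) :
    ContinuousOn (P.profile φ) (Icc 0 1) := by
  refine ContinuousOn.congr (Continuous.continuousOn ?_) fun z hz => profile_eq hA1 φ hz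
  refine P.continuous_CE.mul ?_
  simp_rw [intervalIntegral.integral_symm 0]
  exact (intervalIntegral.continuous_parametric_intervalIntegral_of_continuous
    (f := fun z p => P.psi (z + P.c * p) (P.ev φ p)) (continuous_psi_ev hA1 φ)
    (by fun_prop)).neg

theorem continuousOn_rate (hA1 : P.A1) (φ : Hist P.r (St nb N₁ N₂)) :
    ContinuousOn (P.rate φ) (Icc 0 1) := by
  refine ContinuousOn.congr (Continuous.continuousOn ?_) fun z hz => rate_eq hA1 φ hz
  have hev := P.continuous_ev φ
  refine P.continuous_CE.mul ((Continuous.sub ?_ ?_).sub (continuous_const.mul ?_))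
  · exact (continuous_psi hA1).comp (f := fun z : ℝ => (z, P.ev φ 0)) (by fun_prop)
  · exact (continuous_psi hA1).comp (f := fun z : ℝ => ((0 : ℝ), P.ev φ (-(P.r * z))))
      (by fun_prop)
  · simp_rw [intervalIntegral.integral_symm 0]
    exact (intervalIntegral.continuous_parametric_intervalIntegral_of_continuous
      (f := fun z p => P.psiD (z + P.c * p) (P.ev φ p)) (continuous_psiD_ev hA1 φ)
      (by fun_prop)).neg

theorem exists_CE_bounds : ∃ B : ℝ, 0 < B ∧ ∀ z ∈ Icc (0 : ℝ) 1, P.CE z ≤ B ∧ (P.CE z)⁻¹ ≤ B := by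
  obtain ⟨B, hB⟩ := isCompact_Icc.exists_bound_of_continuousOn
    (s := Icc (0 : ℝ) 1) P.continuous_CE.continuousOn
  obtain ⟨B', hB'⟩ := isCompact_Icc.exists_bound_of_continuousOn (s := Icc (0 : ℝ) 1)
    (f := fun z => (P.CE z)⁻¹) (P.continuous_CE.inv₀ fun z => (P.CE_pos z).ne').continuousOn
  have h0 : (0 : ℝ) ∈ Icc (0 : ℝ) 1 := ⟨le_rfl, zero_le_one⟩
  have h1 := (norm_nonneg _).trans (hB 0 h0)
  have h2 := (norm_nonneg _).trans (hB' 0 h0)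
  refine ⟨B + B' + 1, by linarith, fun z hz => ⟨?_, ?_⟩⟩
  · linarith [le_abs_self (P.CE z), hB z hz, Real.norm_eq_abs (P.CE z)]
  · linarith [le_abs_self (P.CE z)⁻¹, hB' z hz, Real.norm_eq_abs (P.CE z)⁻¹]

theorem exists_lipschitz_psi (hA1 : P.A1) : ∃ L : ℝ, 0 ≤ L ∧ ∀ z ∈ Icc (0 : ℝ) 1,
    ∀ x y : St nb N₁ N₂, |P.psi z x - P.psi z y| ≤ L * ‖x - y‖ := by
  obtain ⟨B, hB0, hB⟩ := exists_CE_bounds (P := P)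
  obtain ⟨L, hL, h⟩ := exists_lipschitz_gbarS hA1
  refine ⟨L * B, by positivity, fun z hz x y => ?_⟩
  rw [psi_eq hA1 hz, psi_eq hA1 hz, ← sub_div, div_eq_mul_inv, abs_mul,
    abs_of_pos (inv_pos.2 (P.CE_pos z))]
  calc _ ≤ L * ‖x - y‖ * B := mul_le_mul (h z hz x y) (hB z hz).2
        (inv_pos.2 (P.CE_pos z)).le (by positivity)
    _ = _ := by ring

theorem exists_lipschitz_psiD (hA1 : P.A1) (hA3 : P.A3) : ∃ L : ℝ, 0 ≤ L ∧
    ∀ z ∈ Icc (0 : ℝ) 1, ∀ x y : St nb N₁ N₂, |P.psiD z x - P.psiD z y| ≤ L * ‖x - y‖ := by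
  obtain ⟨B, hB0, hB⟩ := exists_CE_bounds (P := P)
  obtain ⟨L, hL, h⟩ := exists_lipschitz_gtildeS hA1 hA3
  have hr := P.r_pos
  refine ⟨P.r * (L * B), by positivity, fun z hz x y => ?_⟩
  have e : P.psiD z x - P.psiD z y =
      -(P.r * ((P.gtildeS z x - P.gtildeS z y) * (P.CE z)⁻¹)) := by
    rw [psiD, psiD, unitClamp_of_mem hz]
    ring
  rw [e, abs_neg, abs_mul, abs_of_pos hr, abs_mul, abs_of_pos (inv_pos.2 (P.CE_pos z)), mul_assoc]
  refine mul_le_mul_of_nonneg_left ?_ hr.le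
  calc _ ≤ L * ‖x - y‖ * B := mul_le_mul (h z hz x y) (hB z hz).2
        (inv_pos.2 (P.CE_pos z)).le (by positivity)
    _ = _ := by ring

/-- The bound keeps the integral over the history, since that integral supplies the factor 1/κ for η
and λ in the uniqueness proof. -/
theorem exists_profile_sub_le (hA1 : P.A1) : ∃ L : ℝ, 0 ≤ L ∧ ∀ z ∈ Icc (0 : ℝ) 1,
    ∀ φ φ' : Hist P.r (St nb N₁ N₂), |P.profile φ z - P.profile φ' z| ≤
      L * ∫ p in (-(P.r * z))..0, ‖P.ev φ p - P.ev φ' p‖ := by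
  obtain ⟨B, hB0, hB⟩ := exists_CE_bounds (P := P)
  obtain ⟨L, hL, h⟩ := exists_lipschitz_psi hA1
  refine ⟨B * L, by positivity, fun z hz φ φ' => ?_⟩
  have hz0 := (neg_r_mul_mem (P := P) hz).2
  have hev := P.continuous_ev φ
  have hev' := P.continuous_ev φ'
  have hc : ∀ φ : Hist P.r (St nb N₁ N₂), Continuous fun p => P.psi (z + P.c * p) (P.ev φ p) :=
    fun φ => (continuous_psi_ev hA1 φ).comp (f := fun p : ℝ => (z, p)) (by fun_prop)
  rw [profile_eq hA1 φ hz, profile_eq hA1 φ' hz, ← mul_sub, ← intervalIntegral.integral_sub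
    ((hc φ).intervalIntegrable _ _) ((hc φ').intervalIntegrable _ _), abs_mul,
    abs_of_pos (P.CE_pos z), mul_assoc]
  refine mul_le_mul (hB z hz).1 ?_ (abs_nonneg _) hB0.le
  rw [← intervalIntegral.integral_const_mul, ← Real.norm_eq_abs]
  refine intervalIntegral.norm_integral_le_of_norm_le hz0 (Eventually.of_forall fun p hp => ?_)
    (Continuous.intervalIntegrable (by fun_prop) _ _)
  exact h _ (mem_Icc_of_mem hz (Ioc_subset_Icc_self hp)) _ _

theorem exists_lipschitz_profile (hA1 : P.A1) : ∃ L : ℝ, 0 ≤ L ∧ ∀ z ∈ Icc (0 : ℝ) 1,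
    ∀ φ φ' : Hist P.r (St nb N₁ N₂), |P.profile φ z - P.profile φ' z| ≤ L * ‖φ - φ'‖ := by
  obtain ⟨L, hL, h⟩ := exists_profile_sub_le hA1
  have hr := P.r_pos
  refine ⟨L * P.r, by positivity, fun z hz φ φ' => (h z hz φ φ').trans ?_⟩
  rw [mul_assoc]
  refine mul_le_mul_of_nonneg_left ?_ hL
  have hz0 := neg_r_mul_mem (P := P) hz
  have hev := P.continuous_ev φ
  have hev' := P.continuous_ev φ'
  calc _ ≤ ∫ p in (-(P.r * z))..0, ‖φ - φ'‖ :=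
        intervalIntegral.integral_mono_on hz0.2 (Continuous.intervalIntegrable (by fun_prop) _ _)
          intervalIntegrable_const fun p _ => P.norm_ev_sub_le φ φ' p
    _ = P.r * z * ‖φ - φ'‖ := by simp
    _ ≤ _ := mul_le_mul_of_nonneg_right (by linarith [hz0.1]) (norm_nonneg _)

theorem exists_lipschitz_rate (hA1 : P.A1) (hA3 : P.A3) : ∃ L : ℝ, 0 ≤ L ∧
    ∀ z ∈ Icc (0 : ℝ) 1, ∀ φ φ' : Hist P.r (St nb N₁ N₂),
      |P.rate φ z - P.rate φ' z| ≤ L * ‖φ - φ'‖ := by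
  obtain ⟨B, hB0, hB⟩ := exists_CE_bounds (P := P)
  obtain ⟨L, hL, h⟩ := exists_lipschitz_psi hA1
  obtain ⟨L', hL', h'⟩ := exists_lipschitz_psiD hA1 hA3
  have hr := P.r_pos
  have hc := P.c_pos
  refine ⟨B * (L + L + P.c * (L' * P.r)), by positivity, fun z hz φ φ' => ?_⟩
  have hz0 := neg_r_mul_mem (P := P) hz
  have hcD : ∀ φ : Hist P.r (St nb N₁ N₂), Continuous fun p => P.psiD (z + P.c * p) (P.ev φ p) :=
    fun φ => (continuous_psiD_ev hA1 φ).comp (f := fun p : ℝ => (z, p)) (by fun_prop)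
  have e : P.rate φ z - P.rate φ' z = P.CE z * ((P.psi z (P.ev φ 0) - P.psi z (P.ev φ' 0)) -
      (P.psi 0 (P.ev φ (-(P.r * z))) - P.psi 0 (P.ev φ' (-(P.r * z)))) -
      P.c * ∫ p in (-(P.r * z))..0,
        (P.psiD (z + P.c * p) (P.ev φ p) - P.psiD (z + P.c * p) (P.ev φ' p))) := by
    rw [rate_eq hA1 φ hz, rate_eq hA1 φ' hz, intervalIntegral.integral_sub
      ((hcD φ).intervalIntegrable _ _) ((hcD φ').intervalIntegrable _ _)]
    ring
  rw [e, abs_mul, abs_of_pos (P.CE_pos z), mul_assoc]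
  refine mul_le_mul (hB z hz).1 ?_ (abs_nonneg _) hB0.le
  have h1 : |P.psi z (P.ev φ 0) - P.psi z (P.ev φ' 0)| ≤ L * ‖φ - φ'‖ :=
    (h z hz _ _).trans (mul_le_mul_of_nonneg_left (P.norm_ev_sub_le _ _ _) hL)
  have h2 : |P.psi 0 (P.ev φ (-(P.r * z))) - P.psi 0 (P.ev φ' (-(P.r * z)))| ≤ L * ‖φ - φ'‖ :=
    (h 0 ⟨le_rfl, zero_le_one⟩ _ _).trans (mul_le_mul_of_nonneg_left (P.norm_ev_sub_le _ _ _) hL)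
  have h3 : |P.c * ∫ p in (-(P.r * z))..0,
      (P.psiD (z + P.c * p) (P.ev φ p) - P.psiD (z + P.c * p) (P.ev φ' p))| ≤
      P.c * (L' * P.r * ‖φ - φ'‖) := by
    rw [abs_mul, abs_of_pos hc, ← Real.norm_eq_abs]
    refine mul_le_mul_of_nonneg_left ?_ hc.le
    refine (intervalIntegral.norm_integral_le_of_norm_le_const (C := L' * ‖φ - φ'‖)
      fun p hp => ?_).trans ?_
    · rw [uIoc_of_le hz0.2] at hp
      exact (h' _ (mem_Icc_of_mem hz (Ioc_subset_Icc_self hp)) _ _).trans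
        (mul_le_mul_of_nonneg_left (P.norm_ev_sub_le _ _ _) hL')
    · rw [zero_sub, neg_neg, abs_of_nonneg (by linarith [hz0.2])]
      have : L' * ‖φ - φ'‖ * (P.r * z) ≤ L' * ‖φ - φ'‖ * P.r :=
        mul_le_mul_of_nonneg_left (by linarith [hz0.1]) (by positivity)
      linarith
  refine (abs_sub _ _).trans ((add_le_add (abs_sub _ _) le_rfl).trans ?_)
  linarith

/-! ### The delay system -/

theorem f₁_eq (φ : Hist P.r (St nb N₁ N₂)) (u : Eu m) (d : Eu nb) :
    P.f₁ φ u d = P.Ft (xPart (P.ev φ 0)) (prof (P.profile φ)) u + d := rfl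

theorem f₂_apply (φ : Hist P.r (St nb N₁ N₂)) (i : Fin N₁) : P.f₂ φ i = P.rate φ (P.zpt i) := rfl

theorem intervalIntegrable_γ_mul {i : Fin N₂} {w : ℝ → ℝ} (hw : ContinuousOn w (Icc 0 1)) :
    IntervalIntegrable (fun z => P.γ i z * w z) volume 0 1 := by
  have h := (P.γ_cont i).mul hw
  rw [← uIcc_of_le (zero_le_one' ℝ)] at h
  exact h.intervalIntegrable

/-- The two terms of `f₃` merge into one integral of γ_i against the rate. -/
theorem f₃_apply (hA1 : P.A1) (φ : Hist P.r (St nb N₁ N₂)) (i : Fin N₂) :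
    P.f₃ φ i = ∫ z in (0 : ℝ)..1, P.γ i z * P.rate φ z := by
  have h1 : ContinuousOn (fun z => P.γ i z *
      (P.gbarS z (P.ev φ 0) - P.Cf z * P.gbarS 0 (P.ev φ (-(P.r * z))))) (Icc 0 1) := by
    refine (P.γ_cont i).mul (ContinuousOn.congr (f := fun z => P.CE z *
      (P.psi z (P.ev φ 0) - P.psi 0 (P.ev φ (-(P.r * z))))) ?_ fun z hz => ?_)
    · have hev := P.continuous_ev φ
      refine (P.continuous_CE.mul (Continuous.sub ?_ ?_)).continuousOn
      · exact (continuous_psi hA1).comp (f := fun z : ℝ => (z, P.ev φ 0)) (by fun_prop)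
      · exact (continuous_psi hA1).comp (f := fun z : ℝ => ((0 : ℝ), P.ev φ (-(P.r * z))))
          (by fun_prop)
    · have hC := (P.CE_pos z).ne'
      simp only [psi_eq hA1 hz, psi_eq hA1 (left_mem_Icc.2 (zero_le_one' ℝ)), P.CE_zero,
        ← P.CE_eq hz]
      field_simp
  have h2 := intervalIntegrable_γ_mul (P := P) (i := i) (continuousOn_rate hA1 φ)
  rw [← uIcc_of_le (zero_le_one' ℝ)] at h1
  -- The rate and the bracket are continuous in z, so integrability is checked for these two; the
  -- iterated integral is then obtained as their difference.
  suffices h : (∫ z in (0 : ℝ)..1, P.γ i z * P.rate φ z) - (∫ z in (0 : ℝ)..1, P.γ i z *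
      (P.gbarS z (P.ev φ 0) - P.Cf z * P.gbarS 0 (P.ev φ (-(P.r * z))))) =
      ∫ z in (0 : ℝ)..1, ∫ p in (-(P.r * z))..0, P.γ i z * P.Cf z / P.Cf (z + P.c * p) *
        P.gtildeS (z + P.c * p) (P.ev φ p) from (sub_eq_iff_eq_add'.1 h).symm
  rw [← intervalIntegral.integral_sub h2 h1.intervalIntegrable]
  refine intervalIntegral.integral_congr fun z _ => ?_
  simp only [rate]
  rw [← mul_sub, add_sub_cancel_left, ← intervalIntegral.integral_const_mul]
  refine intervalIntegral.integral_congr fun p _ => ?_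
  ring

variable (P) in
/-- The linear output map on stacked states. -/
def outMap : St nb N₁ N₂ →L[ℝ] Eu k :=
  LinearMap.toContinuousLinearMap
    { toFun := fun x => WithLp.toLp 2 fun j =>
        inner ℝ (P.q j) (xPart x) + ∑ i, P.bOut j i * ηPart x i + ∑ i, P.βOut j i * lPart x i
      map_add' := fun x y => by
        ext j
        have h1 : xPart (x + y) = xPart x + xPart y := rfl
        have h2 : ηPart (x + y) = ηPart x + ηPart y := rfl
        have h3 : lPart (x + y) = lPart x + lPart y := rfl
        simp only [h1, h2, h3, inner_add_right, PiLp.add_apply, mul_add, Finset.sum_add_distrib]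
        ring
      map_smul' := fun s x => by
        ext j
        have h1 : xPart (s • x) = s • xPart x := rfl
        have h2 : ηPart (s • x) = s • ηPart x := rfl
        have h3 : lPart (s • x) = s • lPart x := rfl
        simp only [h1, h2, h3, inner_smul_right, PiLp.smul_apply, smul_eq_mul, RingHom.id_apply,
          mul_add, Finset.mul_sum, mul_left_comm] }

theorem h_eq (φ : Hist P.r (St nb N₁ N₂)) : P.h φ = P.outMap (P.ev φ 0) := rfl

/-- R and h are the images of f(x_t, u) and of x(t) under the same linear map; this is why R is the
time derivative of the output. -/
theorem R_eq (φ : Hist P.r (St nb N₁ N₂)) (u : Eu m) (d : Eu nb) :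
    P.R φ u d = P.outMap (P.f φ u d) := rfl

/-- The stacked vector of the measured quantities of a state `(x̄, v)`. -/
def measured (P : Loop nb N₁ N₂ m k) (xb : Eu nb) (v : ℝ → ℝ) : St nb N₁ N₂ :=
  stack xb (WithLp.toLp 2 fun i => v (P.zpt i))
    (WithLp.toLp 2 fun i => ∫ s in (0 : ℝ)..1, P.γ i s * v s)

theorem output_eq (xb : Eu nb) (v : ℝ → ℝ) : P.output xb v = P.outMap (P.measured xb v) := rfl

theorem norm_prof_profile_sub_le {φ φ' : Hist P.r (St nb N₁ N₂)} (hA1 : P.A1) {M : ℝ} (hM : 0 ≤ M)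
    (h : ∀ z ∈ Icc (0 : ℝ) 1, |P.profile φ z - P.profile φ' z| ≤ M) :
    ‖prof (P.profile φ) - prof (P.profile φ')‖ ≤ M :=
  norm_prof_sub_le (continuousOn_profile hA1 φ) (continuousOn_profile hA1 φ') hM h

theorem abs_integral_γ_mul_le {i : Fin N₂} {w : ℝ → ℝ} {B M : ℝ}
    (hB : ∀ z ∈ Icc (0 : ℝ) 1, |P.γ i z| ≤ B) (hw : ∀ z ∈ Icc (0 : ℝ) 1, |w z| ≤ M) :
    |∫ z in (0 : ℝ)..1, P.γ i z * w z| ≤ B * M := by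
  have hB0 : 0 ≤ B := (abs_nonneg _).trans (hB 0 ⟨le_rfl, zero_le_one⟩)
  rw [← Real.norm_eq_abs]
  refine (intervalIntegral.norm_integral_le_of_norm_le_const (C := B * M) fun z hz => ?_).trans
    (by simp)
  rw [uIoc_of_le zero_le_one] at hz
  have hz' := Ioc_subset_Icc_self hz
  rw [Real.norm_eq_abs, abs_mul]
  exact mul_le_mul (hB z hz') (hw z hz') (abs_nonneg _) hB0

theorem exists_lipschitz_f (hA1 : P.A1) (hA3 : P.A3) : ∃ L : ℝ, 0 ≤ L ∧
    ∀ (φ φ' : Hist P.r (St nb N₁ N₂)) (u : Eu m), ‖P.f φ u 0 - P.f φ' u 0‖ ≤ L * ‖φ - φ'‖ := by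
  obtain ⟨L₀, hL₀, hF, -⟩ := hA1.lipschitz
  obtain ⟨L₁, hL₁, h₁⟩ := exists_lipschitz_profile hA1
  obtain ⟨L₂, hL₂, h₂⟩ := exists_lipschitz_rate hA1 hA3
  obtain ⟨B, hB0, hB⟩ := exists_common_bound P.γ_cont
  refine ⟨(L₀ * L₁ + L₀) + N₁ * L₂ + N₂ * (B * L₂), by positivity, fun φ φ' u => ?_⟩
  rw [f, f, stack_sub]
  refine (norm_stack_le _ _ _).trans ?_
  have e1 : ‖P.f₁ φ u 0 - P.f₁ φ' u 0‖ ≤ (L₀ * L₁ + L₀) * ‖φ - φ'‖ := by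
    rw [f₁_eq, f₁_eq, add_zero, add_zero]
    refine (hF _ _ _ _ u).trans ?_
    have a1 := norm_prof_profile_sub_le hA1 (by positivity) fun z hz => h₁ z hz φ φ'
    have a2 : ‖xPart (P.ev φ 0) - xPart (P.ev φ' 0)‖ ≤ ‖φ - φ'‖ := by
      rw [← xPart_sub]
      exact (norm_xPart_le _).trans (P.norm_ev_sub_le _ _ _)
    have a3 := mul_le_mul_of_nonneg_left a1 hL₀.le
    have a4 := mul_le_mul_of_nonneg_left a2 hL₀.le
    linarith
  have e2 : ‖P.f₂ φ - P.f₂ φ'‖ ≤ N₁ * L₂ * ‖φ - φ'‖ := by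
    refine (norm_le_sum_abs _).trans ((Finset.sum_le_sum fun i _ => ?_).trans
      (b := ∑ _i : Fin N₁, L₂ * ‖φ - φ'‖) (by simp [mul_assoc]))
    rw [PiLp.sub_apply, f₂_apply, f₂_apply]
    exact h₂ _ (Ioc_subset_Icc_self (P.zpt_mem i)) _ _
  have e3 : ‖P.f₃ φ - P.f₃ φ'‖ ≤ N₂ * (B * L₂) * ‖φ - φ'‖ := by
    refine (norm_le_sum_abs _).trans ((Finset.sum_le_sum fun i _ => ?_).trans
      (b := ∑ _i : Fin N₂, B * (L₂ * ‖φ - φ'‖)) (by simp [mul_assoc]))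
    rw [PiLp.sub_apply, f₃_apply hA1, f₃_apply hA1]
    rw [← intervalIntegral.integral_sub (intervalIntegrable_γ_mul (continuousOn_rate hA1 φ))
      (intervalIntegrable_γ_mul (continuousOn_rate hA1 φ'))]
    simp_rw [← mul_sub]
    exact abs_integral_γ_mul_le (hB i) fun z hz => h₂ z hz φ φ'
  linarith

/-- Lipschitz in the history uniformly in u, and continuous in u for a fixed history: together these
give joint continuity. -/
theorem continuous_f (hA1 : P.A1) (hA3 : P.A3) :
    Continuous fun p : Hist P.r (St nb N₁ N₂) × Eu m => P.f p.1 p.2 0 := by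
  obtain ⟨L, hL, h⟩ := exists_lipschitz_f hA1 hA3
  rw [continuous_iff_continuousAt]
  rintro ⟨φ, u⟩
  have hu : Continuous fun u : Eu m => P.f φ u 0 := by
    have h1 : Continuous fun u : Eu m => P.f₁ φ u 0 := by
      simp_rw [f₁_eq]
      exact (hA1.F_cont.comp (f := fun u : Eu m =>
        (xPart (P.ev φ 0), prof (P.profile φ), u)) (by fun_prop)).add continuous_const
    exact continuous_stack.comp (h1.prodMk (continuous_const (y := (P.f₂ φ, P.f₃ φ))))
  have h2 : Tendsto (fun p : Hist P.r (St nb N₁ N₂) × Eu m => L * ‖p.1 - φ‖ +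
      ‖P.f φ p.2 0 - P.f φ u 0‖) (𝓝 (φ, u)) (𝓝 0) := by
    have : Continuous (fun p : Hist P.r (St nb N₁ N₂) × Eu m => L * ‖p.1 - φ‖ +
      ‖P.f φ p.2 0 - P.f φ u 0‖) := by
      have := hu.comp (continuous_snd (X := Hist P.r (St nb N₁ N₂)))
      simp only [Function.comp_def] at this
      fun_prop
    simpa using this.tendsto (φ, u)
  rw [ContinuousAt, tendsto_iff_norm_sub_tendsto_zero]
  refine squeeze_zero (fun _ => norm_nonneg _) (fun p => ?_) h2
  calc ‖P.f p.1 p.2 0 - P.f φ u 0‖ = ‖(P.f p.1 p.2 0 - P.f φ p.2 0) + (P.f φ p.2 0 - P.f φ u 0)‖ := by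
        congr 1; abel
    _ ≤ _ := (norm_add_le _ _).trans (by gcongr; exact h _ _ _)

theorem continuous_R (hA1 : P.A1) (hA3 : P.A3) :
    Continuous fun p : Hist P.r (St nb N₁ N₂) × Eu m => P.R p.1 p.2 0 :=
  P.outMap.continuous.comp (continuous_f hA1 hA3)

theorem exists_lipschitz_R (hA1 : P.A1) (hA3 : P.A3) : ∃ L : ℝ, 0 ≤ L ∧
    ∀ (φ φ' : Hist P.r (St nb N₁ N₂)) (u : Eu m), ‖P.R φ u 0 - P.R φ' u 0‖ ≤ L * ‖φ - φ'‖ := by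
  obtain ⟨L, hL, h⟩ := exists_lipschitz_f hA1 hA3
  refine ⟨‖P.outMap‖ * L, by positivity, fun φ φ' u => ?_⟩
  rw [R_eq, R_eq, ← map_sub, mul_assoc]
  exact (P.outMap.le_opNorm _).trans (mul_le_mul_of_nonneg_left (h φ φ' u) (norm_nonneg _))

/-! ### The reconstructed profile -/

theorem vhat_eq (φ : Hist P.r (St nb N₁ N₂)) (t z : ℝ) : P.vhat φ t z = P.profile φ z := by
  have h := intervalIntegral.integral_comp_add_right (a := -(P.r * z)) (b := 0) (fun p =>
    P.Cf z / P.Cf (z - P.c * (t - p)) * P.gbarS (z - P.c * (t - p)) (P.ev φ (p - t))) t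
  rw [vhat, profile]
  rw [zero_add, show -(P.r * z) + t = t - P.r * z by ring] at h
  rw [← h]
  refine intervalIntegral.integral_congr fun p _ => ?_
  simp only [add_sub_cancel_right]
  rw [show z - P.c * (t - (p + t)) = P.c * p + z by ring]

end Loop

/-! ### Integral equations and C¹ regularity -/

theorem contDiffOn_of_eq_integral {E : Type*} [NormedAddCommGroup E] [NormedSpace ℝ E]
    [CompleteSpace E] {y F : ℝ → E} {y₀ : E} (hF : ContinuousOn F (Ici 0))
    (hy : ∀ t, 0 ≤ t → y t = y₀ + ∫ s in (0 : ℝ)..t, F s) :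
    ContDiffOn ℝ 1 y (Ici 0) ∧ ∀ t, 0 ≤ t → derivWithin y (Ici 0) t = F t := by
  -- Freezing F at its value at 0 for negative times gives a primitive that is C¹ on ℝ and agrees
  -- with y on [0, ∞).
  have hc : Continuous fun s => F (max s 0) :=
    hF.comp_continuous (by fun_prop) fun s => mem_Ici.2 (le_max_right _ _)
  set Y : ℝ → E := fun t => y₀ + ∫ s in (0 : ℝ)..t, F (max s 0) with hY
  have hd : ∀ t, HasDerivAt Y (F (max t 0)) t := fun t =>
    (intervalIntegral.integral_hasDerivAt_right (hc.intervalIntegrable 0 t)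
      hc.stronglyMeasurable.stronglyMeasurableAtFilter hc.continuousAt).const_add _
  have heq : EqOn y Y (Ici 0) := fun t ht => by
    rw [hy t ht, hY]
    simp only
    congr 1
    refine intervalIntegral.integral_congr fun s hs => ?_
    rw [uIcc_of_le ht] at hs
    simp only [max_eq_left hs.1]
  have hC : ContDiff ℝ 1 Y := by
    rw [contDiff_one_iff_deriv]
    refine ⟨fun t => (hd t).differentiableAt, ?_⟩
    rw [funext fun t => (hd t).deriv]
    exact hc
  refine ⟨hC.contDiffOn.congr heq, fun t ht => ?_⟩
  rw [derivWithin_congr heq (heq ht),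
    (hd t).hasDerivWithinAt.derivWithin (uniqueDiffOn_Ici 0 t ht), max_eq_left ht]

/-! ### The integral form of the loop and its uniqueness -/

namespace Loop

variable {nb N₁ N₂ m k : ℕ} {P : Loop nb N₁ N₂ m k}

/-- In absolute time, p ↦ z - ct + cp is the characteristic through (t, z); it leaves the boundary z
= 0 at time t - rz. -/
theorem profile_hist_eq (hA1 : P.A1) {x : ℝ → St nb N₁ N₂} {t z : ℝ}
    (hx : ContinuousOn x (Icc (t - P.r) t)) (hz : z ∈ Icc (0 : ℝ) 1) :
    P.profile (hist P.r x t) z =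
      P.CE z * ∫ p in (t - P.r * z)..t, P.psi (z - P.c * t + P.c * p) (x p) := by
  have h := intervalIntegral.integral_comp_add_right (a := -(P.r * z)) (b := 0)
    (fun p => P.psi (z - P.c * t + P.c * p) (x p)) t
  rw [zero_add, show -(P.r * z) + t = t - P.r * z by ring] at h
  rw [profile_eq hA1 _ hz, ← h]
  congr 1
  refine intervalIntegral.integral_congr fun p hp => ?_
  have hz0 := neg_r_mul_mem (P := P) hz
  rw [uIcc_of_le hz0.2] at hp
  rw [P.ev_hist hx ⟨hz0.1.trans hp.1, hp.2⟩, add_comm p t]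
  congr 1
  ring

theorem continuous_prof_profile (hA1 : P.A1) :
    Continuous fun φ : Hist P.r (St nb N₁ N₂) => prof (P.profile φ) := by
  obtain ⟨L, hL, h⟩ := exists_lipschitz_profile hA1
  refine (LipschitzWith.of_dist_le_mul (K := Real.toNNReal L) fun φ φ' => ?_).continuous
  rw [dist_eq_norm, dist_eq_norm, Real.coe_toNNReal _ hL]
  exact norm_prof_profile_sub_le hA1 (by positivity) fun z hz => h z hz φ φ'

theorem measured_sub_le (P : Loop nb N₁ N₂ m k) {x x' : Eu nb} {v v' : ℝ → ℝ} {B M : ℝ}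
    (hB : ∀ i, ∀ z ∈ Icc (0 : ℝ) 1, |P.γ i z| ≤ B) (hv : ContinuousOn v (Icc 0 1))
    (hv' : ContinuousOn v' (Icc 0 1)) (h : ∀ z ∈ Icc (0 : ℝ) 1, |v z - v' z| ≤ M) :
    ‖P.measured x v - P.measured x' v'‖ ≤ ‖x - x'‖ + N₁ * M + N₂ * (B * M) := by
  rw [measured, measured, stack_sub]
  refine (norm_stack_le _ _ _).trans (add_le_add (add_le_add le_rfl ?_) ?_)
  · refine (norm_le_sum_abs _).trans ((Finset.sum_le_sum fun i _ => ?_).trans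
      (b := ∑ _i : Fin N₁, M) (by simp))
    exact h _ (Ioc_subset_Icc_self (P.zpt_mem i))
  · refine (norm_le_sum_abs _).trans ((Finset.sum_le_sum fun i _ => ?_).trans
      (b := ∑ _i : Fin N₂, B * M) (by simp))
    rw [PiLp.sub_apply, ← intervalIntegral.integral_sub (intervalIntegrable_γ_mul hv)
      (intervalIntegrable_γ_mul hv')]
    simp_rw [← mul_sub]
    exact abs_integral_γ_mul_le (hB i) h

/-- The integral form of the loop on `[0, T)` for the stacked signal `x : [-r, T) → ℝⁿ`: the
component `x̄` solves its differential equation, and the components `η`, `λ` are the measurements of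
the profile generated by the current history. -/
structure IntegralForm (P : Loop nb N₁ N₂ m k) (T : ℝ) (xb₀ : Eu nb) (u : ℝ → Eu m)
    (x : ℝ → St nb N₁ N₂) : Prop where
  cont : ContinuousOn x (Ico (-P.r) T)
  mild : ∀ t ∈ Ico 0 T, xPart (x t) = xb₀ + ∫ s in (0 : ℝ)..t,
    P.Ft (xPart (x s)) (prof (P.profile (hist P.r x s))) (u s)
  meas : ∀ t ∈ Ico 0 T, x t = P.measured (xPart (x t)) (P.profile (hist P.r x t))

theorem continuousOn_Ft (hA1 : P.A1) {T : ℝ} {u : ℝ → Eu m} {x : ℝ → St nb N₁ N₂}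
    (hu : ContinuousOn u (Ici 0)) (hx : ContinuousOn x (Ico (-P.r) T)) :
    ContinuousOn (fun s => P.Ft (xPart (x s)) (prof (P.profile (hist P.r x s))) (u s))
      (Ico 0 T) := by
  have hr := P.r_pos
  refine hA1.F_cont.comp_continuousOn (f := fun s =>
    (xPart (x s), prof (P.profile (hist P.r x s)), u s)) ?_
  refine ContinuousOn.prodMk ?_ (ContinuousOn.prodMk ?_ (hu.mono fun s hs => hs.1))
  · exact continuous_xPart.comp_continuousOn (hx.mono fun s hs => ⟨by linarith [hs.1], hs.2⟩)
  · exact (continuous_prof_profile hA1).comp_continuousOn (continuousOn_hist hr.le hx)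

/-- Every component is a Volterra integral: x̄ by its equation, η and λ because the profile
integrates the history. With an exponential weight the difference of two solutions is therefore
contracted. Only Lipschitz bounds on F̃ and ḡ enter, because η and λ are read off the profile and
not off its rate. -/
theorem IntegralForm.eqOn (hA1 : P.A1) {T : ℝ} {xb₀ : Eu nb} {u : ℝ → Eu m}
    {x y : ℝ → St nb N₁ N₂} (hu : ContinuousOn u (Ici 0)) (hx : P.IntegralForm T xb₀ u x)
    (hy : P.IntegralForm T xb₀ u y) (h0 : EqOn x y (Icc (-P.r) 0)) :
    EqOn x y (Ico (-P.r) T) := by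
  have hr := P.r_pos
  intro t₁ ht₁
  rcases le_or_gt t₁ 0 with hneg | hpos
  · exact h0 ⟨ht₁.1, hneg⟩
  obtain ⟨L, hL, hF, -⟩ := hA1.lipschitz
  obtain ⟨Lp, hLp, hprof⟩ := exists_profile_sub_le hA1
  obtain ⟨B, hB0, hB⟩ := exists_common_bound P.γ_cont
  -- Q collects the gains of the x̄, η and λ components; each appears divided by κ, so κ = 2Q + 1
  -- makes the total at most 1/2.
  set Q : ℝ := L * (Lp + 1) + N₁ * Lp + N₂ * (B * Lp) with hQ
  have hQ0 : 0 ≤ Q := by positivity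
  set κ : ℝ := 2 * Q + 1 with hκ
  have hκ1 : 1 ≤ κ := by linarith
  have hκ0 : 0 < κ := by linarith
  have hsub : Icc 0 t₁ ⊆ Ico 0 T := fun s hs => ⟨hs.1, hs.2.trans_lt ht₁.2⟩
  have hsub' : Icc 0 t₁ ⊆ Ico (-P.r) T := fun s hs => ⟨by linarith [hs.1], hs.2.trans_lt ht₁.2⟩
  have hwin : ∀ s ∈ Icc 0 t₁, Icc (s - P.r) s ⊆ Ico (-P.r) T := fun s hs p hp =>
    ⟨by linarith [hp.1, hs.1], (hp.2.trans hs.2).trans_lt ht₁.2⟩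
  have key := le_of_weighted_contraction (M := fun t => ‖x t - y t‖) (T := t₁) (κ := κ) (ε := 0)
    ((hx.cont.mono hsub').sub (hy.cont.mono hsub')).norm (fun _ _ => norm_nonneg _) ?_
  · have := key t₁ ⟨hpos.le, le_rfl⟩
    rw [mul_zero, zero_mul] at this
    exact sub_eq_zero.1 (norm_le_zero_iff.1 this)
  intro S hS hM t ht
  have hM' : ∀ p ∈ Icc (-P.r) t₁, ‖x p - y p‖ ≤ S * Real.exp (κ * p) := fun p hp => by
    rcases le_or_gt p 0 with h | h
    · rw [h0 ⟨hp.1, h⟩, sub_self, norm_zero]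
      positivity
    · exact hM p ⟨h.le, hp.2⟩
  have hv : ∀ s ∈ Icc 0 t₁, ∀ z ∈ Icc (0 : ℝ) 1, |P.profile (hist P.r x s) z -
      P.profile (hist P.r y s) z| ≤ Lp * (S * Real.exp (κ * s) / κ) := fun s hs z hz => by
    refine (hprof z hz _ _).trans (mul_le_mul_of_nonneg_left ?_ hLp)
    have hz0 := neg_r_mul_mem (P := P) hz
    have c1 := P.continuous_ev (hist P.r x s)
    have c2 := P.continuous_ev (hist P.r y s)
    calc _ ≤ ∫ p in (-(P.r * z))..0, S * Real.exp (κ * s) * Real.exp (κ * p) := by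
          refine intervalIntegral.integral_mono_on hz0.2
            (Continuous.intervalIntegrable (by fun_prop) _ _)
            (Continuous.intervalIntegrable (by fun_prop) _ _) fun p hp => ?_
          have hp' : p ∈ Icc (-P.r) 0 := ⟨hz0.1.trans hp.1, hp.2⟩
          rw [P.ev_hist (hx.cont.mono (hwin s hs)) hp', P.ev_hist (hy.cont.mono (hwin s hs)) hp',
            mul_assoc, ← Real.exp_add, ← mul_add]
          exact hM' _ ⟨by linarith [hp'.1, hs.1], by linarith [hp'.2, hs.2]⟩
      _ ≤ S * Real.exp (κ * s) * (Real.exp (κ * 0) / κ) := by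
          rw [intervalIntegral.integral_const_mul]
          exact mul_le_mul_of_nonneg_left (integral_exp_mul_le hκ0 _ _) (by positivity)
      _ = _ := by simp [div_eq_mul_inv]
  -- In the x̄ component the factor 1/κ comes from the time integral of F̃, so the one in the
  -- profile bound may be dropped.
  have hdiv : ∀ s, Lp * (S * Real.exp (κ * s) / κ) ≤ Lp * (S * Real.exp (κ * s)) := fun s =>
    mul_le_mul_of_nonneg_left (div_le_self (by positivity) hκ1) hLp
  have hxp : ‖xPart (x t) - xPart (y t)‖ ≤ L * (Lp + 1) * (S * Real.exp (κ * t) / κ) := by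
    have ci : ∀ {x}, P.IntegralForm T xb₀ u x → IntervalIntegrable (fun s =>
        P.Ft (xPart (x s)) (prof (P.profile (hist P.r x s))) (u s)) volume 0 t := fun hx =>
      ((continuousOn_Ft hA1 hu hx.cont).mono (by
        rw [uIcc_of_le ht.1]
        exact (Icc_subset_Icc_right ht.2).trans hsub)).intervalIntegrable
    rw [hx.mild t (hsub ht), hy.mild t (hsub ht), add_sub_add_left_eq_sub,
      ← intervalIntegral.integral_sub (ci hx) (ci hy)]
    calc _ ≤ ∫ s in (0 : ℝ)..t, L * (Lp + 1) * S * Real.exp (κ * s) := by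
          refine intervalIntegral.norm_integral_le_of_norm_le ht.1
            (Eventually.of_forall fun s hs => ?_) (Continuous.intervalIntegrable (by fun_prop) _ _)
          have hs' : s ∈ Icc 0 t₁ := ⟨hs.1.le, hs.2.trans ht.2⟩
          refine (hF _ _ _ _ _).trans ?_
          have a1 := norm_prof_profile_sub_le hA1 (by positivity)
            fun z hz => (hv s hs' z hz).trans (hdiv s)
          have a2 : ‖xPart (x s) - xPart (y s)‖ ≤ S * Real.exp (κ * s) := by
            rw [← xPart_sub]
            exact (norm_xPart_le _).trans (hM s hs')
          have a3 := mul_le_mul_of_nonneg_left a1 hL.le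
          have a4 := mul_le_mul_of_nonneg_left a2 hL.le
          linarith
      _ ≤ L * (Lp + 1) * S * (Real.exp (κ * t) / κ) := by
          rw [intervalIntegral.integral_const_mul]
          exact mul_le_mul_of_nonneg_left (integral_exp_mul_le hκ0 _ _) (by positivity)
      _ = _ := by ring
  rw [hx.meas t (hsub ht), hy.meas t (hsub ht)]
  refine (P.measured_sub_le hB (continuousOn_profile hA1 _) (continuousOn_profile hA1 _)
    (hv t ht)).trans ?_
  have e : Q * (S * Real.exp (κ * t) / κ) ≤ (S / 2 + 0) * Real.exp (κ * t) := by
    rw [add_zero, mul_div_assoc', div_le_iff₀ hκ0]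
    have : 0 ≤ S * Real.exp (κ * t) := by positivity
    nlinarith
  refine le_trans ?_ e
  rw [hQ]
  linarith

end Loop

/-! ### Histories that generate an initial state -/

namespace Loop

variable {nb N₁ N₂ m k : ℕ} {P : Loop nb N₁ N₂ m k}

/-- The history `φ` generates the initial state `(x̄₀, v₀)` of the loop. -/
structure Generates (P : Loop nb N₁ N₂ m k) (φ : Hist P.r (St nb N₁ N₂)) (xb₀ : Eu nb)
    (v₀ : ℝ → ℝ) : Prop where
  profile_eq : ∀ z ∈ Icc (0 : ℝ) 1, v₀ z = P.profile φ z
  ev_zero : P.ev φ 0 = P.measured xb₀ v₀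

theorem measured_congr {xb : Eu nb} {v v' : ℝ → ℝ} (h : EqOn v v' (Icc 0 1)) :
    P.measured xb v = P.measured xb v' := by
  unfold measured
  congr 2
  · ext i
    exact h (Ioc_subset_Icc_self (P.zpt_mem i))
  · ext i
    refine intervalIntegral.integral_congr fun z hz => ?_
    rw [uIcc_of_le zero_le_one] at hz
    simp only [h hz]

theorem exists_generates (hA2 : P.A2) : ∃ G : ℝ, 0 < G ∧ ∀ (v₀ : ℝ → ℝ) (xb₀ : Eu nb),
    P.Compatible v₀ xb₀ → ∃ φ : Hist P.r (St nb N₁ N₂), P.Generates φ xb₀ v₀ ∧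
      ‖φ‖ ≤ G * (‖prof v₀‖ + ‖prof (derivWithin v₀ (Icc 0 1))‖ + ‖xb₀‖) := by
  obtain ⟨G, hG, h⟩ := hA2
  refine ⟨G, hG, fun v₀ xb₀ hc => ?_⟩
  obtain ⟨xb, η, l, h1, h2, h3, h4, h5⟩ := h v₀ xb₀ hc
  let φ : Hist P.r (St nb N₁ N₂) := ⟨fun θ => stack (xb θ) (η θ) (l θ),
    continuous_stack.comp (xb.continuous.prodMk (η.continuous.prodMk l.continuous))⟩
  have hev : ∀ p, P.ev φ p = stack (P.ev xb p) (P.ev η p) (P.ev l p) := fun p => rfl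
  refine ⟨φ, ⟨fun z hz => ?_, ?_⟩, le_trans ?_ h4⟩
  · rw [h5 z hz]
    rfl
  · rw [hev, h1, measured]
    congr 1
    · ext i
      exact h2 i
    · ext i
      exact h3 i
  · refine (ContinuousMap.norm_le _ (by positivity)).2 fun θ => (norm_stack_le _ _ _).trans ?_
    exact add_le_add (add_le_add (xb.norm_coe_le_norm θ) (η.norm_coe_le_norm θ))
      (l.norm_coe_le_norm θ)

/-! ### From the classical solution to the integral form -/

/-- The stacked signal formed by a history and the measurements of a solution of the loop. -/
def stackedSignal (P : Loop nb N₁ N₂ m k) (φ : Hist P.r (St nb N₁ N₂)) (xb : ℝ → Eu nb)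
    (v : ℝ → ℝ → ℝ) (t : ℝ) : St nb N₁ N₂ :=
  P.ev φ (min t 0) + (P.measured (xb (max t 0)) (v (max t 0)) - P.measured (xb 0) (v 0))

theorem stackedSignal_of_nonpos {φ : Hist P.r (St nb N₁ N₂)} {xb : ℝ → Eu nb} {v : ℝ → ℝ → ℝ}
    {t : ℝ} (ht : t ≤ 0) : P.stackedSignal φ xb v t = P.ev φ t := by
  simp [stackedSignal, ht]

section FromPDE

variable {T : ℝ} {xb₀ : Eu nb} {v₀ : ℝ → ℝ} {u : ℝ → Eu m} {xb : ℝ → Eu nb} {v : ℝ → ℝ → ℝ}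
  {φ : Hist P.r (St nb N₁ N₂)}

theorem IsPDESolution.measured_zero (hs : P.IsPDESolution T xb₀ v₀ u xb v)
    (hφ : P.Generates φ xb₀ v₀) : P.measured (xb 0) (v 0) = P.ev φ 0 := by
  rw [hφ.ev_zero, hs.xb_init, measured_congr fun z hz => hs.v_init z hz]

theorem IsPDESolution.stackedSignal_of_nonneg (hs : P.IsPDESolution T xb₀ v₀ u xb v)
    (hφ : P.Generates φ xb₀ v₀) {t : ℝ} (ht : 0 ≤ t) :
    P.stackedSignal φ xb v t = P.measured (xb t) (v t) := by
  rw [stackedSignal, min_eq_right ht, max_eq_left ht, hs.measured_zero hφ]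
  abel

/-- Up to a time T' < T both variables can be clamped to a compact rectangle, which turns v into a
continuous function on ℝ² and the integral measurements into parametric integrals. -/
theorem IsPDESolution.continuousOn_measured (hs : P.IsPDESolution T xb₀ v₀ u xb v) :
    ContinuousOn (fun t => P.measured (xb t) (v t)) (Ico 0 T) := by
  have hvc := hs.v_C1.continuousOn
  intro t ht
  obtain ⟨T', h1, h2⟩ := exists_between ht.2
  set τ : ℝ → ℝ := fun t => max 0 (min T' t) with hτ
  have hT' : 0 ≤ T' := ht.1.trans h1.le
  have hτm : ∀ t, τ t ∈ Ico 0 T := fun t =>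
    ⟨le_max_left _ _, (max_le hT' (min_le_left _ _)).trans_lt h2⟩
  have hτc : Continuous τ := by fun_prop
  have hV : Continuous fun p : ℝ × ℝ => v (τ p.1) (unitClamp p.2) :=
    hvc.comp_continuous (f := fun p : ℝ × ℝ => (τ p.1, unitClamp p.2)) (by fun_prop)
      fun p => ⟨hτm _, unitClamp_mem _⟩
  have hX : Continuous fun t => xb (τ t) := hs.xb_C1.continuousOn.comp_continuous hτc hτm
  have hM : Continuous fun t => P.measured (xb (τ t)) fun z => v (τ t) (unitClamp z) := by
    refine continuous_stack.comp (f := fun t => (xb (τ t), (WithLp.toLp 2 fun i =>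
      v (τ t) (unitClamp (P.zpt i)) : Eu N₁), (WithLp.toLp 2 fun i =>
        ∫ s in (0 : ℝ)..1, P.γ i s * v (τ t) (unitClamp s) : Eu N₂))) (hX.prodMk
      (Continuous.prodMk ?_ ?_))
    · refine (PiLp.continuous_toLp 2 _).comp (continuous_pi fun i => ?_)
      exact hV.comp (f := fun t : ℝ => (t, P.zpt i)) (by fun_prop)
    · refine (PiLp.continuous_toLp 2 _).comp (continuous_pi fun i => ?_)
      have e : ∀ t, ∫ s in (0 : ℝ)..1, P.γ i s * v (τ t) (unitClamp s) =
          ∫ s in (0 : ℝ)..1, P.γ i (unitClamp s) * v (τ t) (unitClamp s) := fun t => by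
        refine intervalIntegral.integral_congr fun s hs => ?_
        rw [uIcc_of_le zero_le_one] at hs
        simp only [unitClamp_of_mem hs]
      simp_rw [e]
      refine intervalIntegral.continuous_parametric_intervalIntegral_of_continuous'
        (f := fun t s => P.γ i (unitClamp s) * v (τ t) (unitClamp s)) ?_ 0 1
      exact ((continuous_comp_unitClamp (P.γ_cont i)).comp continuous_snd).mul hV
  have heq : ∀ s, s ∈ Icc 0 T' → P.measured (xb s) (v s) =
      P.measured (xb (τ s)) fun z => v (τ s) (unitClamp z) := fun s hs => by
    have : τ s = s := by simp [hτ, hs.1, hs.2]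
    rw [this]
    exact measured_congr fun z hz => by simp only [unitClamp_of_mem hz]
  refine (hM.continuousWithinAt (s := Ico 0 T) (x := t)).congr_of_eventuallyEq ?_
    (heq t ⟨ht.1, h1.le⟩)
  filter_upwards [mem_nhdsWithin_of_mem_nhds (Iio_mem_nhds h1), self_mem_nhdsWithin] with s hs hs0
  exact heq s ⟨hs0.1, le_of_lt hs⟩

/-- The signal is a sum of a continuous function of min(t, 0) and one of max(t, 0), so continuity at
0 does not depend on the history matching the initial state. -/
theorem IsPDESolution.continuousOn_stackedSignal (hT : 0 < T)
    (hs : P.IsPDESolution T xb₀ v₀ u xb v) :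
    ContinuousOn (P.stackedSignal φ xb v) (Ico (-P.r) T) := by
  have h1 := P.continuous_ev φ
  refine ContinuousOn.add (by fun_prop) (ContinuousOn.sub ?_ continuousOn_const)
  refine hs.continuousOn_measured.comp (f := fun t => max t 0) (by fun_prop) fun t ht => ?_
  exact ⟨le_max_right _ _, max_lt ht.2 hT⟩

/-- Integration of the transport equation along a characteristic. -/
theorem IsPDESolution.eq_profile (hA1 : P.A1) (hT : 0 < T)
    (hs : P.IsPDESolution T xb₀ v₀ u xb v) (hφ : P.Generates φ xb₀ v₀) {t z : ℝ}
    (ht : t ∈ Ico 0 T) (hz : z ∈ Icc (0 : ℝ) 1) :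
    v t z = P.profile (hist P.r (P.stackedSignal φ xb v) t) z := by
  have hr := P.r_pos
  have hc := P.c_pos
  have hrc := P.r_mul_c
  set x := P.stackedSignal φ xb v with hx
  have hxc : ContinuousOn x (Ico (-P.r) T) := hs.continuousOn_stackedSignal hT
  have hrz := neg_r_mul_mem (P := P) hz
  set y : ℝ → ℝ := fun p => z - P.c * t + P.c * p with hy
  -- The characteristic through (t, z) is followed back to `a₀`, where it meets the boundary z = 0
  -- (if t ≥ rz) or the initial line.
  set a₀ : ℝ := max 0 (t - P.r * z) with ha₀
  have ha₀t : a₀ ≤ t := max_le ht.1 (by linarith [hrz.2])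
  have hymem : ∀ p ∈ Icc (t - P.r * z) t, y p ∈ Icc (0 : ℝ) 1 := fun p hp => by
    have := mem_Icc_of_mem (P := P) (p := p - t) hz ⟨by linarith [hp.1], by linarith [hp.2]⟩
    rwa [show z + P.c * (p - t) = y p by simp only [hy]; ring] at this
  have hsub : Icc a₀ t ⊆ Icc (t - P.r * z) t := Icc_subset_Icc_left (le_max_right _ _)
  have hpsi : ContinuousOn (fun p => P.psi (y p) (x p)) (Icc (t - P.r * z) t) :=
    (continuous_psi hA1).comp_continuousOn (f := fun p => (y p, x p)) (ContinuousOn.prodMk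
      (by fun_prop) (hxc.mono fun p hp => ⟨by linarith [hp.1, hrz.1, ht.1], hp.2.trans_lt ht.2⟩))
  have hint : ∀ s₁ s₂, s₁ ∈ Icc (t - P.r * z) t → s₂ ∈ Icc (t - P.r * z) t →
      IntervalIntegrable (fun p => P.psi (y p) (x p)) volume s₁ s₂ := fun s₁ s₂ h₁ h₂ => by
    refine (hpsi.mono ?_).intervalIntegrable
    rw [← uIcc_of_le (show t - P.r * z ≤ t by linarith [hrz.2])] at h₁ h₂ ⊢
    exact uIcc_subset_uIcc h₁ h₂
  have key := intervalIntegral.integral_eq_sub_of_hasDerivAt_of_le (a := a₀) (b := t)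
    (f := fun p => v p (y p) / P.CE (y p)) (f' := fun p => P.psi (y p) (x p)) ha₀t ?_ ?_
    (hint _ _ (hsub ⟨le_rfl, ha₀t⟩) (hsub ⟨ha₀t, le_rfl⟩))
  · have hyt : y t = z := by simp [hy]
    have hCz := (P.CE_pos z).ne'
    rw [profile_hist_eq hA1 (hxc.mono fun p hp => ⟨by linarith [hp.1, ht.1], hp.2.trans_lt ht.2⟩) hz]
    suffices h : ∫ p in (t - P.r * z)..t, P.psi (y p) (x p) = v t z / P.CE z by
      change v t z = P.CE z * ∫ p in (t - P.r * z)..t, P.psi (y p) (x p)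
      rw [h]
      field_simp
    rw [hyt] at key
    rcases le_total 0 (t - P.r * z) with h | h
    · rw [ha₀, max_eq_right h] at key
      rw [key]
      have : y (t - P.r * z) = 0 := by simp only [hy]; linear_combination (-z) * hrc
      rw [this, hs.boundary _ ⟨h, by linarith [ht.2, hrz.2]⟩]
      simp
    · rw [ha₀, max_eq_left h] at key
      have hy0 : y 0 ∈ Icc (0 : ℝ) 1 := hymem 0 ⟨h, ht.1⟩
      have e0 : y 0 = z - P.c * t := by simp [hy]
      have e1 : -(P.r * y 0) = t - P.r * z := by rw [e0]; linear_combination t * hrc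
      have hC0 := (P.CE_pos (y 0)).ne'
      -- The characteristic starts on the initial line at y(0) = z - ct; the integral that
      -- represents v₀ there is the missing piece over [t - rz, 0], taken along the same
      -- characteristic.
      have h2 : ∫ p in (t - P.r * z)..0, P.psi (y p) (x p) = v 0 (y 0) / P.CE (y 0) := by
        rw [hs.v_init _ hy0, hφ.profile_eq _ hy0, Loop.profile_eq hA1 φ hy0, e1]
        rw [mul_div_cancel_left₀ _ hC0]
        refine intervalIntegral.integral_congr fun p hp => ?_
        rw [uIcc_of_le h] at hp
        simp only [hx, stackedSignal_of_nonpos hp.2, hy, mul_zero, add_zero]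
      rw [← intervalIntegral.integral_add_adjacent_intervals (b := 0)
        (hint _ _ ⟨le_rfl, by linarith [hrz.2]⟩ ⟨h, ht.1⟩)
        (hint _ _ ⟨h, ht.1⟩ ⟨by linarith [hrz.2], le_rfl⟩), key, h2]
      ring
  · refine ContinuousOn.div (hs.v_C1.continuousOn.comp (f := fun p => (p, y p)) (by fun_prop)
      fun p hp => ?_) (P.continuous_CE.comp_continuousOn (by fun_prop)) fun p _ => (P.CE_pos _).ne'
    exact ⟨⟨(le_max_left _ _).trans hp.1, hp.2.trans_lt ht.2⟩, hymem p (hsub hp)⟩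
  · intro p hp
    have hp0 : 0 < p := (le_max_left _ _).trans_lt hp.1
    have hpT : p < T := hp.2.trans ht.2
    have hpz : t - P.r * z < p := (le_max_right _ _).trans_lt hp.1
    have hyp : y p ∈ Ioo (0 : ℝ) 1 := by
      have h1 : P.c * (t - P.r * z) < P.c * p := mul_lt_mul_of_pos_left hpz hc
      have h2 : P.c * p < P.c * t := mul_lt_mul_of_pos_left hp.2 hc
      have h3 : P.c * (t - P.r * z) = P.c * t - z := by linear_combination (-z) * hrc
      simp only [hy]
      exact ⟨by linarith, by linarith [hz.2]⟩
    have hyp' := Ioo_subset_Icc_self hyp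
    -- The characteristic is interior to the domain for times strictly between a₀ and t, so the
    -- one-sided derivatives of the equation are ordinary partial derivatives there.
    have hnhds : Ico 0 T ×ˢ Icc (0 : ℝ) 1 ∈ 𝓝 (p, y p) :=
      prod_mem_nhds (Ico_mem_nhds hp0 hpT) (Icc_mem_nhds hyp.1 hyp.2)
    have hmem : (p, y p) ∈ Ico 0 T ×ˢ Icc (0 : ℝ) 1 := ⟨⟨hp0.le, hpT⟩, hyp'⟩
    have hd := ((hs.v_C1.differentiableOn one_ne_zero _ hmem).differentiableAt hnhds).hasFDerivAt
    set A := fderiv ℝ (fun p : ℝ × ℝ => v p.1 p.2) (p, y p) with hA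
    have d1 : HasDerivAt (fun s => v s (y p)) (A (1, 0)) p :=
      hd.comp_hasDerivAt (f := fun s => (s, y p)) p
        ((hasDerivAt_id p).prodMk (hasDerivAt_const p (y p)))
    have d2 : HasDerivAt (v p) (A (0, 1)) (y p) :=
      hd.comp_hasDerivAt (f := fun s => (p, s)) (y p)
        ((hasDerivAt_const (y p) p).prodMk (hasDerivAt_id (y p)))
    have dy : HasDerivAt y P.c p :=
      (((hasDerivAt_id p).const_mul P.c).const_add (z - P.c * t)).congr_deriv (mul_one _)
    have d3 : HasDerivAt (fun s => v s (y s)) (A (1, P.c)) p :=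
      hd.comp_hasDerivAt (f := fun s => (s, y s)) p ((hasDerivAt_id p).prodMk dy)
    have hpde := hs.pde p ⟨hp0.le, hpT⟩ (y p) hyp'
    rw [(d1.hasDerivWithinAt).derivWithin (uniqueDiffOn_Ici 0 p hp0.le),
      (d2.hasDerivWithinAt).derivWithin (uniqueDiffOn_Icc zero_lt_one _ hyp')] at hpde
    have hAe : A (1, P.c) = A (1, 0) + P.c * A (0, 1) := by
      rw [show ((1 : ℝ), P.c) = (1, 0) + P.c • (0, 1) by ext <;> simp, map_add, map_smul,
        smul_eq_mul]
    have hg : P.gbarS (y p) (x p) = P.g (y p) (xb p) + ∑ i, P.b i (y p) * v p (P.zpt i) +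
        ∑ i, P.β i (y p) * ∫ s in (0 : ℝ)..1, P.γ i s * v p s := by
      rw [hx, hs.stackedSignal_of_nonneg hφ hp0.le]
      rfl
    refine (d3.div ((P.hasDerivAt_CE (y p)).comp p dy) (P.CE_pos _).ne').congr_deriv ?_
    have hC := (P.CE_pos (y p)).ne'
    rw [psi_eq hA1 hyp', unitClamp_of_mem hyp', hAe, hpde, hg]
    simp only [Function.comp_apply]
    field_simp
    linear_combination (-(v p (y p) * P.a (y p))) * hrc

theorem IsPDESolution.integralForm (hA1 : P.A1) (hT : 0 < T) (hu : ContinuousOn u (Ici 0))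
    (hs : P.IsPDESolution T xb₀ v₀ u xb v) (hφ : P.Generates φ xb₀ v₀) :
    P.IntegralForm T xb₀ u (P.stackedSignal φ xb v) := by
  have hxc : ContinuousOn (P.stackedSignal φ xb v) (Ico (-P.r) T) :=
    hs.continuousOn_stackedSignal hT
  have hxp : ∀ t, 0 ≤ t → xPart (P.stackedSignal φ xb v t) = xb t := fun t ht => by
    rw [hs.stackedSignal_of_nonneg hφ ht]
    rfl
  refine ⟨hxc, fun t ht => ?_, fun t ht => ?_⟩
  · rw [hxp t ht.1, intervalIntegral.integral_eq_sub_of_hasDerivAt_of_le (f := xb) ht.1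
      (hs.xb_C1.continuousOn.mono fun s hs => ⟨hs.1, hs.2.trans_lt ht.2⟩), hs.xb_init]
    · abel
    · intro s hs'
      have hsT : s ∈ Ico 0 T := ⟨hs'.1.le, hs'.2.trans ht.2⟩
      have hd := ((hs.xb_C1.differentiableOn one_ne_zero s hsT).differentiableAt
        (Ico_mem_nhds hs'.1 hsT.2)).hasDerivAt
      have e := hs.ode s hsT
      rw [hd.hasDerivWithinAt.derivWithin (uniqueDiffOn_Ici 0 s hs'.1.le)] at e
      rw [hxp s hs'.1.le, ← prof_congr fun z hz => hs.eq_profile hA1 hT hφ hsT hz, ← e]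
      exact hd
    · refine ((continuousOn_Ft hA1 hu hxc).mono ?_).intervalIntegrable
      rw [uIcc_of_le ht.1]
      exact fun s hs => ⟨hs.1, hs.2.trans_lt ht.2⟩
  · rw [hxp t ht.1, ← measured_congr fun z hz => hs.eq_profile hA1 hT hφ ht hz]
    exact hs.stackedSignal_of_nonneg hφ ht.1

end FromPDE

end Loop

namespace Loop

variable {nb N₁ N₂ m k : ℕ} {P : Loop nb N₁ N₂ m k}

/-! ### The profile generated by a continuous signal on the real line -/

/-- The profile at time `t` generated by a continuous signal, as a function on `ℝ²`. -/
def flow (P : Loop nb N₁ N₂ m k) (x : ℝ → St nb N₁ N₂) (t z : ℝ) : ℝ :=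
  P.CE z * (charInt (fun s p => P.psi s (x p)) P.c t (z - P.c * t) -
    charInt (fun s p => P.psi s (x p)) P.c (t - P.r * z) (z - P.c * t))

/-- The time derivative of `flow`. -/
def flowDt (P : Loop nb N₁ N₂ m k) (x : ℝ → St nb N₁ N₂) (t z : ℝ) : ℝ :=
  P.CE z * (P.psi z (x t) - P.psi 0 (x (t - P.r * z)) -
    P.c * (charInt (fun s p => P.psiD s (x p)) P.c t (z - P.c * t) -
      charInt (fun s p => P.psiD s (x p)) P.c (t - P.r * z) (z - P.c * t)))

section Flow

variable {x : ℝ → St nb N₁ N₂}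

theorem continuous_psi_comp (hA1 : P.A1) (hx : Continuous x) :
    Continuous fun p : ℝ × ℝ => P.psi p.1 (x p.2) :=
  (continuous_psi hA1).comp (f := fun p : ℝ × ℝ => (p.1, x p.2)) (by fun_prop)

theorem continuous_psiD_comp (hA1 : P.A1) (hx : Continuous x) :
    Continuous fun p : ℝ × ℝ => P.psiD p.1 (x p.2) :=
  (continuous_psiD hA1).comp (f := fun p : ℝ × ℝ => (p.1, x p.2)) (by fun_prop)

theorem flow_eq (hA1 : P.A1) (hx : Continuous x) (t : ℝ) {z : ℝ} (hz : z ∈ Icc (0 : ℝ) 1) :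
    P.flow x t z = P.profile (hist P.r x t) z := by
  have hc : Continuous fun p => P.psi (z - P.c * t + P.c * p) (x p) :=
    (continuous_psi_comp hA1 hx).comp (f := fun p : ℝ => (z - P.c * t + P.c * p, p)) (by fun_prop)
  rw [profile_hist_eq hA1 hx.continuousOn hz, flow, charInt, charInt,
    intervalIntegral.integral_interval_sub_left (hc.intervalIntegrable _ _)
      (hc.intervalIntegrable _ _)]

theorem flowDt_eq (hA1 : P.A1) (hx : Continuous x) (t : ℝ) {z : ℝ} (hz : z ∈ Icc (0 : ℝ) 1) :
    P.flowDt x t z = P.rate (hist P.r x t) z := by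
  have hc : Continuous fun p => P.psiD (z - P.c * t + P.c * p) (x p) :=
    (continuous_psiD_comp hA1 hx).comp (f := fun p : ℝ => (z - P.c * t + P.c * p, p)) (by fun_prop)
  have hr := P.r_pos
  have hz0 := neg_r_mul_mem (P := P) hz
  rw [rate_eq hA1 _ hz, flowDt, charInt, charInt,
    intervalIntegral.integral_interval_sub_left (hc.intervalIntegrable _ _)
      (hc.intervalIntegrable _ _), P.ev_hist hx.continuousOn ⟨by linarith, le_rfl⟩,
    P.ev_hist hx.continuousOn hz0, add_zero, ← sub_eq_add_neg]
  have h := intervalIntegral.integral_comp_add_right (a := -(P.r * z)) (b := 0)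
    (fun p => P.psiD (z - P.c * t + P.c * p) (x p)) t
  rw [zero_add, show -(P.r * z) + t = t - P.r * z by ring] at h
  rw [← h]
  congr 3
  refine intervalIntegral.integral_congr fun p hp => ?_
  rw [uIcc_of_le hz0.2] at hp
  rw [P.ev_hist hx.continuousOn ⟨hz0.1.trans hp.1, hp.2⟩, add_comm p t,
    show z - P.c * t + P.c * (t + p) = z + P.c * p by ring]

/-- The characteristic integral is C¹ in its two arguments, because `psi` is differentiable in s
with continuous derivative on all of ℝ; the flow is made of it by composition with linear maps. No
differentiability of x in time is involved. -/
theorem contDiff_flow (hA1 : P.A1) (hx : Continuous x) :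
    ContDiff ℝ 1 fun p : ℝ × ℝ => P.flow x p.1 p.2 := by
  have hψ := continuous_psi_comp hA1 hx
  have hD := continuous_psiD_comp hA1 hx
  have hK : ContDiff ℝ 1 fun p : ℝ × ℝ => charInt (fun s p => P.psi s (x p)) P.c p.1 p.2 :=
    contDiff_of_partials (hasDerivAt_charInt_fst P.c hψ)
      (hasDerivAt_charInt_snd P.c hψ hD fun s p => hasDerivAt_psi hA1 s (x p))
      (hψ.comp (f := fun p : ℝ × ℝ => (p.2 + P.c * p.1, p.1)) (by fun_prop))
      (continuous_charInt P.c hD)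
  refine (P.contDiff_CE.comp contDiff_snd).mul (ContDiff.sub ?_ ?_)
  · exact hK.comp (f := fun p : ℝ × ℝ => (p.1, p.2 - P.c * p.1)) (by fun_prop)
  · exact hK.comp (f := fun p : ℝ × ℝ => (p.1 - P.r * p.2, p.2 - P.c * p.1)) (by fun_prop)

theorem continuous_flowDt (hA1 : P.A1) (hx : Continuous x) :
    Continuous fun p : ℝ × ℝ => P.flowDt x p.1 p.2 := by
  have hψ := continuous_psi_comp hA1 hx
  have hD := continuous_charInt (G := fun s p => P.psiD s (x p)) P.c (continuous_psiD_comp hA1 hx)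
  refine (P.continuous_CE.comp continuous_snd).mul (Continuous.sub (Continuous.sub ?_ ?_)
    (continuous_const.mul (Continuous.sub ?_ ?_)))
  · exact hψ.comp (f := fun p : ℝ × ℝ => (p.2, p.1)) (by fun_prop)
  · exact hψ.comp (f := fun p : ℝ × ℝ => (0, p.1 - P.r * p.2)) (by fun_prop)
  · exact hD.comp (f := fun p : ℝ × ℝ => (p.1, p.2 - P.c * p.1)) (by fun_prop)
  · exact hD.comp (f := fun p : ℝ × ℝ => (p.1 - P.r * p.2, p.2 - P.c * p.1)) (by fun_prop)

/-- The z-derivative is stated through `flowDt` so that, after multiplication by c, the sum of the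
two derivatives is visibly a · flow + C · ψ, the right-hand side of the transport equation. -/
theorem hasDerivAt_flow (hA1 : P.A1) (hx : Continuous x) (t z : ℝ) :
    HasDerivAt (fun t => P.flow x t z) (P.flowDt x t z) t ∧
    HasDerivAt (fun z => P.flow x t z) (P.r * P.a (unitClamp z) * P.flow x t z +
      P.r * (P.CE z * P.psi z (x t) - P.flowDt x t z)) z := by
  have hψ := continuous_psi_comp hA1 hx
  have hD := continuous_psiD_comp hA1 hx
  have hrc := P.r_mul_c
  have hK := hasFDerivAt_of_partials (hasDerivAt_charInt_fst P.c hψ)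
      (hasDerivAt_charInt_snd P.c hψ hD fun s p => hasDerivAt_psi hA1 s (x p))
      (hψ.comp (f := fun p : ℝ × ℝ => (p.2 + P.c * p.1, p.1)) (by fun_prop))
      (continuous_charInt P.c hD)
  -- The two ends of the characteristic: position z at time t, and position 0 at time t - rz.
  have e1 : z - P.c * t + P.c * t = z := by ring
  have e2 : z - P.c * t + P.c * (t - P.r * z) = 0 := by linear_combination (-z) * hrc
  constructor
  · have dy : HasDerivAt (fun t => z - P.c * t) (-P.c) t :=
      (((hasDerivAt_id t).const_mul P.c).const_sub z).congr_deriv (by rw [mul_one])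
    have k1 := (hK (t, z - P.c * t)).comp_hasDerivAt (f := fun t => (t, z - P.c * t)) t
      ((hasDerivAt_id t).prodMk dy)
    have k2 := (hK (t - P.r * z, z - P.c * t)).comp_hasDerivAt
      (f := fun t => (t - P.r * z, z - P.c * t)) t (((hasDerivAt_id t).sub_const _).prodMk dy)
    refine ((k1.sub k2).const_mul (P.CE z)).congr_deriv ?_
    simp only [add_apply, smul_apply,
      ContinuousLinearMap.coe_fst', ContinuousLinearMap.coe_snd', smul_eq_mul, e1, e2, flowDt]
    ring
  · have dy : HasDerivAt (fun z => z - P.c * t) 1 z := (hasDerivAt_id z).sub_const _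
    have dz : HasDerivAt (fun z => t - P.r * z) (-P.r) z :=
      (((hasDerivAt_id z).const_mul P.r).const_sub t).congr_deriv (by rw [mul_one])
    have k1 := (hK (t, z - P.c * t)).comp_hasDerivAt (f := fun z => (t, z - P.c * t)) z
      ((hasDerivAt_const z t).prodMk dy)
    have k2 := (hK (t - P.r * z, z - P.c * t)).comp_hasDerivAt
      (f := fun z => (t - P.r * z, z - P.c * t)) z (dz.prodMk dy)
    refine ((P.hasDerivAt_CE z).mul (k1.sub k2)).congr_deriv ?_
    simp only [add_apply, smul_apply, Pi.sub_apply,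
      Function.comp_apply,
      ContinuousLinearMap.coe_fst', ContinuousLinearMap.coe_snd', smul_eq_mul, e2, flowDt, flow]
    linear_combination (-P.CE z * (charInt (fun s p => P.psiD s (x p)) P.c t (z - P.c * t) -
      charInt (fun s p => P.psiD s (x p)) P.c (t - P.r * z) (z - P.c * t))) * hrc

theorem hasDerivAt_integral_flow (hA1 : P.A1) (hx : Continuous x) (i : Fin N₂) (t : ℝ) :
    HasDerivAt (fun t => ∫ z in (0 : ℝ)..1, P.γ i (unitClamp z) * P.flow x t z)
      (∫ z in (0 : ℝ)..1, P.γ i (unitClamp z) * P.flowDt x t z) t := by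
  have hγ := continuous_comp_unitClamp (P.γ_cont i)
  -- With speed 0 the characteristic integral is an ordinary integral over z ∈ [0, 1], and time
  -- takes the place of the parameter.
  have h := hasDerivAt_charInt_snd (G := fun s p => P.γ i (unitClamp p) * P.flow x s p)
    (G' := fun s p => P.γ i (unitClamp p) * P.flowDt x s p) 0
    ((hγ.comp continuous_snd).mul (contDiff_flow hA1 hx).continuous)
    ((hγ.comp continuous_snd).mul (continuous_flowDt hA1 hx))
    (fun s p => (hasDerivAt_flow hA1 hx s p).1.const_mul _) 1 t
  simpa only [charInt, zero_mul, add_zero] using h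

end Flow

/-! ### From the delay system to the loop -/

section FromDelay

variable {xb₀ : Eu nb} {v₀ : ℝ → ℝ} {u : ℝ → Eu m} {φ : Hist P.r (St nb N₁ N₂)}
  {x : ℝ → St nb N₁ N₂}

theorem continuousOn_Ici_of_delaySolution {E : Type*} [NormedAddCommGroup E] [NormedSpace ℝ E]
    {r : ℝ} {φ : Hist r E} {x rhs : ℝ → E} (h : ∀ T > 0, IsDelaySolution r T φ x rhs) :
    ContinuousOn x (Ici (-r)) := by
  intro t ht
  have h1 := (h (max t 0 + 1) (by positivity)).cont t ⟨ht, by linarith [le_max_left t 0]⟩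
  refine h1.mono_of_mem_nhdsWithin ?_
  filter_upwards [self_mem_nhdsWithin, mem_nhdsWithin_of_mem_nhds
    (Iio_mem_nhds (show t < max t 0 + 1 by linarith [le_max_left t 0]))] with s hs hs'
  exact ⟨hs, hs'⟩

theorem continuousOn_f_hist (hA1 : P.A1) (hA3 : P.A3) (hu : ContinuousOn u (Ici 0))
    (hx : ContinuousOn x (Ici (-P.r))) :
    ContinuousOn (fun t => P.f (hist P.r x t) (u t) 0) (Ici 0) := by
  refine (continuous_f hA1 hA3).comp_continuousOn (f := fun t => (hist P.r x t, u t))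
    (ContinuousOn.prodMk (fun t ht => ?_) hu)
  have h1 := continuousOn_hist (T := t + 1) P.r_pos.le (hx.mono fun s hs => hs.1) t
    ⟨ht, by linarith⟩
  refine h1.mono_of_mem_nhdsWithin ?_
  filter_upwards [self_mem_nhdsWithin, mem_nhdsWithin_of_mem_nhds
    (Iio_mem_nhds (show t < t + 1 by linarith))] with s hs hs'
  exact ⟨hs, hs'⟩

/-- The right-hand side is continuous in time, so the almost-everywhere equation is equivalent to an
integral equation. -/
theorem delaySolution_sub_eq (hA1 : P.A1) (hA3 : P.A3) (hu : ContinuousOn u (Ici 0))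
    (h : ∀ T > 0, IsDelaySolution P.r T φ x fun t => P.f (hist P.r x t) (u t) 0)
    {s t : ℝ} (hs : 0 ≤ s) (hst : s ≤ t) :
    x t - x s = ∫ p in s..t, P.f (hist P.r x p) (u p) 0 := by
  have hc := (continuousOn_f_hist hA1 hA3 hu (continuousOn_Ici_of_delaySolution h)).mono
    (show Icc s t ⊆ Ici 0 from fun p hp => hs.trans hp.1)
  obtain ⟨M, hM⟩ := isCompact_Icc.exists_bound_of_continuousOn hc
  have ht0 : 0 ≤ t := hs.trans hst
  have h1 := h (t + 1) (by linarith)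
  refine AbsolutelyContinuousOnInterval.sub_eq_integral hst ?_ ?_ ?_ hM
  · rcases ht0.eq_or_lt with h0 | h0
    · have : s = t := le_antisymm hst (by linarith)
      subst this
      exact LipschitzOnWith.absolutelyContinuousOnInterval (K := 0) (by simp)
    · refine (h1.ode.1 t ⟨h0, by linarith⟩).mono ?_
      rw [uIcc_of_le hst, uIcc_of_le ht0]
      exact Icc_subset_Icc_left hs
  · filter_upwards [h1.ode.2] with p hp hp'
    exact hp ⟨hs.trans_lt hp'.1, by linarith [hp'.2]⟩
  · refine ContinuousOn.intervalIntegrable ?_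
    rwa [uIcc_of_le hst]

/-- The delay system prescribes only that η and λ move at the rate of the profile's measurements. A
generating history makes them equal at time 0, so they stay equal; then `flow`, whose source is
built from η and λ, solves the transport equation with v(t, z_i) and the integrals of v in their
place. -/
theorem exists_solution_of_delay (hA1 : P.A1) (hA3 : P.A3) (hu : ContinuousOn u (Ici 0))
    (hφ : P.Generates φ xb₀ v₀)
    (h : ∀ T > 0, IsDelaySolution P.r T φ x fun t => P.f (hist P.r x t) (u t) 0) :
    ∃ v : ℝ → ℝ → ℝ, (∀ t, 0 ≤ t → ∀ z ∈ Icc (0 : ℝ) 1, v t z = P.profile (hist P.r x t) z) ∧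
      (∀ T > 0, P.IsPDESolution T xb₀ v₀ u (fun t => xPart (x t)) v) ∧
      (∀ T > 0, P.IntegralForm T xb₀ u x) := by
  have hr := P.r_pos
  have hxc := continuousOn_Ici_of_delaySolution h
  -- Constant extension before -r: the windows of times t ≥ 0 do not see it, and `flow` requires a
  -- continuous signal on ℝ.
  set y : ℝ → St nb N₁ N₂ := fun t => x (max t (-P.r)) with hy
  have hyc : Continuous y := hxc.comp_continuous (by fun_prop) fun t => mem_Ici.2 (le_max_right _ _)
  have hyx : ∀ t, -P.r ≤ t → y t = x t := fun t ht => by simp only [hy, max_eq_left ht]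
  have hhist : ∀ t, 0 ≤ t → hist P.r y t = hist P.r x t := fun t ht =>
    hist_congr fun p hp => hyx p (by linarith [hp.1])
  have hfl : ∀ t, 0 ≤ t → ∀ z ∈ Icc (0 : ℝ) 1, P.flow y t z = P.profile (hist P.r x t) z :=
    fun t ht z hz => by rw [flow_eq hA1 hyc t hz, hhist t ht]
  have hfd : ∀ t, 0 ≤ t → ∀ z ∈ Icc (0 : ℝ) 1, P.flowDt y t z = P.rate (hist P.r x t) z :=
    fun t ht z hz => by rw [flowDt_eq hA1 hyc t hz, hhist t ht]
  have hinit : hist P.r x 0 = φ := by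
    ext θ
    rw [hist_apply (hxc.mono fun p hp => mem_Ici.2 (by linarith [hp.1])), zero_add,
      (h 1 one_pos).init θ]
  have hx0 : x 0 = P.measured xb₀ v₀ := by
    have h0 : (0 : ℝ) ∈ Icc (-P.r) 0 := ⟨by linarith, le_rfl⟩
    rw [← hφ.ev_zero, P.ev_of_mem _ h0]
    exact (h 1 one_pos).init ⟨0, h0⟩
  have hcomp : ∀ j t, 0 ≤ t → x t j = x 0 j + ∫ p in (0 : ℝ)..t, P.f (hist P.r x p) (u p) 0 j := by
    intro j t ht
    have h1 := delaySolution_sub_eq hA1 hA3 hu h le_rfl ht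
    have hi : IntervalIntegrable (fun t => P.f (hist P.r x t) (u t) 0) volume 0 t := by
      refine ((continuousOn_f_hist hA1 hA3 hu hxc).mono ?_).intervalIntegrable
      rw [uIcc_of_le ht]
      exact fun p hp => hp.1
    have h2 : ∫ p in (0 : ℝ)..t, P.f (hist P.r x p) (u p) 0 j =
        (∫ p in (0 : ℝ)..t, P.f (hist P.r x p) (u p) 0) j :=
      (EuclideanSpace.proj (𝕜 := ℝ) j).intervalIntegral_comp_comm hi
    rw [h2, ← h1, PiLp.sub_apply]
    ring
  have hmeas : ∀ t, 0 ≤ t → x t = P.measured (xPart (x t)) (P.profile (hist P.r x t)) := by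
    intro t ht
    ext j
    rcases j with j | i | i
    · rfl
    · change x t (Sum.inr (Sum.inl i)) = P.profile (hist P.r x t) (P.zpt i)
      have hz := Ioc_subset_Icc_self (P.zpt_mem i)
      have hcd : Continuous fun s => P.flowDt y s (P.zpt i) :=
        (continuous_flowDt hA1 hyc).comp (f := fun s : ℝ => (s, P.zpt i)) (by fun_prop)
      have e := intervalIntegral.integral_eq_sub_of_hasDerivAt (a := 0) (b := t)
        (fun s _ => (hasDerivAt_flow hA1 hyc s (P.zpt i)).1) (hcd.intervalIntegrable _ _)
      rw [hcomp _ t ht, ← hfl t ht _ hz]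
      have e2 : ∫ p in (0 : ℝ)..t, P.f (hist P.r x p) (u p) 0 (Sum.inr (Sum.inl i)) =
          ∫ p in (0 : ℝ)..t, P.flowDt y p (P.zpt i) := by
        refine intervalIntegral.integral_congr fun p hp => ?_
        rw [uIcc_of_le ht] at hp
        exact (hfd p hp.1 _ hz).symm
      have e3 : x 0 (Sum.inr (Sum.inl i)) = P.flow y 0 (P.zpt i) := by
        rw [hfl 0 le_rfl _ hz, hinit, ← hφ.profile_eq _ hz, hx0]
        rfl
      rw [e2, e, e3]
      ring
    · change x t (Sum.inr (Sum.inr i)) = ∫ z in (0 : ℝ)..1, P.γ i z * P.profile (hist P.r x t) z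
      have hγ := continuous_comp_unitClamp (P.γ_cont i)
      have hcl : ∀ (w w' : ℝ → ℝ), (∀ z ∈ Icc (0 : ℝ) 1, w z = w' z) →
          ∫ z in (0 : ℝ)..1, P.γ i (unitClamp z) * w z = ∫ z in (0 : ℝ)..1, P.γ i z * w' z := by
        intro w w' hw
        refine intervalIntegral.integral_congr fun z hz => ?_
        rw [uIcc_of_le zero_le_one] at hz
        simp only [unitClamp_of_mem hz, hw z hz]
      have hcd : Continuous fun s => ∫ z in (0 : ℝ)..1, P.γ i (unitClamp z) * P.flowDt y s z :=
        intervalIntegral.continuous_parametric_intervalIntegral_of_continuous'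
          (f := fun s z => P.γ i (unitClamp z) * P.flowDt y s z)
          ((hγ.comp continuous_snd).mul (continuous_flowDt hA1 hyc)) 0 1
      have e := intervalIntegral.integral_eq_sub_of_hasDerivAt (a := 0) (b := t)
        (fun s _ => hasDerivAt_integral_flow hA1 hyc i s) (hcd.intervalIntegrable _ _)
      rw [hcomp _ t ht, ← hcl _ _ (hfl t ht)]
      have e2 : ∫ p in (0 : ℝ)..t, P.f (hist P.r x p) (u p) 0 (Sum.inr (Sum.inr i)) =
          ∫ p in (0 : ℝ)..t, ∫ z in (0 : ℝ)..1, P.γ i (unitClamp z) * P.flowDt y p z := by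
        refine intervalIntegral.integral_congr fun p hp => ?_
        rw [uIcc_of_le ht] at hp
        simp only
        rw [hcl _ _ (hfd p hp.1)]
        exact f₃_apply hA1 _ i
      have e3 : x 0 (Sum.inr (Sum.inr i)) =
          ∫ z in (0 : ℝ)..1, P.γ i (unitClamp z) * P.flow y 0 z := by
        rw [hcl _ v₀ fun z hz => by rw [hfl 0 le_rfl _ hz, hinit, ← hφ.profile_eq _ hz], hx0]
        rfl
      rw [e2, e, e3]
      ring
  have hFc : ContinuousOn (fun s => P.Ft (xPart (x s)) (prof (P.profile (hist P.r x s))) (u s))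
      (Ici 0) := by
    intro t ht
    have h1 := continuousOn_Ft (T := t + 1) hA1 hu (hxc.mono fun s hs => hs.1) t
      ⟨ht, by linarith⟩
    refine h1.mono_of_mem_nhdsWithin ?_
    filter_upwards [self_mem_nhdsWithin, mem_nhdsWithin_of_mem_nhds
      (Iio_mem_nhds (show t < t + 1 by linarith))] with s hs hs'
    exact ⟨hs, hs'⟩
  have hmild : ∀ t, 0 ≤ t → xPart (x t) = xb₀ + ∫ s in (0 : ℝ)..t,
      P.Ft (xPart (x s)) (prof (P.profile (hist P.r x s))) (u s) := by
    intro t ht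
    have hi : IntervalIntegrable (fun s => P.Ft (xPart (x s))
        (prof (P.profile (hist P.r x s))) (u s)) volume 0 t := by
      refine (hFc.mono ?_).intervalIntegrable
      rw [uIcc_of_le ht]
      exact fun p hp => hp.1
    ext j
    have h2 : ∫ s in (0 : ℝ)..t, P.Ft (xPart (x s)) (prof (P.profile (hist P.r x s))) (u s) j =
        (∫ s in (0 : ℝ)..t, P.Ft (xPart (x s)) (prof (P.profile (hist P.r x s))) (u s)) j :=
      (EuclideanSpace.proj (𝕜 := ℝ) j).intervalIntegral_comp_comm hi
    rw [PiLp.add_apply, ← h2]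
    change x t (Sum.inl j) = _
    rw [hcomp _ t ht, hx0]
    congr 1
    refine intervalIntegral.integral_congr fun p hp => ?_
    rw [uIcc_of_le ht] at hp
    change P.f₁ (hist P.r x p) (u p) 0 j = _
    rw [f₁_eq, add_zero, P.ev_hist (hxc.mono fun q hq => mem_Ici.2 (by linarith [hq.1, hp.1]))
      ⟨by linarith, le_rfl⟩, add_zero]
  have hode := contDiffOn_of_eq_integral hFc hmild
  refine ⟨P.flow y, hfl, fun T hT => ?_, fun T hT => ?_⟩
  · refine ⟨hode.1.mono fun t ht => ht.1, (contDiff_flow hA1 hyc).contDiffOn, ?_, fun z hz => ?_,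
      fun t ht => ?_, fun t ht z hz => ?_, fun t ht => ?_⟩
    · rw [hx0]
      rfl
    · rw [hfl 0 le_rfl z hz, hinit, hφ.profile_eq z hz]
    · rw [hode.2 t ht.1, prof_congr fun z hz => (hfl t ht.1 z hz).symm]
    · obtain ⟨d1, d2⟩ := hasDerivAt_flow hA1 hyc t z
      have hg : P.gbarS z (x t) = P.g z (xPart (x t)) + ∑ i, P.b i z * P.flow y t (P.zpt i) +
          ∑ i, P.β i z * ∫ s in (0 : ℝ)..1, P.γ i s * P.flow y t s := by
        conv_lhs => rw [hmeas t ht.1, ← measured_congr fun z hz => hfl t ht.1 z hz]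
        rfl
      rw [d1.hasDerivWithinAt.derivWithin (uniqueDiffOn_Ici 0 t ht.1),
        d2.hasDerivWithinAt.derivWithin (uniqueDiffOn_Icc zero_lt_one z hz), psi_eq hA1 hz,
        hyx t (by linarith [ht.1]), unitClamp_of_mem hz, add_assoc (P.a z * P.flow y t z),
        add_assoc (P.a z * P.flow y t z), ← hg, mul_div_cancel₀ _ (P.CE_pos z).ne']
      linear_combination (P.a z * P.flow y t z + P.gbarS z (x t) - P.flowDt y t z) * P.r_mul_c
    · rw [hfl t ht.1 0 ⟨le_rfl, zero_le_one⟩, profile]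
      simp
  · exact ⟨hxc.mono fun t ht => ht.1, fun t ht => hmild t ht.1, fun t ht => hmeas t ht.1⟩

end FromDelay

end Loop

/-! ### Delay equations with a one-sided Lipschitz right-hand side -/

theorem mem_closedBall_triple {Z Y V : Type*} [NormedAddCommGroup Z] [NormedAddCommGroup Y]
    [NormedAddCommGroup V] {r A : ℝ} {p : Hist r Z × Y × V} :
    p ∈ Metric.closedBall (0 : Hist r Z × Y × V) A ↔ ‖p.1‖ ≤ A ∧ ‖p.2.1‖ ≤ A ∧ ‖p.2.2‖ ≤ A := by
  rw [mem_closedBall_zero_iff, Prod.norm_def, Prod.norm_def]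
  simp only [sup_le_iff]

theorem exists_bound_input {V : Type*} [NormedAddCommGroup V] {u : ℝ → V}
    (hu : ContinuousOn u (Ici 0)) (T₁ : ℝ) :
    ∃ A : ℝ, 0 ≤ A ∧ ∀ p ∈ Icc 0 T₁, ‖u p‖ ≤ A := by
  obtain ⟨A, hA⟩ := isCompact_Icc.exists_bound_of_continuousOn
    (hu.mono fun s (hs : s ∈ Icc 0 T₁) => hs.1)
  exact ⟨max A 0, le_max_right _ _, fun p hp => (hA p hp).trans (le_max_left _ _)⟩

section OneSided

variable {Z Y V : Type*} [NormedAddCommGroup Z] [InnerProductSpace ℝ Z]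
  [NormedAddCommGroup Y] [NormedAddCommGroup V]
  {r : ℝ} {F : Hist r Z → Y → V → Z} {z₀ : Hist r Z} {u : ℝ → V}

theorem IsDelaySolution.congr_rhs {E : Type*} [NormedAddCommGroup E] [NormedSpace ℝ E]
    {r T : ℝ} {φ : Hist r E} {x rhs rhs' : ℝ → E} (h : IsDelaySolution r T φ x rhs)
    (he : EqOn rhs rhs' (Ioo 0 T)) : IsDelaySolution r T φ x rhs' := by
  refine ⟨h.cont, h.init, h.ode.1, ?_⟩
  filter_upwards [h.ode.2] with t ht ht'
  rw [← he ht']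
  exact ht ht'

/-- `F` satisfies the one-sided Lipschitz inequality with constant `L` on `Ω`. -/
def OneSidedOn (F : Hist r Z → Y → V → Z) (Ω : Set (Hist r Z × Y × V)) (L : ℝ) : Prop :=
  ∀ (z z' : Hist r Z) (y : Y) (u : V), (z, y, u) ∈ Ω → (z', y, u) ∈ Ω →
    ∀ θ₀ : Icc (-r) (0 : ℝ), (θ₀ : ℝ) = 0 →
      inner ℝ (z θ₀ - z' θ₀) (F z y u - F z' y u) ≤ L * ‖z - z'‖ ^ 2

variable {w w' : ℝ → Y} {z z' : ℝ → Z} {T T' T₁ : ℝ}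

/-- The derivative of ‖z - z'‖² is split at F(z_t, w', u): the first part is at most ‖z - z'‖² + ε²
by Young's inequality, the second at most 2L‖z_t - z'_t‖² by the one-sided condition. The two inputs
are compared along z only, so this part needs no information on z'. -/
theorem normSq_sub_le_of_oneSided {Ω : Set (Hist r Z × Y × V)} {L ε : ℝ} (hr : 0 ≤ r) (hL : 0 ≤ L)
    (hF : OneSidedOn F Ω L)
    (hz : IsDelaySolution r T z₀ z fun t => F (hist r z t) (w t) (u t))
    (hz' : IsDelaySolution r T' z₀ z' fun t => F (hist r z' t) (w' t) (u t))
    (hT : T₁ < T) (hT' : T₁ < T')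
    (hΩ : ∀ t ∈ Ico 0 T₁, (hist r z t, w' t, u t) ∈ Ω ∧ (hist r z' t, w' t, u t) ∈ Ω)
    (hε : ∀ t ∈ Ico 0 T₁, ‖F (hist r z t) (w t) (u t) - F (hist r z t) (w' t) (u t)‖ ≤ ε) :
    ∀ t ∈ Icc 0 T₁, ‖z t - z' t‖ ^ 2 ≤ 2 * ε ^ 2 * Real.exp (2 * (1 + 2 * L) * t) := by
  -- Twice the total gain 1 + 2L. As κ > 0 the weight increases, so the supremum over a window is
  -- bounded by the weight at its right end.
  set κ : ℝ := 2 * (1 + 2 * L) with hκ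
  have hκ0 : 0 < κ := by positivity
  have hκ1 : 1 ≤ κ := by linarith
  have hzc : ContinuousOn z (Icc (-r) T₁) := hz.cont.mono fun s hs => ⟨hs.1, hs.2.trans_lt hT⟩
  have hzc' : ContinuousOn z' (Icc (-r) T₁) := hz'.cont.mono fun s hs => ⟨hs.1, hs.2.trans_lt hT'⟩
  have hsub : Icc 0 T₁ ⊆ Icc (-r) T₁ := Icc_subset_Icc_left (by linarith)
  have hneg : ∀ p ∈ Icc (-r) 0, z p = z' p := fun p hp =>
    (hz.init ⟨p, hp⟩).trans (hz'.init ⟨p, hp⟩).symm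
  refine le_of_weighted_contraction (((hzc.mono hsub).sub (hzc'.mono hsub)).norm.pow 2)
    (fun _ _ => by positivity) fun S hS hM t ht => ?_
  have hwin : ∀ s ∈ Icc 0 T₁, Icc (s - r) s ⊆ Icc (-r) T₁ := fun s hs p hp =>
    ⟨by linarith [hp.1, hs.1], hp.2.trans hs.2⟩
  have hH : ∀ s ∈ Icc 0 T₁, ‖hist r z s - hist r z' s‖ ^ 2 ≤ S * Real.exp (κ * s) := by
    intro s hs
    have h1 : ‖hist r z s - hist r z' s‖ ≤ √(S * Real.exp (κ * s)) := by
      refine norm_hist_sub_le (Real.sqrt_nonneg _) (fun p hp => ?_) (hzc.mono (hwin s hs))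
        (hzc'.mono (hwin s hs))
      rcases le_or_gt p 0 with h | h
      · rw [hneg p ⟨(hwin s hs hp).1, h⟩, sub_self, norm_zero]
        exact Real.sqrt_nonneg _
      · refine Real.le_sqrt_of_sq_le ((hM p ⟨h.le, hp.2.trans hs.2⟩).trans ?_)
        have := hp.2
        gcongr
    calc _ ≤ √(S * Real.exp (κ * s)) ^ 2 := by gcongr
      _ = _ := Real.sq_sqrt (by positivity)
  rcases ht.1.eq_or_lt with h0 | h0
  · rw [← h0, hneg 0 ⟨by linarith, le_rfl⟩, sub_self, norm_zero, zero_pow two_ne_zero]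
    positivity
  have hac : AbsolutelyContinuousOnInterval (fun s => z s - z' s) 0 t :=
    (hz.ode.1 t ⟨h0, ht.2.trans_lt hT⟩).sub (hz'.ode.1 t ⟨h0, ht.2.trans_lt hT'⟩)
  have key := hac.normSq_sub_le (g := fun s => F (hist r z s) (w s) (u s) -
    F (hist r z' s) (w' s) (u s)) (β := fun s => ((1 + 2 * L) * S + ε ^ 2) * Real.exp (κ * s))
    ht.1 (by
      filter_upwards [hz.ode.2, hz'.ode.2] with s h1 h2 hs
      exact (h1 ⟨hs.1, (hs.2.trans_le ht.2).trans hT⟩).sub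
        (h2 ⟨hs.1, (hs.2.trans_le ht.2).trans hT'⟩))
    (Continuous.intervalIntegrable (by fun_prop) _ _) fun s hs => ?_
  · rw [hneg 0 ⟨by linarith, le_rfl⟩, sub_self, norm_zero, intervalIntegral.integral_const_mul]
      at key
    have h1 := mul_le_mul_of_nonneg_left (integral_exp_mul_le hκ0 0 t)
      (show 0 ≤ (1 + 2 * L) * S + ε ^ 2 by positivity)
    have h2 : ((1 + 2 * L) * S + ε ^ 2) * (Real.exp (κ * t) / κ) ≤
        (S / 2 + ε ^ 2) * Real.exp (κ * t) := by
      rw [mul_div_assoc', div_le_iff₀ hκ0]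
      have : 0 ≤ ε ^ 2 * Real.exp (κ * t) * (κ - 1) :=
        mul_nonneg (by positivity) (by linarith)
      have e : S * Real.exp (κ * t) * κ = S * Real.exp (κ * t) * (2 * (1 + 2 * L)) := by rw [hκ]
      nlinarith
    have h3 : ‖z t - z' t‖ ^ 2 ≤ ((1 + 2 * L) * S + ε ^ 2) * ∫ x in (0 : ℝ)..t, Real.exp (κ * x) := by
      simpa using key
    linarith
  · have hs' : s ∈ Icc 0 T₁ := ⟨hs.1.le, hs.2.le.trans ht.2⟩
    have hs'' : s ∈ Ico 0 T₁ := ⟨hs.1.le, hs.2.trans_le ht.2⟩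
    set b := F (hist r z s) (w' s) (u s) with hb
    have hθ : (0 : ℝ) ∈ Icc (-r) 0 := ⟨by linarith, le_rfl⟩
    have i1 := hF _ _ _ _ (hΩ s hs'').1 (hΩ s hs'').2 ⟨0, hθ⟩ rfl
    rw [hist_apply (hzc.mono (hwin s hs')), hist_apply (hzc'.mono (hwin s hs'))] at i1
    simp only [add_zero] at i1
    have i2 : inner ℝ (z s - z' s) (F (hist r z s) (w s) (u s) - b) ≤ ‖z s - z' s‖ * ε :=
      (real_inner_le_norm _ _).trans (mul_le_mul_of_nonneg_left (hε s hs'') (norm_nonneg _))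
    have i3 : inner ℝ (z s - z' s) (F (hist r z s) (w s) (u s) - F (hist r z' s) (w' s) (u s)) =
        inner ℝ (z s - z' s) (F (hist r z s) (w s) (u s) - b) +
        inner ℝ (z s - z' s) (b - F (hist r z' s) (w' s) (u s)) := by
      rw [← inner_add_right]
      congr 1
      abel
    have i4 := hM s hs'
    have i5 := mul_le_mul_of_nonneg_left (hH s hs') hL
    have i6 : ε ^ 2 ≤ ε ^ 2 * Real.exp (κ * s) :=
      le_mul_of_one_le_right (by positivity) (Real.one_le_exp (mul_nonneg hκ0.le hs.1.le))
    rw [i3]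
    nlinarith [sq_nonneg (‖z s - z' s‖ - ε)]

theorem exists_bound_solution {E : Type*} [NormedAddCommGroup E] [NormedSpace ℝ E] {φ : Hist r E}
    {x rhs : ℝ → E} (hz : IsDelaySolution r T φ x rhs) (hT : T₁ < T) :
    ∃ A : ℝ, 0 ≤ A ∧ ∀ p ∈ Icc (-r) T₁, ‖x p‖ ≤ A := by
  obtain ⟨A, hA⟩ := isCompact_Icc.exists_bound_of_continuousOn
    (hz.cont.mono fun s (hs : s ∈ Icc (-r) T₁) => ⟨hs.1, hs.2.trans_lt hT⟩)
  exact ⟨max A 0, le_max_right _ _, fun p hp => (hA p hp).trans (le_max_left _ _)⟩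

theorem norm_hist_le_of_bound {E : Type*} [NormedAddCommGroup E] {x : ℝ → E} {A : ℝ} (hA : 0 ≤ A)
    (hx : ContinuousOn x (Icc (-r) T₁)) (h : ∀ p ∈ Icc (-r) T₁, ‖x p‖ ≤ A) {t : ℝ}
    (ht : t ∈ Icc 0 T₁) : ‖hist r x t‖ ≤ A := by
  have hsub : Icc (t - r) t ⊆ Icc (-r) T₁ := fun p hp => ⟨by linarith [hp.1, ht.1], hp.2.trans ht.2⟩
  exact norm_hist_le hA (fun p hp => h p (hsub hp)) (hx.mono hsub)

/-- The case ε = 0 of the energy estimate; a bound on w is required because the one-sided constant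
is available only on bounded sets. -/
theorem eqOn_of_oneSided
    (hF : ∀ Ω : Set (Hist r Z × Y × V), Bornology.IsBounded Ω → ∃ L, 0 ≤ L ∧ OneSidedOn F Ω L)
    (hr : 0 ≤ r) (hu : ContinuousOn u (Ici 0))
    (hz : IsDelaySolution r T z₀ z fun t => F (hist r z t) (w t) (u t))
    (hz' : IsDelaySolution r T' z₀ z' fun t => F (hist r z' t) (w' t) (u t))
    (hT : T₁ < T) (hT' : T₁ < T') (hw : EqOn w w' (Ico 0 T₁))
    (hb : ∃ B, ∀ t ∈ Ico 0 T₁, ‖w t‖ ≤ B) : EqOn z z' (Icc (-r) T₁) := by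
  obtain ⟨A, hA0, hA⟩ := exists_bound_solution hz hT
  obtain ⟨A', hA0', hA'⟩ := exists_bound_solution hz' hT'
  obtain ⟨U, hU0, hU⟩ := exists_bound_input hu T₁
  obtain ⟨B, hB⟩ := hb
  obtain ⟨L, hL, h⟩ := hF (Metric.closedBall 0 (A + A' + U + |B|)) Metric.isBounded_closedBall
  have hzc : ContinuousOn z (Icc (-r) T₁) := hz.cont.mono fun s hs => ⟨hs.1, hs.2.trans_lt hT⟩
  have hzc' : ContinuousOn z' (Icc (-r) T₁) := hz'.cont.mono fun s hs => ⟨hs.1, hs.2.trans_lt hT'⟩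
  have key := normSq_sub_le_of_oneSided (ε := 0) hr hL h hz hz' hT hT' (fun t ht => ?_)
    (fun t ht => by rw [hw ht, sub_self, norm_zero])
  · intro t ht
    rcases le_or_gt t 0 with h0 | h0
    · exact (hz.init ⟨t, ht.1, h0⟩).trans (hz'.init ⟨t, ht.1, h0⟩).symm
    · have := key t ⟨h0.le, ht.2⟩
      rw [zero_pow two_ne_zero, mul_zero, zero_mul] at this
      have h2 : ‖z t - z' t‖ = 0 := by
        have := le_antisymm this (by positivity)
        exact pow_eq_zero_iff two_ne_zero |>.1 this
      exact sub_eq_zero.1 (norm_eq_zero.1 h2)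
  · have h1 := norm_hist_le_of_bound hA0 hzc hA ⟨ht.1, ht.2.le⟩
    have h2 := norm_hist_le_of_bound hA0' hzc' hA' ⟨ht.1, ht.2.le⟩
    have h3 : ‖w' t‖ ≤ |B| := by rw [← hw ht]; exact (hB t ht).trans (le_abs_self B)
    have h4 := hU t ⟨ht.1, ht.2.le⟩
    have h5 := abs_nonneg B
    rw [mem_closedBall_triple, mem_closedBall_triple]
    exact ⟨⟨by simp only; linarith, by simp only; linarith, by simp only; linarith⟩,
      ⟨by simp only; linarith, by simp only; linarith, by simp only; linarith⟩⟩

/-- F is uniformly continuous on the compact set swept by the histories of z, the inputs u and a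
ball of values w, so a small change of w perturbs the equation along z by at most ε₁. The one-sided
constant presupposes a bound on z'; it is obtained by stopping at the first time the two solutions
are 2η apart, before which z' stays within distance 1 of z. -/
theorem exists_modulus_of_oneSided [ProperSpace Y]
    (hF : ∀ Ω : Set (Hist r Z × Y × V), Bornology.IsBounded Ω → ∃ L, 0 ≤ L ∧ OneSidedOn F Ω L)
    (hr : 0 ≤ r) (hu : ContinuousOn u (Ici 0))
    (hFc : Continuous fun p : Hist r Z × Y × V => F p.1 p.2.1 p.2.2)
    (hz : IsDelaySolution r T z₀ z fun t => F (hist r z t) (w t) (u t)) (hT : T₁ < T) {B : ℝ}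
    (hw : ∀ t ∈ Icc 0 T₁, ‖w t‖ ≤ B) {ε : ℝ} (hε : 0 < ε) :
    ∃ d > 0, ∀ (w' : ℝ → Y) (z' : ℝ → Z) (T' : ℝ), T₁ < T' →
      IsDelaySolution r T' z₀ z' (fun t => F (hist r z' t) (w' t) (u t)) →
      (∀ t ∈ Icc 0 T₁, ‖w' t‖ ≤ B) → (∀ t ∈ Icc 0 T₁, ‖w t - w' t‖ < d) →
      ∀ t ∈ Icc 0 T₁, ‖z t - z' t‖ < ε := by
  obtain ⟨A, hA0, hA⟩ := exists_bound_solution hz hT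
  obtain ⟨U, hU0, hU⟩ := exists_bound_input hu T₁
  obtain ⟨L, hL, hone⟩ := hF (Metric.closedBall 0 (A + 1 + U + |B|)) Metric.isBounded_closedBall
  have hzc : ContinuousOn z (Icc (-r) T₁) := hz.cont.mono fun s hs => ⟨hs.1, hs.2.trans_lt hT⟩
  set κ : ℝ := 2 * (1 + 2 * L) with hκ
  set η : ℝ := min ε 1 / 2 with hη
  have hη0 : 0 < η := by positivity
  have hηε : 2 * η ≤ ε := by linarith [min_le_left ε 1]
  have hη1 : 2 * η ≤ 1 := by linarith [min_le_right ε 1]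
  -- Chosen so that 2ε₁² exp(κT₁) ≤ η²: the energy estimate then gives distance at most η at a time
  -- where the distance should be at least 2η.
  set ε₁ : ℝ := η * Real.exp (-(κ * T₁)) / 2 with hε₁
  have hε₁0 : 0 < ε₁ := by positivity
  have hK : IsCompact ((hist r z '' Icc 0 T₁) ×ˢ (Metric.closedBall (0 : Y) B) ×ˢ
      (u '' Icc 0 T₁)) := by
    refine (isCompact_Icc.image_of_continuousOn ?_).prod ((isCompact_closedBall _ _).prod
      (isCompact_Icc.image_of_continuousOn (hu.mono fun s hs => hs.1)))
    exact (continuousOn_hist hr hz.cont).mono fun s hs => ⟨hs.1, hs.2.trans_lt hT⟩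
  have huc := hK.uniformContinuousOn_of_continuous hFc.continuousOn
  rw [Metric.uniformContinuousOn_iff] at huc
  obtain ⟨d, hd, hmod⟩ := huc ε₁ hε₁0
  refine ⟨d, hd, fun w' z' T' hT' hz' hw' hww' => ?_⟩
  have hzc' : ContinuousOn z' (Icc (-r) T₁) := hz'.cont.mono fun s hs => ⟨hs.1, hs.2.trans_lt hT'⟩
  have hclose : ∀ t ∈ Icc 0 T₁,
      ‖F (hist r z t) (w t) (u t) - F (hist r z t) (w' t) (u t)‖ ≤ ε₁ := by
    intro t ht
    have h1 := hmod (hist r z t, w t, u t)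
      ⟨mem_image_of_mem _ ht, mem_closedBall_zero_iff.2 (hw t ht), mem_image_of_mem _ ht⟩
      (hist r z t, w' t, u t)
      ⟨mem_image_of_mem _ ht, mem_closedBall_zero_iff.2 (hw' t ht), mem_image_of_mem _ ht⟩
      (by
        rw [Prod.dist_eq, Prod.dist_eq]
        simp only [dist_self, dist_eq_norm (w t)]
        exact max_lt hd (max_lt (hww' t ht) hd))
    rw [dist_eq_norm] at h1
    exact h1.le
  have hneg : ∀ p ∈ Icc (-r) 0, z p = z' p := fun p hp =>
    (hz.init ⟨p, hp⟩).trans (hz'.init ⟨p, hp⟩).symm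
  have hsub : Icc 0 T₁ ⊆ Icc (-r) T₁ := Icc_subset_Icc_left (by linarith)
  by_contra! hcon
  obtain ⟨t₂, ht₂, hbig⟩ := hcon
  have hdc : ContinuousOn (fun t => ‖z t - z' t‖) (Icc 0 T₁) :=
    ((hzc.mono hsub).sub (hzc'.mono hsub)).norm
  have hcl : IsCompact (Icc 0 T₁ ∩ (fun t => ‖z t - z' t‖) ⁻¹' Ici (2 * η)) :=
    isCompact_Icc.of_isClosed_subset (hdc.preimage_isClosed_of_isClosed isClosed_Icc isClosed_Ici)
      inter_subset_left
  -- s is the first time at which the distance is at least 2η; it exists because the set of such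
  -- times is compact.
  obtain ⟨s, ⟨hs, hsη⟩, hmin⟩ := hcl.exists_isLeast ⟨t₂, ht₂, mem_preimage.2 (hηε.trans hbig)⟩
  have hle : ∀ p ∈ Icc (-r) s, ‖z p - z' p‖ ≤ 1 := by
    intro p hp
    rcases le_or_gt p 0 with h0 | h0
    · rw [hneg p ⟨hp.1, h0⟩, sub_self, norm_zero]
      exact zero_le_one
    · by_contra! hgt
      have hmem : p ∈ Icc 0 T₁ := ⟨h0.le, hp.2.trans hs.2⟩
      have h1 : s ≤ p := hmin ⟨hmem, hη1.trans hgt.le⟩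
      have h2 : p = s := le_antisymm hp.2 h1
      have hcont : ContinuousOn (fun t => ‖z t - z' t‖) (Icc 0 p) :=
        hdc.mono (Icc_subset_Icc_right hmem.2)
      -- A distance above 1 at s itself would force the value 2η ≤ 1 at an earlier time, against
      -- minimality.
      obtain ⟨q, hq, hqe⟩ := intermediate_value_Icc h0.le hcont (show 2 * η ∈ Icc _ _ from
        ⟨by
          rw [hneg 0 ⟨by linarith, le_rfl⟩, sub_self, norm_zero]
          positivity, hη1.trans hgt.le⟩)
      have h3 : s ≤ q := hmin ⟨⟨hq.1, hq.2.trans hmem.2⟩, hqe.ge⟩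
      have h4 : q = p := le_antisymm hq.2 (h2 ▸ h3)
      rw [h4] at hqe
      linarith
  have hbd : ∀ p ∈ Icc (-r) s, ‖z' p‖ ≤ A + 1 := fun p hp => by
    have h1 := hA p ⟨hp.1, hp.2.trans hs.2⟩
    have h2 := hle p hp
    calc ‖z' p‖ = ‖z p - (z p - z' p)‖ := by congr 1; abel
      _ ≤ _ := (norm_sub_le _ _).trans (add_le_add h1 h2)
  have key := normSq_sub_le_of_oneSided (T₁ := s) (ε := ε₁) hr hL hone hz hz' (hs.2.trans_lt hT)
    (hs.2.trans_lt hT') (fun t ht => ?_) (fun t ht => hclose t ⟨ht.1, ht.2.le.trans hs.2⟩) s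
    ⟨hs.1, le_rfl⟩
  · have e1 : Real.exp (κ * s) ≤ Real.exp (κ * T₁) := by
      have := hs.2
      gcongr
    have e2 : Real.exp (-(κ * T₁)) * Real.exp (κ * T₁) = 1 := by
      rw [← Real.exp_add]
      simp
    have e3 : Real.exp (-(κ * T₁)) ≤ 1 := by
      rw [Real.exp_le_one_iff]
      have := hs.1.trans hs.2
      have : 0 ≤ κ * T₁ := by positivity
      linarith
    have e4 : ‖z s - z' s‖ ^ 2 ≤ η ^ 2 := by
      calc _ ≤ 2 * ε₁ ^ 2 * Real.exp (κ * s) := key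
        _ ≤ 2 * ε₁ ^ 2 * Real.exp (κ * T₁) := by gcongr
        _ = η ^ 2 / 2 * Real.exp (-(κ * T₁)) * (Real.exp (-(κ * T₁)) * Real.exp (κ * T₁)) := by
          rw [hε₁]; ring
        _ ≤ η ^ 2 / 2 * 1 * 1 := by rw [e2]; gcongr
        _ ≤ η ^ 2 := by linarith [sq_nonneg η]
    have e5 := abs_le_of_sq_le_sq e4 hη0.le
    have e6 : 2 * η ≤ ‖z s - z' s‖ := hsη
    linarith [le_abs_self ‖z s - z' s‖]
  · have ht' : t ∈ Icc 0 T₁ := ⟨ht.1, ht.2.le.trans hs.2⟩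
    have h1 := norm_hist_le_of_bound hA0 hzc hA ht'
    have h2 := norm_hist_le_of_bound (T₁ := s) (by linarith)
      (hzc'.mono (Icc_subset_Icc_right hs.2)) hbd ⟨ht.1, ht.2.le⟩
    have h3 : ‖w' t‖ ≤ |B| := (hw' t ht').trans (le_abs_self B)
    have h4 := hU t ht'
    have h5 := abs_nonneg B
    rw [mem_closedBall_triple, mem_closedBall_triple]
    exact ⟨⟨by simp only; linarith, by simp only; linarith, by simp only; linarith⟩,
      ⟨by simp only; linarith, by simp only; linarith, by simp only; linarith⟩⟩

end OneSided

/-! ### Admissible signals -/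

theorem locBddInput_of_continuousOn {E : Type*} [NormedAddCommGroup E] [SecondCountableTopology E]
    {u : ℝ → E} (h : ContinuousOn u (Ici 0)) : LocBddInput univ u :=
  ⟨fun _ _ => mem_univ _, h.aestronglyMeasurable measurableSet_Ici, fun _ =>
    isCompact_Icc.exists_bound_of_continuousOn (h.mono fun _ hs => hs.1)⟩

theorem LocBddInput.sub {E : Type*} [NormedAddCommGroup E] {u u' : ℝ → E}
    (h : LocBddInput univ u) (h' : LocBddInput univ u') :
    LocBddInput univ fun t => u t - u' t := by
  refine ⟨fun _ _ => mem_univ _, h.meas.sub h'.meas, fun T => ?_⟩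
  obtain ⟨M, hM⟩ := h.bdd T
  obtain ⟨M', hM'⟩ := h'.bdd T
  exact ⟨M + M', fun t ht => (norm_sub_le _ _).trans (add_le_add (hM t ht) (hM' t ht))⟩

theorem fadingSup_congr {E : Type*} [NormedAddCommGroup E] {ω t : ℝ} {ξ ξ' : ℝ → E}
    (h : EqOn ξ ξ' (Icc 0 t)) : fadingSup ω ξ t = fadingSup ω ξ' t := by
  unfold fadingSup
  congr 1
  exact image_congr fun s hs => by rw [h hs]

/-! ### The trajectory of the delay system and the observer states -/

namespace Loop

variable {nb N₁ N₂ m k l : ℕ} {P : Loop nb N₁ N₂ m k}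

/-- `x` is the unique global solution of the delay system with initial history `φ`. -/
structure IsTraj (P : Loop nb N₁ N₂ m k) (φ : Hist P.r (St nb N₁ N₂)) (u : ℝ → Eu m)
    (x : ℝ → St nb N₁ N₂) : Prop where
  u_cont : ContinuousOn u (Ici 0)
  sol : ∀ T > 0, IsDelaySolution P.r T φ x fun t => P.f (hist P.r x t) (u t) 0
  unique : ∀ x', (∀ T > 0, IsDelaySolution P.r T φ x' fun t => P.f (hist P.r x' t) (u t) 0) →
    EqOn x' x (Ici (-P.r))

variable {φ : Hist P.r (St nb N₁ N₂)} {u : ℝ → Eu m} {x : ℝ → St nb N₁ N₂}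

theorem IsTraj.cont (hx : P.IsTraj φ u x) : ContinuousOn x (Ici (-P.r)) :=
  continuousOn_Ici_of_delaySolution hx.sol

theorem IsTraj.h_hist (hx : P.IsTraj φ u x) {t : ℝ} (ht : 0 ≤ t) :
    P.h (hist P.r x t) = P.outMap (x t) := by
  rw [h_eq, P.ev_hist (hx.cont.mono fun p hp => mem_Ici.2 (by linarith [hp.1]))
    ⟨by linarith [P.r_pos], le_rfl⟩, add_zero]

theorem IsTraj.continuousOn_out (hx : P.IsTraj φ u x) :
    ContinuousOn (fun t => P.outMap (x t)) (Ici 0) :=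
  P.outMap.continuous.comp_continuousOn (hx.cont.mono (Ici_subset_Ici.2 (by linarith [P.r_pos])))

theorem continuousOn_hist_Ici {E : Type*} [NormedAddCommGroup E] {r : ℝ} (hr : 0 ≤ r) {x : ℝ → E}
    (hx : ContinuousOn x (Ici (-r))) : ContinuousOn (hist r x) (Ici 0) := by
  intro t ht
  have h1 := continuousOn_hist (T := t + 1) hr (hx.mono fun s hs => hs.1) t ⟨ht, by linarith⟩
  refine h1.mono_of_mem_nhdsWithin ?_
  filter_upwards [self_mem_nhdsWithin, mem_nhdsWithin_of_mem_nhds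
    (Iio_mem_nhds (show t < t + 1 by linarith))] with s hs hs'
  exact ⟨hs, hs'⟩

/-- The rate of the predicted output along the observer state `z`. -/
def predRate (P : Loop nb N₁ N₂ m k) (Ψ : Hist P.r (Eu l) → Hist P.r (St nb N₁ N₂))
    (u : ℝ → Eu m) (z : ℝ → Eu l) (t : ℝ) : Eu k := P.R (Ψ (hist P.r z t)) (u t) 0

theorem IsTraj.continuousOn_R (hA1 : P.A1) (hA3 : P.A3) (hx : P.IsTraj φ u x) :
    ContinuousOn (fun t => P.R (hist P.r x t) (u t) 0) (Ici 0) :=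
  (continuous_R hA1 hA3).comp_continuousOn (f := fun t => (hist P.r x t, u t))
    ((continuousOn_hist_Ici P.r_pos.le hx.cont).prodMk hx.u_cont)

theorem IsTraj.out_sub (hA1 : P.A1) (hA3 : P.A3) (hx : P.IsTraj φ u x) {s t : ℝ} (hs : 0 ≤ s)
    (hst : s ≤ t) : P.outMap (x t) - P.outMap (x s) = ∫ p in s..t, P.R (hist P.r x p) (u p) 0 := by
  have hi : IntervalIntegrable (fun t => P.f (hist P.r x t) (u t) 0) volume s t := by
    refine ((continuousOn_f_hist hA1 hA3 hx.u_cont hx.cont).mono ?_).intervalIntegrable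
    rw [uIcc_of_le hst]
    exact fun p hp => hs.trans hp.1
  rw [← map_sub, delaySolution_sub_eq hA1 hA3 hx.u_cont hx.sol hs hst,
    ← P.outMap.intervalIntegral_comp_comm hi]
  rfl

section REO

variable {F : Hist P.r (Eu l) → Eu k → Eu m → Eu l}
  {Ψ : Hist P.r (Eu l) → Hist P.r (St nb N₁ N₂)} {γ σ : ℝ} {g a : ℝ → ℝ} {z₀ : Hist P.r (Eu l)}
  {w w' : ℝ → Eu k} {z z' : ℝ → Eu l}

/-- Existence is part of the observer hypothesis, with any observer state alongside. Uniqueness is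
that of the integral form, which every delay solution with a generating history satisfies. -/
theorem exists_isTraj (hA1 : P.A1) (hA3 : P.A3)
    (hREO : IsREOWith P.r univ {(0 : Eu nb)} P.f P.h F Ψ γ σ g a) {xb₀ : Eu nb} {v₀ : ℝ → ℝ}
    (hφ : P.Generates φ xb₀ v₀) (hu : ContinuousOn u (Ici 0)) : ∃ x, P.IsTraj φ u x := by
  obtain ⟨x, z, h⟩ := hREO.exists_solution φ 0 u (fun _ => 0) (fun _ => 0)
    (locBddInput_of_continuousOn hu)
    ⟨fun _ _ => rfl, aestronglyMeasurable_const, fun _ => ⟨0, fun _ _ => by simp⟩⟩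
    (locBddInput_of_continuousOn continuousOn_const)
  have hx : ∀ T > 0, IsDelaySolution P.r T φ x fun t => P.f (hist P.r x t) (u t) 0 :=
    fun T hT => (h T hT).1
  refine ⟨x, hu, hx, fun x' hx' => ?_⟩
  obtain ⟨-, -, -, h1⟩ := exists_solution_of_delay hA1 hA3 hu hφ hx
  obtain ⟨-, -, -, h2⟩ := exists_solution_of_delay hA1 hA3 hu hφ hx'
  intro t ht
  have hT : 0 < max t 0 + 1 := by positivity
  refine (h2 _ hT).eqOn hA1 hu (h1 _ hT) (fun θ hθ => ?_) ⟨ht, by linarith [le_max_left t 0]⟩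
  exact ((hx' 1 one_pos).init ⟨θ, hθ⟩).trans ((hx 1 one_pos).init ⟨θ, hθ⟩).symm

theorem oneSided_of_REO (hREO : IsREOWith P.r univ {(0 : Eu nb)} P.f P.h F Ψ γ σ g a)
    (Ω : Set (Hist P.r (Eu l) × Eu k × Eu m)) (hΩ : Bornology.IsBounded Ω) :
    ∃ L, 0 ≤ L ∧ OneSidedOn F Ω L :=
  hREO.F_oneSided Ω (fun _ _ => mem_univ _) hΩ

theorem continuous_F_of_REO (hREO : IsREOWith P.r univ {(0 : Eu nb)} P.f P.h F Ψ γ σ g a) :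
    Continuous fun p : Hist P.r (Eu l) × Eu k × Eu m => F p.1 p.2.1 p.2.2 := by
  have h := hREO.F_cont
  rwa [show {p : Hist P.r (Eu l) × Eu k × Eu m | p.2.2 ∈ (univ : Set (Eu m))} = univ from
    eq_univ_of_forall fun _ => mem_univ _, continuousOn_univ] at h

/-- `z` is a global solution of `ż = F(z_t, w, u)` with initial history `z₀`. -/
def IsObsState (F : Hist P.r (Eu l) → Eu k → Eu m → Eu l) (u : ℝ → Eu m) (z₀ : Hist P.r (Eu l))
    (w : ℝ → Eu k) (z : ℝ → Eu l) : Prop :=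
  ∀ T > 0, IsDelaySolution P.r T z₀ z fun t => F (hist P.r z t) (w t) (u t)

/-- An arbitrary input w is the true output h(x_t) corrupted by the noise w - h(x_t), so the
observer hypothesis covers ż = F(z_t, w, u). -/
theorem isREOSolution_of_isObsState (hx : P.IsTraj φ u x) (hz : IsObsState F u z₀ w z) :
    IsREOSolution P.r P.f P.h F φ z₀ u (fun _ => 0) (fun t => w t - P.outMap (x t)) x z := by
  refine fun T hT => ⟨hx.sol T hT, (hz T hT).congr_rhs fun t ht => ?_⟩
  simp only [hx.h_hist ht.1.le, add_sub_cancel]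

/-- The observer hypothesis returns its own plant trajectory; by uniqueness it is x, so the
subtracted output cancels and z is driven by w exactly. -/
theorem exists_isObsState (hREO : IsREOWith P.r univ {(0 : Eu nb)} P.f P.h F Ψ γ σ g a)
    (hx : P.IsTraj φ u x) (z₀ : Hist P.r (Eu l)) (hw : LocBddInput univ w) :
    ∃ z, IsObsState F u z₀ w z := by
  obtain ⟨x', z, h⟩ := hREO.exists_solution φ z₀ u (fun _ => 0) (fun t => w t - P.outMap (x t))
    (locBddInput_of_continuousOn hx.u_cont)
    ⟨fun _ _ => rfl, aestronglyMeasurable_const, fun _ => ⟨0, fun _ _ => by simp⟩⟩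
    (hw.sub (locBddInput_of_continuousOn hx.continuousOn_out))
  have hxx := hx.unique x' fun T hT => (h T hT).1
  refine ⟨z, fun T hT => (h T hT).2.congr_rhs fun t ht => ?_⟩
  have e : hist P.r x' t = hist P.r x t := hist_congr fun p hp => hxx
    (mem_Ici.2 (by linarith [hp.1, ht.1]))
  simp only [e, hx.h_hist ht.1.le, add_sub_cancel]

theorem IsObsState.norm_sub_le (hREO : IsREOWith P.r univ {(0 : Eu nb)} P.f P.h F Ψ γ σ g a)
    (hx : P.IsTraj φ u x) (hw : LocBddInput univ w) (hz : IsObsState F u z₀ w z) {t : ℝ}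
    (ht : 0 ≤ t) : ‖Ψ (hist P.r z t) - hist P.r x t‖ ≤ Real.exp (-σ * t) * a (‖φ‖ + ‖z₀‖) +
      γ * fadingSup σ (fun s => w s - P.outMap (x s)) t := by
  have h := hREO.estimate φ z₀ u (fun _ => 0) (fun t => w t - P.outMap (x t))
    (locBddInput_of_continuousOn hx.u_cont)
    ⟨fun _ _ => rfl, aestronglyMeasurable_const, fun _ => ⟨0, fun _ _ => by simp⟩⟩
    (hw.sub (locBddInput_of_continuousOn hx.continuousOn_out)) x z
    (isREOSolution_of_isObsState hx hz) t ht
  -- The plant disturbance is identically 0 and g(0) = 0, so the disturbance term vanishes.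
  have e : sSup ((fun _ : ℝ => g ‖(0 : Eu nb)‖) '' Icc 0 t) = 0 := by
    rw [(nonempty_Icc.2 ht).image_const, norm_zero, hREO.g_classK.zero, csSup_singleton]
  simpa only [e, add_zero] using h

theorem continuousOn_Ici_of_isObsState (hz : IsObsState F u z₀ w z) :
    ContinuousOn z (Ici (-P.r)) := continuousOn_Ici_of_delaySolution hz

theorem IsObsState.eqOn (hREO : IsREOWith P.r univ {(0 : Eu nb)} P.f P.h F Ψ γ σ g a)
    (hu : ContinuousOn u (Ici 0)) (hz : IsObsState F u z₀ w z) (hz' : IsObsState F u z₀ w' z')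
    {T : ℝ} (hw : EqOn w w' (Ico 0 T)) (hb : LocBddInput univ w) :
    EqOn z z' (Icc (-P.r) T) := by
  obtain ⟨B, hB⟩ := hb.bdd T
  have hT : 0 < |T| + 1 := by positivity
  have hT' : T < |T| + 1 := by linarith [le_abs_self T]
  exact eqOn_of_oneSided (oneSided_of_REO hREO) P.r_pos.le hu (hz _ hT) (hz' _ hT) hT' hT' hw
    ⟨B, fun t ht => hB t ⟨ht.1, ht.2.le⟩⟩

theorem locBddInput_indicator {E : Type*} [NormedAddCommGroup E] {w : ℝ → E} {S : Set ℝ}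
    (hS : MeasurableSet S) (hm : AEStronglyMeasurable w (volume.restrict (Ici 0 ∩ S)))
    (hb : ∀ T, ∃ M, ∀ t ∈ Icc 0 T ∩ S, ‖w t‖ ≤ M) : LocBddInput univ (S.indicator w) := by
  refine ⟨fun _ _ => mem_univ _, ?_, fun T => ?_⟩
  · rw [aestronglyMeasurable_indicator_iff hS, Measure.restrict_restrict hS, inter_comm]
    exact hm
  · obtain ⟨M, hM⟩ := hb T
    refine ⟨max M 0, fun t ht => ?_⟩
    by_cases h : t ∈ S
    · rw [indicator_of_mem h]
      exact (hM t ⟨ht, h⟩).trans (le_max_left _ _)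
    · rw [indicator_of_notMem h, norm_zero]
      exact le_max_right _ _

/-- The observer estimate for solutions on bounded time intervals. -/
theorem norm_sub_le_of_local (hREO : IsREOWith P.r univ {(0 : Eu nb)} P.f P.h F Ψ γ σ g a)
    (hx : P.IsTraj φ u x) {T t : ℝ} (ht : t ∈ Ico 0 T)
    (hm : AEStronglyMeasurable w (volume.restrict (Icc 0 t)))
    (hb : ∃ M, ∀ s ∈ Icc 0 t, ‖w s‖ ≤ M)
    (hz : IsDelaySolution P.r T z₀ z fun t => F (hist P.r z t) (w t) (u t)) :
    ‖Ψ (hist P.r z t) - hist P.r x t‖ ≤ Real.exp (-σ * t) * a (‖φ‖ + ‖z₀‖) +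
      γ * fadingSup σ (fun s => w s - P.outMap (x s)) t := by
  obtain ⟨M, hM⟩ := hb
  -- Cutting w off after t makes it admissible for all times; by uniqueness the observer state up to
  -- t is unchanged.
  have hw : LocBddInput univ ((Iic t).indicator w) :=
    locBddInput_indicator measurableSet_Iic (by rwa [Ici_inter_Iic]) fun T =>
      ⟨M, fun s hs => hM s ⟨hs.1.1, hs.2⟩⟩
  obtain ⟨z', hz'⟩ := exists_isObsState hREO hx z₀ hw
  have heq : EqOn z z' (Icc (-P.r) t) :=
    eqOn_of_oneSided (oneSided_of_REO hREO) P.r_pos.le hx.u_cont hz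
      (hz' (t + 1) (by linarith [ht.1])) ht.2 (by linarith)
      (fun s hs => (indicator_of_mem (mem_Iic.2 hs.2.le) w).symm)
      ⟨M, fun s hs => hM s ⟨hs.1, hs.2.le⟩⟩
  have h := hz'.norm_sub_le hREO hx hw ht.1
  rw [hist_congr (heq.mono (Icc_subset_Icc_left (by linarith [ht.1])))]
  refine h.trans_eq ?_
  congr 2
  exact fadingSup_congr fun s hs => by simp only [indicator_of_mem (mem_Iic.2 hs.2) w]

end REO

end Loop

/-! ### Sampling sequences, the output predictor and the small-gain estimate -/

theorem IsSampling.monotone {δ : ℝ} {τ : ℕ → ℝ} (h : IsSampling δ τ) : Monotone τ :=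
  monotone_nat_of_le_succ fun i => by linarith [h.step_pos i]

theorem IsSampling.nonneg {δ : ℝ} {τ : ℕ → ℝ} (h : IsSampling δ τ) (i : ℕ) : 0 ≤ τ i :=
  h.zero ▸ h.monotone (Nat.zero_le i)

theorem IsSampling.exists_mem {δ : ℝ} {τ : ℕ → ℝ} (h : IsSampling δ τ) {t : ℝ} (ht : 0 ≤ t) :
    ∃ i, t ∈ Ico (τ i) (τ (i + 1)) := by
  classical
  have hex : ∃ i, t < τ i := (h.tendsto.eventually_gt_atTop t).exists
  obtain ⟨j, hj⟩ : ∃ j, Nat.find hex = j + 1 := Nat.exists_eq_succ_of_ne_zero fun h0 => by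
    have := Nat.find_spec hex
    rw [h0, h.zero] at this
    linarith
  refine ⟨j, not_lt.1 (Nat.find_min hex (by omega)), ?_⟩
  rw [← hj]
  exact Nat.find_spec hex

theorem continuousOn_primitive_Ico {E : Type*} [NormedAddCommGroup E] [NormedSpace ℝ E]
    [CompleteSpace E] {f : ℝ → E} {T s : ℝ} (hf : ContinuousOn f (Ico 0 T)) (hs : s ∈ Ico 0 T) :
    ContinuousOn (fun t => ∫ p in s..t, f p) (Ico 0 T) := by
  intro t ht
  obtain ⟨T', h1, h2⟩ := exists_between (max_lt hs.2 ht.2)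
  obtain ⟨y, hy, hxy⟩ := exists_continuous_eqOn_Icc (a := 0) (b := T')
    (by linarith [ht.1, le_max_right s t]) (hf.mono fun p hp => ⟨hp.1, hp.2.trans_lt h2⟩)
  have hst : s ≤ T' ∧ t < T' := ⟨(le_max_left s t).trans h1.le, (le_max_right s t).trans_lt h1⟩
  have key : ∀ t' ∈ Icc 0 T', ∫ p in s..t', f p = ∫ p in s..t', y p := fun t' ht' =>
    intervalIntegral.integral_congr fun p hp =>
      (hxy (uIcc_subset_Icc ⟨hs.1, hst.1⟩ ht' hp)).symm
  refine ((intervalIntegral.continuous_primitive (μ := volume)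
    (fun _ _ => hy.intervalIntegrable _ _) s).continuousWithinAt (s := Ico 0 T) (x := t)).congr_of_eventuallyEq ?_ ?_
  · have : Iio T' ∈ 𝓝[Ico 0 T] t := mem_nhdsWithin_of_mem_nhds (Iio_mem_nhds hst.2)
    filter_upwards [this, self_mem_nhdsWithin] with t' h h'
    exact key t' ⟨h'.1, le_of_lt h⟩
  · exact key t ⟨ht.1, hst.2.le⟩

namespace Loop

variable {nb N₁ N₂ m k l : ℕ} {P : Loop nb N₁ N₂ m k}
  {φ : Hist P.r (St nb N₁ N₂)} {u : ℝ → Eu m} {x : ℝ → St nb N₁ N₂}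
  {F : Hist P.r (Eu l) → Eu k → Eu m → Eu l}
  {Ψ : Hist P.r (Eu l) → Hist P.r (St nb N₁ N₂)} {γ σ : ℝ} {g a : ℝ → ℝ} {z₀ : Hist P.r (Eu l)}
  {w w' : ℝ → Eu k} {z z' : ℝ → Eu l} {τ : ℕ → ℝ} {ξ : ℝ → Eu k} {δ T : ℝ}

theorem continuousOn_predRate (hA1 : P.A1) (hA3 : P.A3) (hΨ : Continuous Ψ)
    (hu : ContinuousOn u (Ici 0)) (hz : ContinuousOn z (Ico (-P.r) T)) :
    ContinuousOn (P.predRate Ψ u z) (Ico 0 T) :=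
  (continuous_R hA1 hA3).comp_continuousOn (f := fun t => (Ψ (hist P.r z t), u t))
    ((hΨ.comp_continuousOn (continuousOn_hist P.r_pos.le hz)).prodMk
      (hu.mono fun _ hp => hp.1))

theorem predRate_congr {t : ℝ} (h : EqOn z z' (Icc (t - P.r) t)) :
    P.predRate Ψ u z t = P.predRate Ψ u z' t := by
  rw [predRate, predRate, hist_congr h]

/-- The output predictor: `w` is reset at the sampling times and driven by `predRate` in between. -/
def IsPredictor (P : Loop nb N₁ N₂ m k) (Ψ : Hist P.r (Eu l) → Hist P.r (St nb N₁ N₂))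
    (u : ℝ → Eu m) (y : ℝ → Eu k) (τ : ℕ → ℝ) (T : ℝ) (z : ℝ → Eu l) (w : ℝ → Eu k) : Prop :=
  ∀ i, ∀ t ∈ Ico (τ i) (τ (i + 1)), t < T → w t = y (τ i) + ∫ s in τ i..t, P.predRate Ψ u z s

/-- w is continuous on each sampling interval below T, and countably many of them cover [0, T). -/
theorem IsPredictor.aestronglyMeasurable {y : ℝ → Eu k} (h : IsPredictor P Ψ u y τ T z w)
    (hτ : IsSampling δ τ) (hp : ContinuousOn (P.predRate Ψ u z) (Ico 0 T)) :
    AEStronglyMeasurable w (volume.restrict (Ico 0 T)) := by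
  have hsub : Ico 0 T ⊆ ⋃ i, Ico (τ i) (τ (i + 1)) ∩ Iio T := fun t ht => by
    obtain ⟨i, hi⟩ := hτ.exists_mem ht.1
    exact mem_iUnion.2 ⟨i, hi, ht.2⟩
  refine AEStronglyMeasurable.mono_measure ?_ (Measure.restrict_mono hsub le_rfl)
  rw [aestronglyMeasurable_iUnion_iff]
  intro i
  have hm : MeasurableSet (Ico (τ i) (τ (i + 1)) ∩ Iio T) := measurableSet_Ico.inter measurableSet_Iio
  by_cases hi : τ i < T
  · refine ContinuousOn.aestronglyMeasurable ?_ hm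
    refine ContinuousOn.congr (f := fun t => y (τ i) + ∫ s in τ i..t, P.predRate Ψ u z s) ?_
      fun t ht => h i t ht.1 ht.2
    exact continuousOn_const.add ((continuousOn_primitive_Ico hp ⟨hτ.nonneg i, hi⟩).mono
      fun t ht => ⟨(hτ.nonneg i).trans ht.1.1, ht.2⟩)
  · rw [show Ico (τ i) (τ (i + 1)) ∩ Iio T = ∅ from
      eq_empty_of_forall_notMem fun t ht => hi (ht.1.1.trans_lt ht.2), Measure.restrict_empty]
    exact aestronglyMeasurable_zero_measure w

theorem IsPredictor.norm_le {y : ℝ → Eu k} (h : IsPredictor P Ψ u y τ T z w)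
    (hτ : IsSampling δ τ) {t A K : ℝ} (ht : t ∈ Ico 0 T) (hA : ∀ s ∈ Icc 0 t, ‖y s‖ ≤ A)
    (hK : ∀ s ∈ Icc 0 t, ‖P.predRate Ψ u z s‖ ≤ K) : ‖w t‖ ≤ A + K * δ := by
  obtain ⟨i, hi⟩ := hτ.exists_mem ht.1
  have hK0 : 0 ≤ K := (norm_nonneg _).trans (hK t ⟨ht.1, le_rfl⟩)
  rw [h i t hi ht.2]
  refine (norm_add_le _ _).trans (add_le_add (hA _ ⟨hτ.nonneg i, hi.1⟩) ?_)
  refine (intervalIntegral.norm_integral_le_of_norm_le_const (C := K) fun s hs => ?_).trans ?_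
  · rw [uIoc_of_le hi.1] at hs
    exact hK s ⟨(hτ.nonneg i).trans hs.1.le, hs.2⟩
  · rw [abs_of_nonneg (by linarith [hi.1])]
    have := hτ.step_le i
    have := hi.2
    gcongr
    linarith

theorem norm_exp_shift_le {σ δ p q : ℝ} (hσ : 0 ≤ σ) (h : q - p ≤ δ) :
    Real.exp (-σ * p) ≤ Real.exp (σ * δ) * Real.exp (-σ * q) := by
  rw [← Real.exp_add]
  exact Real.exp_le_exp.2 (by nlinarith)

/-- The predictor and the true output obey the same law between samples, with R evaluated at Ψ(z_s)
and at x_s; their gap is the sampling noise plus an integral over a time of at most δ. Moving the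
weight from τ_i to t costs exp(σδ). -/
theorem IsPredictor.norm_sub_out_le (hA1 : P.A1) (hA3 : P.A3) (hx : P.IsTraj φ u x)
    (h : IsPredictor P Ψ u (fun s => P.outMap (x s) + ξ s) τ T z w)
    (hτ : IsSampling δ τ) (hp : ContinuousOn (P.predRate Ψ u z) (Ico 0 T)) (hσ : 0 ≤ σ)
    {L S X t : ℝ} (hL : 0 ≤ L) (hS : 0 ≤ S)
    (hR : ∀ φ φ' u, ‖P.R φ u 0 - P.R φ' u 0‖ ≤ L * ‖φ - φ'‖) (ht : t ∈ Ico 0 T)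
    (hE : ∀ s ∈ Icc 0 t, ‖Ψ (hist P.r z s) - hist P.r x s‖ ≤ S * Real.exp (-σ * s))
    (hX : ∀ s ∈ Icc 0 t, ‖ξ s‖ ≤ X * Real.exp (-σ * s)) :
    ‖w t - P.outMap (x t)‖ ≤ Real.exp (σ * δ) * (X + L * S * δ) * Real.exp (-σ * t) := by
  obtain ⟨i, hi⟩ := hτ.exists_mem ht.1
  have h0 := hτ.nonneg i
  have hstep : t - τ i ≤ δ := by linarith [hτ.step_le i, hi.2]
  have hsub : Icc (τ i) t ⊆ Ico 0 T := fun p hp => ⟨h0.trans hp.1, hp.2.trans_lt ht.2⟩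
  have hi1 : IntervalIntegrable (P.predRate Ψ u z) volume (τ i) t :=
    (hp.mono (by rwa [uIcc_of_le hi.1])).intervalIntegrable
  have hi2 : IntervalIntegrable (fun t => P.R (hist P.r x t) (u t) 0) volume (τ i) t :=
    ((hx.continuousOn_R hA1 hA3).mono fun p hp => by
      rw [uIcc_of_le hi.1] at hp
      exact (hsub hp).1).intervalIntegrable
  have e : w t - P.outMap (x t) =
      ξ (τ i) + ∫ s in τ i..t, (P.predRate Ψ u z s - P.R (hist P.r x s) (u s) 0) := by
    rw [intervalIntegral.integral_sub hi1 hi2, ← hx.out_sub hA1 hA3 h0 hi.1, h i t hi ht.2]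
    beta_reduce
    module
  have hint : ‖∫ s in τ i..t, (P.predRate Ψ u z s - P.R (hist P.r x s) (u s) 0)‖ ≤
      L * (S * Real.exp (-σ * τ i)) * |t - τ i| := by
    refine intervalIntegral.norm_integral_le_of_norm_le_const fun s hs => ?_
    rw [uIoc_of_le hi.1] at hs
    refine (hR _ _ _).trans ?_
    gcongr
    refine (hE s ⟨h0.trans hs.1.le, hs.2⟩).trans ?_
    gcongr S * Real.exp ?_
    nlinarith [hs.1]
  rw [abs_of_nonneg (by linarith [hi.1])] at hint
  have hX0 : 0 ≤ X := by
    have := (norm_nonneg _).trans (hX (τ i) ⟨h0, hi.1⟩)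
    exact nonneg_of_mul_nonneg_left this (Real.exp_pos _)
  have hδ : 0 ≤ δ := by linarith [hi.1]
  calc ‖w t - P.outMap (x t)‖ ≤ X * Real.exp (-σ * τ i) + L * (S * Real.exp (-σ * τ i)) * (t - τ i) := by
        rw [e]
        exact (norm_add_le _ _).trans (add_le_add (hX _ ⟨h0, hi.1⟩) hint)
    _ ≤ X * Real.exp (-σ * τ i) + L * (S * Real.exp (-σ * τ i)) * δ := by gcongr
    _ = (X + L * S * δ) * Real.exp (-σ * τ i) := by ring
    _ ≤ (X + L * S * δ) * (Real.exp (σ * δ) * Real.exp (-σ * t)) := by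
        gcongr
        exact norm_exp_shift_le hσ hstep
    _ = _ := by ring

/-- The small-gain estimate for the sampled-data observer. -/
theorem IsPredictor.norm_sub_le (hA1 : P.A1) (hA3 : P.A3)
    (hREO : IsREOWith P.r univ {(0 : Eu nb)} P.f P.h F Ψ γ σ g a) (hx : P.IsTraj φ u x)
    (hξ : LocBddInput univ ξ) (hτ : IsSampling δ τ) {L : ℝ} (hL : 0 ≤ L)
    (hR : ∀ φ φ' u, ‖P.R φ u 0 - P.R φ' u 0‖ ≤ L * ‖φ - φ'‖)
    (hδ : γ * L * δ * Real.exp (σ * δ) ≤ 1 / 2)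
    (hz : IsDelaySolution P.r T z₀ z fun t => F (hist P.r z t) (w t) (u t))
    (h : IsPredictor P Ψ u (fun s => P.outMap (x s) + ξ s) τ T z w) {t : ℝ} (ht : t ∈ Ico 0 T) :
    ‖Ψ (hist P.r z t) - hist P.r x t‖ ≤ Real.exp (-σ * t) * (2 * a (‖φ‖ + ‖z₀‖)) +
      2 * γ * Real.exp (σ * δ) * fadingSup σ ξ t := by
  have hp : ContinuousOn (P.predRate Ψ u z) (Ico 0 T) :=
    continuousOn_predRate hA1 hA3 hREO.Ψ_cont hx.u_cont hz.cont
  have hsub : Icc 0 t ⊆ Ico 0 T := fun s hs => ⟨hs.1, hs.2.trans_lt ht.2⟩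
  have hσ := hREO.σ_pos.le
  have hγ := hREO.γ_pos.le
  obtain ⟨A, hA⟩ := hξ.bdd t
  obtain ⟨A', hA'⟩ := isCompact_Icc.exists_bound_of_continuousOn
    (hx.continuousOn_out.mono fun s (hs : s ∈ Icc 0 t) => hs.1)
  obtain ⟨K, hK⟩ := isCompact_Icc.exists_bound_of_continuousOn (hp.mono hsub)
  have hwb : ∀ s ∈ Icc 0 t, ‖w s‖ ≤ A' + A + K * δ := fun s hs =>
    h.norm_le hτ (hsub hs) (fun p hp => (norm_add_le _ _).trans
      (add_le_add (hA' p ⟨hp.1, hp.2.trans hs.2⟩) (hA p ⟨hp.1, hp.2.trans hs.2⟩)))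
      fun p hp => hK p ⟨hp.1, hp.2.trans hs.2⟩
  -- X is the supremum over [0, t] of ‖ξ(s)‖ exp(σs), so that ξ is measured in the same weight as
  -- the observer error.
  set X : ℝ := fadingSup σ ξ t * Real.exp (σ * t) with hX
  have hXb : ∀ s ∈ Icc 0 t, ‖ξ s‖ ≤ X * Real.exp (-σ * s) := fun s hs => by
    have h1 := le_fadingSup hσ hA hs
    calc ‖ξ s‖ = ‖ξ s‖ * Real.exp (-σ * (t - s)) * (Real.exp (σ * t) * Real.exp (-σ * s)) := by
          rw [mul_assoc, ← Real.exp_add, ← Real.exp_add]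
          ring_nf
          simp
      _ ≤ fadingSup σ ξ t * (Real.exp (σ * t) * Real.exp (-σ * s)) := by gcongr
      _ = _ := by ring
  set ε : ℝ := a (‖φ‖ + ‖z₀‖) + γ * Real.exp (σ * δ) * X with hε
  have hc : ContinuousOn (fun s => ‖Ψ (hist P.r z s) - hist P.r x s‖) (Icc 0 t) :=
    (((hREO.Ψ_cont.comp_continuousOn (continuousOn_hist P.r_pos.le hz.cont)).mono hsub).sub
      ((continuousOn_hist_Ici P.r_pos.le hx.cont).mono Icc_subset_Ici_self)).norm
  -- The negative rate κ = -σ is allowed, and the a priori finite weighted supremum comes from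
  -- continuity on the compact interval [0, t].
  have key := le_of_weighted_contraction (κ := -σ) (ε := ε) hc (fun _ _ => norm_nonneg _)
    (fun S hS hE s hs => ?_) t (right_mem_Icc.2 ht.1)
  · refine key.trans_eq ?_
    have e : Real.exp (σ * t) * Real.exp (-σ * t) = 1 := by
      rw [← Real.exp_add]
      ring_nf
      simp
    rw [hε, hX]
    linear_combination (2 * γ * Real.exp (σ * δ) * fadingSup σ ξ t) * e
  · have hsT := hsub hs
    have hm : AEStronglyMeasurable w (volume.restrict (Icc 0 s)) :=
      (h.aestronglyMeasurable hτ hp).mono_measure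
        (Measure.restrict_mono (show Icc 0 s ⊆ Ico 0 T from
          fun p hp => ⟨hp.1, hp.2.trans_lt hsT.2⟩) le_rfl)
    refine (norm_sub_le_of_local hREO hx hsT hm ⟨_, fun p hp => hwb p ⟨hp.1, hp.2.trans hs.2⟩⟩
      hz).trans ?_
    have hf : fadingSup σ (fun s => w s - P.outMap (x s)) s ≤
        Real.exp (σ * δ) * (X + L * S * δ) * Real.exp (-σ * s) := by
      refine fadingSup_le hs.1 fun p hp' => ?_
      have h1 := h.norm_sub_out_le hA1 hA3 hx hτ hp hσ hL hS hR (t := p)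
        ⟨hp'.1, hp'.2.trans_lt hsT.2⟩ (fun q hq => hE q ⟨hq.1, (hq.2.trans hp'.2).trans hs.2⟩)
        fun q hq => hXb q ⟨hq.1, (hq.2.trans hp'.2).trans hs.2⟩
      calc _ ≤ Real.exp (σ * δ) * (X + L * S * δ) * Real.exp (-σ * p) *
            Real.exp (-σ * (s - p)) := by gcongr
        _ = Real.exp (σ * δ) * (X + L * S * δ) * Real.exp (-σ * s) := by
            rw [mul_assoc, ← Real.exp_add]
            ring_nf
    calc _ ≤ Real.exp (-σ * s) * a (‖φ‖ + ‖z₀‖) +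
          γ * (Real.exp (σ * δ) * (X + L * S * δ) * Real.exp (-σ * s)) := by gcongr
      -- The observer error feeds back on itself with gain γLδ exp(σδ) ≤ 1/2.
      _ = (γ * L * δ * Real.exp (σ * δ) * S + ε) * Real.exp (-σ * s) := by rw [hε]; ring
      _ ≤ (1 / 2 * S + ε) * Real.exp (-σ * s) := by gcongr
      _ = _ := by ring

end Loop

/-! ### Compactness, patching and absorption -/

theorem exists_subseq_tendsto_of_lipschitz {E : Type*} [NormedAddCommGroup E] [ProperSpace E]
    {W : ℕ → ℝ → E} {a b B K : ℝ} (hab : a ≤ b) (hB : ∀ n, ∀ t ∈ Icc a b, ‖W n t‖ ≤ B)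
    (hK : ∀ n, ∀ s ∈ Icc a b, ∀ t ∈ Icc a b, ‖W n s - W n t‖ ≤ K * |s - t|) :
    ∃ (V : ℝ → E) (ψ : ℕ → ℕ), StrictMono ψ ∧ Continuous V ∧
      ∀ d > 0, ∀ᶠ n in atTop, ∀ t ∈ Icc a b, ‖V t - W (ψ n) t‖ < d := by
  have hKn : ∀ s t, K * |s - t| ≤ |K| * dist s t := fun s t =>
    mul_le_mul_of_nonneg_right (le_abs_self K) (abs_nonneg _)
  let f : ℕ → BoundedContinuousFunction (Icc a b) E := fun n =>
    BoundedContinuousFunction.mkOfCompact ⟨fun t => W n t,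
      (LipschitzWith.of_dist_le_mul (K := ⟨|K|, abs_nonneg K⟩) fun s t => by
        rw [dist_eq_norm]
        exact (hK n s s.2 t t.2).trans (hKn _ _)).continuous⟩
  have hf : ∀ n (t : Icc a b), f n t = W n t := fun n t => rfl
  have hcomp := BoundedContinuousFunction.arzela_ascoli (Metric.closedBall (0 : E) B)
    (isCompact_closedBall 0 B) (range f)
    (by
      rintro _ t ⟨n, rfl⟩
      rw [mem_closedBall_zero_iff, hf]
      exact hB n t t.2)
    (by
      refine Metric.equicontinuous_of_continuity_modulus (fun d => |K| * d) ?_ _ ?_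
      · have : Continuous fun d : ℝ => |K| * d := by fun_prop
        simpa using this.tendsto 0
      · rintro s t ⟨_, n, rfl⟩
        change dist (W n s) (W n t) ≤ _
        rw [dist_eq_norm]
        exact (hK n s s.2 t t.2).trans (hKn _ _))
  obtain ⟨V, -, ψ, hψ, hV⟩ := hcomp.tendsto_subseq (x := f) fun n => subset_closure (mem_range_self n)
  refine ⟨IccExtend hab V, ψ, hψ, V.continuous.Icc_extend', fun d hd => ?_⟩
  filter_upwards [Metric.tendsto_nhds.1 hV d hd] with n hn t ht
  rw [IccExtend_of_mem _ _ ht, ← dist_eq_norm, dist_comm]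
  exact (BoundedContinuousFunction.dist_coe_le_dist (f := f (ψ n)) (g := V) ⟨t, ht⟩).trans_lt hn

theorem LocBddInput.ite {E : Type*} [NormedAddCommGroup E] {w v : ℝ → E} (T : ℝ)
    (hw : LocBddInput univ w) (hv : LocBddInput univ v) :
    LocBddInput univ fun t => if t < T then w t else v t := by
  refine ⟨fun _ _ => mem_univ _, ?_, fun S => ?_⟩
  · exact AEStronglyMeasurable.piecewise (s := Iio T) measurableSet_Iio hw.meas.restrict
      hv.meas.restrict
  · obtain ⟨M, hM⟩ := hw.bdd S
    obtain ⟨M', hM'⟩ := hv.bdd S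
    refine ⟨max M M', fun t ht => ?_⟩
    split_ifs
    · exact (hM t ht).trans (le_max_left _ _)
    · exact (hM' t ht).trans (le_max_right _ _)

/-- Absorption: the supremum is at most half of itself plus D, and it may be subtracted because it
is known to be finite. -/
theorem le_two_mul_of_half_add {ι : Type*} {s : Set ι} {f : ι → ℝ} {D : ℝ}
    (hf : ∃ M, ∀ t ∈ s, f t ≤ M)
    (H : ∀ M, (∀ t ∈ s, f t ≤ M) → ∀ t ∈ s, f t ≤ M / 2 + D) : ∀ t ∈ s, f t ≤ 2 * D := by
  intro t ht
  obtain ⟨M, hM⟩ := hf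
  have hb : BddAbove (f '' s) := ⟨M, by rintro _ ⟨p, hp, rfl⟩; exact hM p hp⟩
  have h1 : ∀ p ∈ s, f p ≤ sSup (f '' s) := fun p hp => le_csSup hb ⟨p, hp, rfl⟩
  have h2 : sSup (f '' s) ≤ sSup (f '' s) / 2 + D := by
    refine csSup_le ⟨_, t, ht, rfl⟩ ?_
    rintro _ ⟨p, hp, rfl⟩
    exact H _ h1 p hp
  linarith [h1 t ht]

/-! ### Causal integral equations with resets -/

/-- A causal operator `Q` on locally bounded signals, continuous for uniform convergence on bounded
intervals and of linear growth with gain `κ`. -/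
structure CausalOp {E : Type*} [NormedAddCommGroup E] (κ : ℝ) (Q : (ℝ → E) → ℝ → E) : Prop where
  cont : ∀ w, LocBddInput univ w → Continuous (Q w)
  causal : ∀ w w' T, LocBddInput univ w → LocBddInput univ w' → EqOn w w' (Ico 0 T) →
    EqOn (Q w) (Q w') (Icc 0 T)
  tendsto : ∀ (w : ℝ → E) (W : ℕ → ℝ → E) (T B : ℝ), LocBddInput univ w →
    (∀ n, LocBddInput univ (W n)) → (∀ t ∈ Icc 0 T, ‖w t‖ ≤ B) →
    (∀ n, ∀ t ∈ Icc 0 T, ‖W n t‖ ≤ B) →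
    (∀ d > 0, ∀ᶠ n in atTop, ∀ t ∈ Icc 0 T, ‖w t - W n t‖ < d) →
    ∀ t ∈ Icc 0 T, Tendsto (fun n => Q (W n) t) atTop (𝓝 (Q w t))
  growth : ∀ T, ∃ C, 0 ≤ C ∧ ∀ (w : ℝ → E) (M : ℝ), LocBddInput univ w →
    (∀ t ∈ Icc 0 T, ‖w t‖ ≤ M) → ∀ t ∈ Icc 0 T, ‖Q w t‖ ≤ C + κ * M

namespace CausalOp

variable {E : Type*} [NormedAddCommGroup E] [NormedSpace ℝ E] {κ δ : ℝ}
  {Q : (ℝ → E) → ℝ → E} {w : ℝ → E} {T T₁ ε : ℝ} {c : E}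

/-- Solvability of the integral equation with delayed upper limit. -/
theorem exists_delayed [SecondCountableTopology E] (hQ : CausalOp κ Q) (hw : LocBddInput univ w)
    (hT : 0 ≤ T) (hT₁ : T ≤ T₁) (c : E) (hε : 0 < ε) :
    ∃ W, LocBddInput univ W ∧ EqOn W w (Iio T) ∧
      ∀ t ∈ Icc T T₁, W t = c + ∫ s in T..max T (t - ε), Q W s := by
  let Γ : (ℝ → E) → ℝ → E := fun W t =>
    if t < T then w t else c + ∫ s in T..max T (min t T₁ - ε), Q W s
  -- Method of steps: by causality and the delay ε, iterate n is already final before T + (n+1)ε, so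
  -- finitely many iterates reach T₁.
  let W : ℕ → ℝ → E := fun n => Nat.rec (fun t => if t < T then w t else c) (fun _ V => Γ V) n
  have hc : LocBddInput univ (fun _ : ℝ => c) := locBddInput_of_continuousOn continuousOn_const
  have hΓ : ∀ V, LocBddInput univ V → LocBddInput univ (Γ V) := fun V hV => by
    refine hw.ite T (locBddInput_of_continuousOn (Continuous.continuousOn ?_))
    have h1 : Continuous fun b => ∫ s in T..b, Q V s :=
      intervalIntegral.continuous_primitive (μ := volume)
        (fun _ _ => (hQ.cont V hV).intervalIntegrable _ _) T
    exact continuous_const.add (h1.comp (by fun_prop))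
  have hW : ∀ n, LocBddInput univ (W n) := fun n => by
    induction n with
    | zero => exact hw.ite T hc
    | succ n ih => exact hΓ _ ih
  have hstep : ∀ n : ℕ, EqOn (W (n + 1)) (W n) (Iio (T + (n + 1) * ε)) := fun n => by
    induction n with
    | zero =>
      intro t ht
      have ht' : t < T + ε := by simpa using ht
      change (if t < T then w t else c + ∫ s in T..max T (min t T₁ - ε), Q (W 0) s) =
        if t < T then w t else c
      rw [max_eq_left (by linarith [min_le_left t T₁]), intervalIntegral.integral_same, add_zero]
    | succ n ih =>
      intro t ht
      have ht' : t < T + (n + 1 + 1) * ε := by simpa using ht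
      change (if t < T then w t else c + ∫ s in T..max T (min t T₁ - ε), Q (W (n + 1)) s) =
        if t < T then w t else c + ∫ s in T..max T (min t T₁ - ε), Q (W n) s
      rw [intervalIntegral.integral_congr fun s hs => ?_]
      rw [uIcc_of_le (le_max_left _ _)] at hs
      refine hQ.causal (W (n + 1)) (W n) (T + (n + 1) * ε) (hW (n + 1)) (hW n) (fun p hp => ih hp.2)
        ⟨hT.trans hs.1, hs.2.trans (max_le ?_ ?_)⟩
      · have : 0 ≤ ((n : ℝ) + 1) * ε := by positivity
        linarith
      · linarith [min_le_left t T₁]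
  obtain ⟨N, hN⟩ := exists_nat_gt ((T₁ - T) / ε)
  have hN' : T₁ < T + (N + 1) * ε := by
    rw [div_lt_iff₀ hε] at hN
    linarith
  refine ⟨W N, hW N, fun t ht => ?_, fun t ht => ?_⟩
  · rw [← hstep N (lt_trans ht (hT₁.trans_lt hN'))]
    exact if_pos ht
  · rw [← hstep N (ht.2.trans_lt hN')]
    change (if t < T then w t else c + ∫ s in T..max T (min t T₁ - ε), Q (W N) s) = _
    rw [if_neg (not_lt.2 ht.1), min_eq_left ht.2]

/-- Linear growth with δκ ≤ 1/2 lets the supremum of W over [T, T₁] be absorbed. The bounds do not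
depend on the delay ε, as the compactness argument requires. -/
theorem exists_bound_delayed (hQ : CausalOp κ Q) (hκ : 0 ≤ κ) (hw : LocBddInput univ w)
    (hT : 0 ≤ T) (hδ : T₁ - T ≤ δ) (hκδ : δ * κ ≤ 1 / 2) (c : E) :
    ∃ B K, 0 ≤ K ∧ ∀ (ε : ℝ) (W : ℝ → E), 0 ≤ ε → LocBddInput univ W → EqOn W w (Iio T) →
      (∀ t ∈ Icc T T₁, W t = c + ∫ s in T..max T (t - ε), Q W s) →
      ∀ t ∈ Icc 0 T₁, ‖W t‖ ≤ B ∧ ‖Q W t‖ ≤ K := by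
  rcases lt_or_ge T₁ T with hlt | hle
  · obtain ⟨A, hA⟩ := hw.bdd T₁
    obtain ⟨C, hC0, hC⟩ := hQ.growth T₁
    refine ⟨A, C + κ * |A|, by positivity, fun ε W hε hW hWw _ t ht => ?_⟩
    have h1 : ∀ t ∈ Icc 0 T₁, ‖W t‖ ≤ A := fun t ht => by
      rw [hWw (ht.2.trans_lt hlt)]
      exact hA t ht
    exact ⟨h1 t ht, hC W _ hW (fun s hs => (h1 s hs).trans (le_abs_self A)) t ht⟩
  obtain ⟨A', hA'⟩ := hw.bdd T₁
  obtain ⟨A, hA0, hA⟩ : ∃ A, 0 ≤ A ∧ ∀ t ∈ Icc 0 T₁, ‖w t‖ ≤ A :=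
    ⟨|A'|, abs_nonneg _, fun t ht => (hA' t ht).trans (le_abs_self _)⟩
  obtain ⟨C, hC0, hC⟩ := hQ.growth T₁
  have hδ0 : 0 ≤ δ := by linarith
  set D := ‖c‖ + δ * (C + κ * A) with hD
  have hD0 : 0 ≤ D := by positivity
  refine ⟨A + 2 * D, C + κ * (A + 2 * D), by positivity, fun ε W hε hW hWw hWe => ?_⟩
  have hall : ∀ M, 0 ≤ M → (∀ t ∈ Icc T T₁, ‖W t‖ ≤ M) → ∀ t ∈ Icc 0 T₁, ‖W t‖ ≤ A + M :=
    fun M hM0 hM t ht => by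
      rcases lt_or_ge t T with h | h
      · rw [hWw h]
        linarith [hA t ht]
      · linarith [hM t ⟨h, ht.2⟩]
  have hbd : ∀ t ∈ Icc T T₁, ‖W t‖ ≤ 2 * D := by
    refine le_two_mul_of_half_add ?_ fun M hM t ht => ?_
    · obtain ⟨M, hM⟩ := hW.bdd T₁
      exact ⟨M, fun t ht => hM t ⟨hT.trans ht.1, ht.2⟩⟩
    · have hM0 : 0 ≤ M := (norm_nonneg _).trans (hM t ht)
      have hq := hC W (A + M) hW (hall M hM0 hM)
      have hmax : max T (t - ε) ≤ t := max_le ht.1 (by linarith)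
      have hint : ‖∫ s in T..max T (t - ε), Q W s‖ ≤ (C + κ * (A + M)) * |max T (t - ε) - T| := by
        refine intervalIntegral.norm_integral_le_of_norm_le_const fun s hs => ?_
        rw [uIoc_of_le (le_max_left _ _)] at hs
        exact hq s ⟨hT.trans hs.1.le, (hs.2.trans hmax).trans ht.2⟩
      rw [abs_of_nonneg (by linarith [le_max_left T (t - ε)])] at hint
      have hlen : max T (t - ε) - T ≤ δ := by linarith [ht.2]
      calc ‖W t‖ ≤ ‖c‖ + (C + κ * (A + M)) * δ := by
            rw [hWe t ht]
            refine (norm_add_le _ _).trans (add_le_add le_rfl (hint.trans ?_))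
            gcongr
        _ = δ * κ * M + D := by rw [hD]; ring
        _ ≤ 1 / 2 * M + D := by gcongr
        _ = M / 2 + D := by ring
  exact fun t ht => ⟨hall _ (by positivity) hbd t ht, hC W _ hW (hall _ (by positivity) hbd) t ht⟩

/-- Dominated convergence on [T, t], while the part of the integral removed by the delay is at most
K e_n. -/
theorem tendsto_integral_delayed {q : ℕ → ℝ → E} {q₀ : ℝ → E} {e : ℕ → ℝ} {K t : ℝ} (hK : 0 ≤ K)
    (hq : ∀ n, Continuous (q n)) (ht : T ≤ t) (hb : ∀ n, ∀ s ∈ Icc T t, ‖q n s‖ ≤ K)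
    (hl : ∀ s ∈ Icc T t, Tendsto (fun n => q n s) atTop (𝓝 (q₀ s))) (he0 : ∀ n, 0 ≤ e n)
    (he : Tendsto e atTop (𝓝 0)) :
    Tendsto (fun n => ∫ s in T..max T (t - e n), q n s) atTop (𝓝 (∫ s in T..t, q₀ s)) := by
  have hsub : ∀ s ∈ uIoc T t, s ∈ Icc T t := fun s hs => by
    rw [uIoc_of_le ht] at hs
    exact ⟨hs.1.le, hs.2⟩
  have h1 : Tendsto (fun n => ∫ s in T..t, q n s) atTop (𝓝 (∫ s in T..t, q₀ s)) := by
    refine intervalIntegral.tendsto_integral_filter_of_dominated_convergence (fun _ => K)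
      (Eventually.of_forall fun n => (hq n).aestronglyMeasurable)
      (Eventually.of_forall fun n => Eventually.of_forall fun s hs => hb n s (hsub s hs))
      intervalIntegrable_const (Eventually.of_forall fun s hs => hl s (hsub s hs))
  have h2 : Tendsto (fun n => ∫ s in max T (t - e n)..t, q n s) atTop (𝓝 0) := by
    refine squeeze_zero_norm (a := fun n => K * e n) (fun n => ?_) (by simpa using he.const_mul K)
    have hmax : max T (t - e n) ≤ t := max_le ht (by linarith [he0 n])
    refine (intervalIntegral.norm_integral_le_of_norm_le_const (C := K) fun s hs => ?_).trans ?_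
    · rw [uIoc_of_le hmax] at hs
      exact hb n s ⟨(le_max_left _ _).trans hs.1.le, hs.2⟩
    · rw [abs_of_nonneg (by linarith)]
      gcongr
      linarith [le_max_right T (t - e n)]
  have h3 := h1.sub h2
  rw [sub_zero] at h3
  refine h3.congr fun n => ?_
  rw [← intervalIntegral.integral_add_adjacent_intervals (b := max T (t - e n))
    ((hq n).intervalIntegrable _ _) ((hq n).intervalIntegrable _ _), add_sub_cancel_right]

/-- Peano-type local existence for the integral equation `w = c + ∫ Q w`. -/
theorem exists_extension [FiniteDimensional ℝ E] (hQ : CausalOp κ Q) (hκ : 0 ≤ κ)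
    (hw : LocBddInput univ w) (hT : 0 ≤ T) (hT₁ : T ≤ T₁) (hδ : T₁ - T ≤ δ)
    (hκδ : δ * κ ≤ 1 / 2) (c : E) :
    ∃ w', LocBddInput univ w' ∧ EqOn w' w (Iio T) ∧
      ∀ t ∈ Icc T T₁, w' t = c + ∫ s in T..t, Q w' s := by
  have := FiniteDimensional.proper ℝ E
  -- Tonelli approximations with delays 1/(n+1); the uniform bound K on Q makes them equi-Lipschitz
  -- on [T, T₁].
  have hε : ∀ n : ℕ, (0 : ℝ) < 1 / ((n : ℝ) + 1) := fun n => by positivity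
  choose W hW hWw hWe using fun n : ℕ => hQ.exists_delayed hw hT hT₁ c (hε n)
  obtain ⟨B, K, hK0, hBK⟩ := hQ.exists_bound_delayed hκ hw hT hδ hκδ c
  replace hBK := fun n => hBK _ (W n) (hε n).le (hW n) (hWw n) (hWe n)
  have hsub : Icc T T₁ ⊆ Icc 0 T₁ := Icc_subset_Icc_left hT
  have hlip : ∀ n, ∀ s ∈ Icc T T₁, ∀ t ∈ Icc T T₁, ‖W n s - W n t‖ ≤ K * |s - t| := by
    intro n s hs t ht
    have hi : ∀ a b, IntervalIntegrable (Q (W n)) volume a b :=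
      fun _ _ => (hQ.cont _ (hW n)).intervalIntegrable _ _
    rw [hWe n s hs, hWe n t ht, add_sub_add_left_eq_sub,
      intervalIntegral.integral_interval_sub_left (hi _ _) (hi _ _)]
    have hmem : ∀ p ∈ Icc T T₁, max T (p - 1 / ((n : ℝ) + 1)) ∈ Icc T T₁ := fun p hp =>
      ⟨le_max_left _ _, max_le hT₁ (by linarith [hp.2, hε n])⟩
    refine (intervalIntegral.norm_integral_le_of_norm_le_const (C := K) fun p hp => ?_).trans ?_
    · exact (hBK n p (hsub (uIcc_subset_Icc (hmem t ht) (hmem s hs) (uIoc_subset_uIcc hp)))).2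
    · refine mul_le_mul_of_nonneg_left ?_ hK0
      have h := abs_max_sub_max_le_abs (s - 1 / ((n : ℝ) + 1)) (t - 1 / ((n : ℝ) + 1)) T
      rwa [max_comm _ T, max_comm _ T, sub_sub_sub_cancel_right] at h
  obtain ⟨V, ψ, hψ, hV, hlim⟩ := exists_subseq_tendsto_of_lipschitz hT₁
    (fun n t ht => (hBK n t (hsub ht)).1) hlip
  set w' : ℝ → E := fun t => if t < T then w t else V t with hw'
  have hw'b : LocBddInput univ w' := hw.ite T (locBddInput_of_continuousOn hV.continuousOn)
  have hwlt : EqOn w' w (Iio T) := fun t ht => if_pos ht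
  have hlim' : ∀ d > 0, ∀ᶠ n in atTop, ∀ t ∈ Icc 0 T₁, ‖w' t - W (ψ n) t‖ < d := fun d hd => by
    filter_upwards [hlim d hd] with n hn t ht
    rcases lt_or_ge t T with h | h
    · rw [hwlt h, hWw _ h, sub_self, norm_zero]
      exact hd
    · simpa only [hw', if_neg (not_lt.2 h)] using hn t ⟨h, ht.2⟩
  have hpt : ∀ t ∈ Icc 0 T₁, Tendsto (fun n => W (ψ n) t) atTop (𝓝 (w' t)) := fun t ht => by
    rw [Metric.tendsto_nhds]
    intro d hd
    filter_upwards [hlim' d hd] with n hn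
    rw [dist_comm, dist_eq_norm]
    exact hn t ht
  have hw'B : ∀ t ∈ Icc 0 T₁, ‖w' t‖ ≤ B := fun t ht =>
    le_of_tendsto (hpt t ht).norm (Eventually.of_forall fun n => (hBK (ψ n) t ht).1)
  -- All approximations equal w before T, so they converge uniformly on the whole of [0, T₁], as
  -- continuity of the causal operator demands.
  have hQlim := hQ.tendsto w' (fun n => W (ψ n)) T₁ B hw'b (fun n => hW _) hw'B
    (fun n t ht => (hBK (ψ n) t ht).1) hlim'
  refine ⟨w', hw'b, hwlt, fun t ht => ?_⟩
  have hsubt : Icc T t ⊆ Icc 0 T₁ := fun s hs => ⟨hT.trans hs.1, hs.2.trans ht.2⟩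
  refine tendsto_nhds_unique (hpt t (hsub ht)) ?_
  have h1 := tendsto_integral_delayed (q := fun n => Q (W (ψ n))) (q₀ := Q w')
    (e := fun n => 1 / ((ψ n : ℝ) + 1)) hK0 (fun n => hQ.cont _ (hW _)) ht.1
    (fun n s hs => (hBK (ψ n) s (hsubt hs)).2) (fun s hs => hQlim s (hsubt hs))
    (fun n => (hε _).le) (tendsto_one_div_add_atTop_nhds_zero_nat.comp hψ.tendsto_atTop)
  exact (h1.const_add c).congr fun n => (hWe (ψ n) t ht).symm

/-- `w` solves the integral equation with resets to `y i` at times `τ i`, up to time `T`. -/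
def Solves (Q : (ℝ → E) → ℝ → E) (y : ℕ → E) (τ : ℕ → ℝ) (T : ℝ) (w : ℝ → E) : Prop :=
  LocBddInput univ w ∧
    ∀ i, ∀ t ∈ Ico (τ i) (τ (i + 1)), t < T → w t = y i + ∫ s in τ i..t, Q w s

variable {y : ℕ → E} {τ : ℕ → ℝ}

/-- T may lie inside a sampling interval. What remains of that interval is no longer than δ, so a
single local existence step reaches its end. -/
theorem exists_next [FiniteDimensional ℝ E] (hQ : CausalOp κ Q) (hκ : 0 ≤ κ)
    (hκδ : δ * κ ≤ 1 / 2) (hτ : IsSampling δ τ) (hw : Solves Q y τ T w) {i : ℕ}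
    (hT : T ∈ Ico (τ i) (τ (i + 1))) :
    ∃ w', Solves Q y τ (τ (i + 1)) w' ∧ EqOn w' w (Iio T) := by
  have h0 := hτ.nonneg i
  have hT0 : 0 ≤ T := h0.trans hT.1
  obtain ⟨w', hw', hlt, heq⟩ := hQ.exists_extension hκ hw.1 hT0 hT.2.le (δ := δ)
    -- The starting constant includes the integral already accumulated since τ_i, so no reset is
    -- introduced at T.
    (by linarith [hτ.step_le i, hT.1]) hκδ (y i + ∫ s in τ i..T, Q w s)
  have hcaus : EqOn (Q w') (Q w) (Icc 0 T) :=
    hQ.causal _ _ _ hw' hw.1 fun t ht => hlt ht.2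
  have hint : ∀ s t, 0 ≤ s → s ≤ t → t ≤ T → ∫ p in s..t, Q w p = ∫ p in s..t, Q w' p :=
    fun s t h1 h2 h3 => intervalIntegral.integral_congr fun p hp => by
      rw [uIcc_of_le h2] at hp
      exact (hcaus ⟨h1.trans hp.1, hp.2.trans h3⟩).symm
  refine ⟨w', ⟨hw', fun j t ht htT => ?_⟩, hlt⟩
  rcases lt_or_ge t T with h | h
  · rw [hlt h, hw.2 j t ht h, hint _ _ (hτ.nonneg j) ht.1 h.le]
  · have hij : j = i := by
      refine le_antisymm ?_ ?_
      · by_contra hc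
        have := hτ.monotone (show i + 1 ≤ j by omega)
        linarith [ht.1]
      · by_contra hc
        have := hτ.monotone (show j + 1 ≤ i by omega)
        linarith [ht.2, hT.1]
    subst hij
    have hi : ∀ a b, IntervalIntegrable (Q w') volume a b :=
      fun _ _ => (hQ.cont _ hw').intervalIntegrable _ _
    rw [heq t ⟨h, htT.le⟩, hint _ _ h0 hT.1 le_rfl, add_assoc,
      intervalIntegral.integral_add_adjacent_intervals (hi _ _) (hi _ _)]

theorem exists_global [FiniteDimensional ℝ E] (hQ : CausalOp κ Q) (hκ : 0 ≤ κ)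
    (hκδ : δ * κ ≤ 1 / 2) (hτ : IsSampling δ τ) (hT : 0 ≤ T) (hw : Solves Q y τ T w) :
    ∃ w', (∀ T', Solves Q y τ T' w') ∧ EqOn w' w (Iio T) := by
  obtain ⟨i₀, hi₀⟩ := hτ.exists_mem hT
  obtain ⟨w₁, hw₁, he₁⟩ := hQ.exists_next hκ hκδ hτ hw hi₀
  have hnext : ∀ i v, Solves Q y τ (τ i) v →
      ∃ v', Solves Q y τ (τ (i + 1)) v' ∧ EqOn v' v (Iio (τ i)) := fun i v hv =>
    hQ.exists_next hκ hκδ hτ hv ⟨le_rfl, by linarith [hτ.step_pos i]⟩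
  choose! step hstep using hnext
  -- W n solves up to τ (i₀ + 1 + n), and later members never change earlier values; N t picks a
  -- member valid strictly beyond t.
  let W : ℕ → ℝ → E := fun n => Nat.rec w₁ (fun n v => step (i₀ + 1 + n) v) n
  have hW : ∀ n, Solves Q y τ (τ (i₀ + 1 + n)) (W n) := fun n => by
    induction n with
    | zero => exact hw₁
    | succ n ih => exact (hstep _ _ ih).1
  have hWs : ∀ n, EqOn (W (n + 1)) (W n) (Iio (τ (i₀ + 1 + n))) := fun n => (hstep _ _ (hW n)).2
  have hWd : ∀ n d, EqOn (W (n + d)) (W n) (Iio (τ (i₀ + 1 + n))) := fun n d => by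
    induction d with
    | zero => exact fun _ _ => rfl
    | succ d ih =>
      exact fun t ht => (hWs (n + d)
        (lt_of_lt_of_le ht (hτ.monotone (by omega)))).trans (ih ht)
  have hex : ∀ t, ∃ n, t < τ (i₀ + 1 + n) := fun t => by
    obtain ⟨j, hj⟩ := (hτ.tendsto.eventually_gt_atTop t).exists
    exact ⟨j, hj.trans_le (hτ.monotone (by omega))⟩
  choose N hN using hex
  have hlim : ∀ n, EqOn (fun t => W (N t) t) (W n) (Iio (τ (i₀ + 1 + n))) := fun n t ht => by
    rcases le_total (N t) n with h | h
    · obtain ⟨d, rfl⟩ := Nat.exists_eq_add_of_le h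
      exact (hWd _ d (hN t)).symm
    · obtain ⟨d, hd⟩ := Nat.exists_eq_add_of_le h
      change W (N t) t = _
      rw [hd]
      exact hWd n d ht
  have hloc : LocBddInput univ fun t => W (N t) t := by
    refine ⟨fun _ _ => mem_univ _, ?_, fun S => ?_⟩
    -- At each time the sequence W n is eventually constant, so the glued signal is its pointwise
    -- limit.
    · refine aestronglyMeasurable_of_tendsto_ae atTop (fun n => (hW n).1.meas)
        (Eventually.of_forall fun t => tendsto_const_nhds.congr' ?_)
      filter_upwards [eventually_ge_atTop (N t)] with n hn
      exact hlim n ((hN t).trans_le (hτ.monotone (by omega)))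
    · obtain ⟨M, hM⟩ := (hW (N S)).1.bdd S
      exact ⟨M, fun t ht => by
        have := hlim (N S) (show t < _ from ht.2.trans_lt (hN S))
        beta_reduce at this ⊢
        rw [this]
        exact hM t ht⟩
  refine ⟨fun t => W (N t) t, fun T' => ⟨hloc, fun i t ht _ => ?_⟩, fun t ht => ?_⟩
  · refine ((hW (N t)).2 i t ht (hN t)).trans ?_
    congr 1
    refine intervalIntegral.integral_congr fun s hs => ?_
    rw [uIcc_of_le ht.1] at hs
    exact hQ.causal _ _ (τ (i₀ + 1 + N t)) (hW _).1 hloc (fun p hp => (hlim _ hp.2).symm)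
      ⟨(hτ.nonneg i).trans hs.1, hs.2.trans (hN t).le⟩
  · have h1 : t < τ (i₀ + 1 + 0) := lt_trans ht hi₀.2
    exact (hlim 0 h1).trans (he₁ ht)

end CausalOp

/-! ### Existence and continuation for the sampled-data observer -/

namespace Loop

variable {nb N₁ N₂ m k l : ℕ} {P : Loop nb N₁ N₂ m k}
  {φ : Hist P.r (St nb N₁ N₂)} {u : ℝ → Eu m} {x : ℝ → St nb N₁ N₂}
  {F : Hist P.r (Eu l) → Eu k → Eu m → Eu l}
  {Ψ : Hist P.r (Eu l) → Hist P.r (St nb N₁ N₂)} {γ σ : ℝ} {g a : ℝ → ℝ} {z₀ : Hist P.r (Eu l)}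
  {w w' : ℝ → Eu k} {z z' : ℝ → Eu l} {τ : ℕ → ℝ} {ξ : ℝ → Eu k} {δ T : ℝ}

theorem continuousOn_predRate_Ici (hA1 : P.A1) (hA3 : P.A3) (hΨ : Continuous Ψ)
    (hu : ContinuousOn u (Ici 0)) (hz : IsObsState F u z₀ w z) :
    ContinuousOn (P.predRate Ψ u z) (Ici 0) :=
  (continuous_R hA1 hA3).comp_continuousOn (f := fun t => (Ψ (hist P.r z t), u t))
    ((hΨ.comp_continuousOn (continuousOn_hist_Ici P.r_pos.le
      (continuousOn_Ici_of_isObsState hz))).prodMk hu)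

/-- Continuous dependence of the observer state on its input. -/
theorem IsObsState.tendsto_hist (hREO : IsREOWith P.r univ {(0 : Eu nb)} P.f P.h F Ψ γ σ g a)
    (hu : ContinuousOn u (Ici 0)) {W : ℕ → ℝ → Eu k} {Z : ℕ → ℝ → Eu l}
    (hz : IsObsState F u z₀ w z) (hZ : ∀ n, IsObsState F u z₀ (W n) (Z n)) {B : ℝ}
    (hw : ∀ t ∈ Icc 0 T, ‖w t‖ ≤ B) (hW : ∀ n, ∀ t ∈ Icc 0 T, ‖W n t‖ ≤ B)
    (hlim : ∀ d > 0, ∀ᶠ n in atTop, ∀ t ∈ Icc 0 T, ‖w t - W n t‖ < d) {t : ℝ}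
    (ht : t ∈ Icc 0 T) : Tendsto (fun n => hist P.r (Z n) t) atTop (𝓝 (hist P.r z t)) := by
  have hT : 0 < T + 1 := by linarith [ht.1.trans ht.2]
  rw [Metric.tendsto_nhds]
  intro ε hε
  obtain ⟨d, hd, h⟩ := exists_modulus_of_oneSided (oneSided_of_REO hREO) P.r_pos.le hu
    (continuous_F_of_REO hREO) (hz _ hT) (lt_add_one T) hw (half_pos hε)
  filter_upwards [hlim d hd] with n hn
  have hclose := h (W n) (Z n) (T + 1) (lt_add_one T) (hZ n _ hT) (hW n) hn
  have hsub : Icc (t - P.r) t ⊆ Ici (-P.r) := fun p hp => mem_Ici.2 (by linarith [hp.1, ht.1])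
  rw [dist_comm, dist_eq_norm]
  refine (norm_hist_sub_le (half_pos hε).le (fun p hp => ?_)
    ((continuousOn_Ici_of_isObsState hz).mono hsub)
    ((continuousOn_Ici_of_isObsState (hZ n)).mono hsub)).trans_lt (half_lt_self hε)
  rcases le_or_gt p 0 with h0 | h0
  · have h1 := (hz _ hT).init ⟨p, hsub hp, h0⟩
    have h2 := (hZ n _ hT).init ⟨p, hsub hp, h0⟩
    simp only at h1 h2
    rw [h1, h2, sub_self, norm_zero]
    exact (half_pos hε).le
  · exact (hclose p ⟨h0.le, hp.2.trans ht.2⟩).le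

theorem norm_predRate_le {L : ℝ} (hR : ∀ φ φ' u, ‖P.R φ u 0 - P.R φ' u 0‖ ≤ L * ‖φ - φ'‖) (t : ℝ) :
    ‖P.predRate Ψ u z t‖ ≤
      ‖P.R (hist P.r x t) (u t) 0‖ + L * ‖Ψ (hist P.r z t) - hist P.r x t‖ := by
  have h := norm_add_le (P.R (hist P.r x t) (u t) 0)
    (P.predRate Ψ u z t - P.R (hist P.r x t) (u t) 0)
  rw [add_sub_cancel] at h
  exact h.trans (add_le_add le_rfl (hR _ _ _))

/-- The growth comes from the observer estimate: R(Ψ(z_t), u) differs from the fixed signal R(x_t,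
u) by at most L times the observer error, which grows with gain γ in w. Freezing time at 0 for t < 0
makes the value continuous on ℝ. -/
theorem causalOp_predRate (hA1 : P.A1) (hA3 : P.A3)
    (hREO : IsREOWith P.r univ {(0 : Eu nb)} P.f P.h F Ψ γ σ g a) (hx : P.IsTraj φ u x)
    {L : ℝ} (hL : 0 ≤ L) (hR : ∀ φ φ' u, ‖P.R φ u 0 - P.R φ' u 0‖ ≤ L * ‖φ - φ'‖)
    {Z : (ℝ → Eu k) → ℝ → Eu l} (hZ : ∀ w, LocBddInput univ w → IsObsState F u z₀ w (Z w)) :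
    CausalOp (L * γ) fun w t => P.predRate Ψ u (Z w) (max t 0) where
  cont w hw := (continuousOn_predRate_Ici hA1 hA3 hREO.Ψ_cont hx.u_cont
    (hZ w hw)).comp_continuous (by fun_prop) fun t => mem_Ici.2 (le_max_right _ _)
  causal w w' T hw hw' h t ht := by
    simp only [max_eq_left ht.1]
    exact predRate_congr (((hZ w hw).eqOn hREO hx.u_cont (hZ w' hw') h hw).mono
      (Icc_subset_Icc (by linarith [ht.1]) ht.2))
  tendsto w W T B hw hW hwB hWB hlim t ht := by
    simp only [max_eq_left ht.1]
    have h := (hZ w hw).tendsto_hist hREO hx.u_cont (fun n => hZ (W n) (hW n)) hwB hWB hlim ht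
    exact (((continuous_R hA1 hA3).comp (hREO.Ψ_cont.prodMk continuous_const)).tendsto _).comp h
  growth T := by
    obtain ⟨C₁, hC₁⟩ := isCompact_Icc.exists_bound_of_continuousOn
      ((hx.continuousOn_R hA1 hA3).mono fun s (hs : s ∈ Icc 0 T) => hs.1)
    obtain ⟨C₂, hC₂⟩ := isCompact_Icc.exists_bound_of_continuousOn
      (hx.continuousOn_out.mono fun s (hs : s ∈ Icc 0 T) => hs.1)
    have hγ := hREO.γ_pos.le
    refine ⟨|C₁| + L * (|a (‖φ‖ + ‖z₀‖)| + γ * |C₂|), by positivity, fun w M hw hM t ht => ?_⟩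
    simp only [max_eq_left ht.1]
    have hexp : Real.exp (-σ * t) * a (‖φ‖ + ‖z₀‖) ≤ |a (‖φ‖ + ‖z₀‖)| := by
      refine (mul_le_mul_of_nonneg_left (le_abs_self _) (Real.exp_pos _).le).trans
        (mul_le_of_le_one_left (abs_nonneg _) (Real.exp_le_one_iff.2 ?_))
      nlinarith [ht.1, hREO.σ_pos]
    have hfad : fadingSup σ (fun s => w s - P.outMap (x s)) t ≤ M + |C₂| := by
      refine fadingSup_le ht.1 fun s hs => ?_
      have h1 : ‖w s - P.outMap (x s)‖ ≤ M + |C₂| :=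
        (_root_.norm_sub_le _ _).trans (add_le_add (hM s ⟨hs.1, hs.2.trans ht.2⟩)
          ((hC₂ s ⟨hs.1, hs.2.trans ht.2⟩).trans (le_abs_self _)))
      refine (mul_le_of_le_one_right (norm_nonneg _) (Real.exp_le_one_iff.2 ?_)).trans h1
      nlinarith [hs.2, hREO.σ_pos]
    have h := (hZ w hw).norm_sub_le hREO hx hw ht.1
    calc _ ≤ _ := norm_predRate_le (x := x) hR t
      _ ≤ |C₁| + L * (|a (‖φ‖ + ‖z₀‖)| + γ * (M + |C₂|)) := by
        refine add_le_add ((hC₁ t ht).trans (le_abs_self _)) (mul_le_mul_of_nonneg_left ?_ hL)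
        exact h.trans (add_le_add hexp (mul_le_mul_of_nonneg_left hfad hγ))
      _ = _ := by ring

theorem isPredictor_of_solves {Z : (ℝ → Eu k) → ℝ → Eu l} {y : ℝ → Eu k} (hτ : IsSampling δ τ)
    (h : CausalOp.Solves (fun w t => P.predRate Ψ u (Z w) (max t 0)) (fun i => y (τ i)) τ T w) :
    IsPredictor P Ψ u y τ T (Z w) w := fun i t ht htT => by
  rw [h.2 i t ht htT]
  congr 1
  refine intervalIntegral.integral_congr fun s hs => ?_
  rw [uIcc_of_le ht.1] at hs
  simp only [max_eq_left ((hτ.nonneg i).trans hs.1)]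

/-- Global existence for the sampled-data observer, starting from a predictor that is given on
`[0, T)`. -/
theorem exists_global_of_solves (hA1 : P.A1) (hA3 : P.A3)
    (hREO : IsREOWith P.r univ {(0 : Eu nb)} P.f P.h F Ψ γ σ g a) (hx : P.IsTraj φ u x)
    {L : ℝ} (hL : 0 ≤ L) (hR : ∀ φ φ' u, ‖P.R φ u 0 - P.R φ' u 0‖ ≤ L * ‖φ - φ'‖)
    (hτ : IsSampling δ τ) (hδ : δ * (L * γ) ≤ 1 / 2) {y : ℝ → Eu k}
    {Z : (ℝ → Eu k) → ℝ → Eu l} (hZ : ∀ w, LocBddInput univ w → IsObsState F u z₀ w (Z w))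
    (hT : 0 ≤ T)
    (h : CausalOp.Solves (fun w t => P.predRate Ψ u (Z w) (max t 0)) (fun i => y (τ i)) τ T w) :
    ∃ w', LocBddInput univ w' ∧ IsObsState F u z₀ w' (Z w') ∧
      (∀ T', IsPredictor P Ψ u y τ T' (Z w') w') ∧ EqOn w' w (Iio T) := by
  have hQ := causalOp_predRate hA1 hA3 hREO hx hL hR hZ
  obtain ⟨w', hw', he⟩ := hQ.exists_global (mul_nonneg hL hREO.γ_pos.le) hδ hτ hT h
  exact ⟨w', (hw' 0).1, hZ _ (hw' 0).1, fun T' => isPredictor_of_solves hτ (hw' T'), he⟩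

theorem exists_obsState_map (hREO : IsREOWith P.r univ {(0 : Eu nb)} P.f P.h F Ψ γ σ g a)
    (hx : P.IsTraj φ u x) (z₀ : Hist P.r (Eu l)) : ∃ Z : (ℝ → Eu k) → ℝ → Eu l,
      ∀ w, LocBddInput univ w → IsObsState F u z₀ w (Z w) := by
  have h : ∀ w : ℝ → Eu k, ∃ z, LocBddInput univ w → IsObsState F u z₀ w z := fun w => by
    by_cases hw : LocBddInput univ w
    · obtain ⟨z, hz⟩ := exists_isObsState hREO hx z₀ hw
      exact ⟨z, fun _ => hz⟩
    · exact ⟨0, fun h => absurd h hw⟩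
  exact ⟨fun w => (h w).choose, fun w => (h w).choose_spec⟩

theorem exists_global_predictor (hA1 : P.A1) (hA3 : P.A3)
    (hREO : IsREOWith P.r univ {(0 : Eu nb)} P.f P.h F Ψ γ σ g a) (hx : P.IsTraj φ u x)
    {L : ℝ} (hL : 0 ≤ L) (hR : ∀ φ φ' u, ‖P.R φ u 0 - P.R φ' u 0‖ ≤ L * ‖φ - φ'‖)
    (hτ : IsSampling δ τ) (hδ : δ * (L * γ) ≤ 1 / 2) (y : ℝ → Eu k) (z₀ : Hist P.r (Eu l)) :
    ∃ w z, IsObsState F u z₀ w z ∧ ∀ T, IsPredictor P Ψ u y τ T z w := by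
  obtain ⟨Z, hZ⟩ := exists_obsState_map hREO hx z₀
  -- Starting at T = 0, the equation to be satisfied so far is vacuous and any signal will do.
  obtain ⟨w, -, hz, hw, -⟩ := exists_global_of_solves (T := 0) (w := 0) (y := y) hA1 hA3 hREO hx hL
    hR hτ hδ hZ le_rfl ⟨locBddInput_of_continuousOn continuousOn_const, fun i t ht ht0 =>
      absurd ((hτ.nonneg i).trans ht.1) (not_le.2 ht0)⟩
  exact ⟨w, Z w, hz, hw⟩

/-- On a bounded interval the predictor of a solution is bounded, by the small-gain estimate. -/
theorem IsPredictor.exists_bound (hA1 : P.A1) (hA3 : P.A3)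
    (hREO : IsREOWith P.r univ {(0 : Eu nb)} P.f P.h F Ψ γ σ g a) (hx : P.IsTraj φ u x)
    (hξ : LocBddInput univ ξ) (hτ : IsSampling δ τ) {L : ℝ} (hL : 0 ≤ L)
    (hR : ∀ φ φ' u, ‖P.R φ u 0 - P.R φ' u 0‖ ≤ L * ‖φ - φ'‖)
    (hδ : γ * L * δ * Real.exp (σ * δ) ≤ 1 / 2)
    (hz : IsDelaySolution P.r T z₀ z fun t => F (hist P.r z t) (w t) (u t))
    (h : IsPredictor P Ψ u (fun s => P.outMap (x s) + ξ s) τ T z w) :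
    ∃ B, ∀ t ∈ Ico 0 T, ‖w t‖ ≤ B := by
  obtain ⟨C₁, hC₁⟩ := isCompact_Icc.exists_bound_of_continuousOn
    ((hx.continuousOn_R hA1 hA3).mono fun s (hs : s ∈ Icc 0 T) => hs.1)
  obtain ⟨C₂, hC₂⟩ := isCompact_Icc.exists_bound_of_continuousOn
    (hx.continuousOn_out.mono fun s (hs : s ∈ Icc 0 T) => hs.1)
  obtain ⟨A, hA⟩ := hξ.bdd T
  have hσ := hREO.σ_pos
  have hγ := hREO.γ_pos
  set D : ℝ := |2 * a (‖φ‖ + ‖z₀‖)| + 2 * γ * Real.exp (σ * δ) * A with hD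
  have hE : ∀ s ∈ Ico 0 T, ‖P.predRate Ψ u z s‖ ≤ C₁ + L * D := fun s hs => by
    refine (norm_predRate_le (x := x) hR s).trans (add_le_add (hC₁ s ⟨hs.1, hs.2.le⟩)
      (mul_le_mul_of_nonneg_left ?_ hL))
    refine (h.norm_sub_le hA1 hA3 hREO hx hξ hτ hL hR hδ hz hs).trans (add_le_add ?_ ?_)
    · refine (mul_le_mul_of_nonneg_left (le_abs_self _) (Real.exp_pos _).le).trans
        (mul_le_of_le_one_left (abs_nonneg _) (Real.exp_le_one_iff.2 ?_))
      nlinarith [hs.1]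
    · refine mul_le_mul_of_nonneg_left (fadingSup_le hs.1 fun p hp => ?_) (by positivity)
      refine (mul_le_of_le_one_right (norm_nonneg _) (Real.exp_le_one_iff.2 ?_)).trans
        (hA p ⟨hp.1, hp.2.trans hs.2.le⟩)
      nlinarith [hp.2]
  refine ⟨C₂ + A + (C₁ + L * D) * δ, fun t ht => h.norm_le hτ ht (fun s hs => ?_) fun s hs =>
    hE s ⟨hs.1, hs.2.trans_lt ht.2⟩⟩
  have hs' : s ∈ Icc 0 T := ⟨hs.1, hs.2.trans ht.2.le⟩
  exact (norm_add_le _ _).trans (add_le_add (hC₂ s hs') (hA s hs'))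

/-- The small-gain bound prevents blow-up of w at T, so w cut off at T is an admissible input. Its
observer state agrees with z before T by one-sided uniqueness, hence the given w solves the causal
equation up to T and can be continued. -/
theorem exists_extension_of_isPredictor (hA1 : P.A1) (hA3 : P.A3)
    (hREO : IsREOWith P.r univ {(0 : Eu nb)} P.f P.h F Ψ γ σ g a) (hx : P.IsTraj φ u x)
    (hξ : LocBddInput univ ξ) (hτ : IsSampling δ τ) {L : ℝ} (hL : 0 ≤ L)
    (hR : ∀ φ φ' u, ‖P.R φ u 0 - P.R φ' u 0‖ ≤ L * ‖φ - φ'‖)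
    (hδ : γ * L * δ * Real.exp (σ * δ) ≤ 1 / 2) (hδ' : δ * (L * γ) ≤ 1 / 2) (hT : 0 < T)
    (hz : IsDelaySolution P.r T z₀ z fun t => F (hist P.r z t) (w t) (u t))
    (h : IsPredictor P Ψ u (fun s => P.outMap (x s) + ξ s) τ T z w) :
    ∃ w' z', IsObsState F u z₀ w' z' ∧
      (∀ T', IsPredictor P Ψ u (fun s => P.outMap (x s) + ξ s) τ T' z' w') ∧
      EqOn w' w (Ico 0 T) ∧ EqOn z' z (Ico (-P.r) T) := by
  obtain ⟨Z, hZ⟩ := exists_obsState_map hREO hx z₀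
  obtain ⟨B, hB⟩ := h.exists_bound hA1 hA3 hREO hx hξ hτ hL hR hδ hz
  have hp : ContinuousOn (P.predRate Ψ u z) (Ico 0 T) :=
    continuousOn_predRate hA1 hA3 hREO.Ψ_cont hx.u_cont hz.cont
  set v : ℝ → Eu k := (Iio T).indicator w with hv
  have hvw : EqOn v w (Iio T) := fun t ht => indicator_of_mem ht w
  have hvb : LocBddInput univ v := locBddInput_indicator measurableSet_Iio
    (by rw [Ici_inter_Iio]; exact h.aestronglyMeasurable hτ hp)
    fun S => ⟨B, fun t ht => hB t ⟨ht.1.1, ht.2⟩⟩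
  have heq : ∀ w' z', IsObsState F u z₀ w' z' → EqOn w' w (Iio T) → EqOn z' z (Ico (-P.r) T) :=
    fun w' z' hz' hww t ht => by
      have hmax : max t 0 < T := max_lt ht.2 hT
      exact (eqOn_of_oneSided (oneSided_of_REO hREO) P.r_pos.le hx.u_cont hz (hz' T hT) hmax hmax
        (fun s hs => (hww (hs.2.trans hmax)).symm)
        ⟨B, fun s hs => hB s ⟨hs.1, hs.2.trans hmax⟩⟩ ⟨ht.1, le_max_left _ _⟩).symm
  have hsol : CausalOp.Solves (fun w t => P.predRate Ψ u (Z w) (max t 0))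
      (fun i => P.outMap (x (τ i)) + ξ (τ i)) τ T v := by
    refine ⟨hvb, fun i t ht htT => ?_⟩
    rw [hvw htT, h i t ht htT]
    congr 1
    refine intervalIntegral.integral_congr fun s hs => ?_
    rw [uIcc_of_le ht.1] at hs
    have hs0 : 0 ≤ s := (hτ.nonneg i).trans hs.1
    simp only [max_eq_left hs0]
    exact predRate_congr fun p hp => (heq _ _ (hZ v hvb) hvw
      ⟨by linarith [hp.1], hp.2.trans_lt (hs.2.trans_lt htT)⟩).symm
  obtain ⟨w', hw', hz', hpr, he⟩ := exists_global_of_solves (y := fun s => P.outMap (x s) + ξ s)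
    hA1 hA3 hREO hx hL hR hτ hδ' hZ hT.le hsol
  have hew : EqOn w' w (Iio T) := he.trans hvw
  exact ⟨w', Z w', hz', hpr, hew.mono Ico_subset_Iio_self, heq _ _ hz' hew⟩

end Loop

/-! ### Rescaled comparison functions -/

theorem classKInf_comp_mul {a : ℝ → ℝ} (ha : ClassKInf a) {c d : ℝ} (hc : 0 < c) (hd : 0 < d) :
    ClassKInf fun s => c * a (d * s) := by
  have hmem : ∀ s ∈ Ici (0 : ℝ), d * s ∈ Ici (0 : ℝ) := fun s hs => mul_nonneg hd.le hs
  refine ⟨⟨continuousOn_const.mul (ha.cont.comp (by fun_prop) hmem), fun s hs t ht hst => ?_, ?_⟩, ?_⟩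
  · exact mul_lt_mul_of_pos_left (ha.mono (hmem s hs) (hmem t ht)
      (mul_lt_mul_of_pos_left hst hd)) hc
  · simp only [mul_zero, ha.zero]
  · exact (ha.unbounded.comp (tendsto_id.const_mul_atTop hd)).const_mul_atTop hc

theorem IsLinearOnNonneg.comp_mul {a : ℝ → ℝ} (ha : IsLinearOnNonneg a) (c : ℝ) {d : ℝ}
    (hd : 0 ≤ d) : IsLinearOnNonneg fun s => c * a (d * s) := by
  obtain ⟨M, hM⟩ := ha
  exact ⟨c * M * d, fun s hs => by
    beta_reduce
    rw [hM _ (mul_nonneg hd hs)]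
    ring⟩

/-! ### Solutions of the coupled system -/

namespace Loop

variable {nb N₁ N₂ m k l : ℕ} {P : Loop nb N₁ N₂ m k}
  {φ : Hist P.r (St nb N₁ N₂)} {u : ℝ → Eu m} {x : ℝ → St nb N₁ N₂}
  {F : Hist P.r (Eu l) → Eu k → Eu m → Eu l}
  {Ψ : Hist P.r (Eu l) → Hist P.r (St nb N₁ N₂)} {γ σ : ℝ} {g a : ℝ → ℝ} {z₀ : Hist P.r (Eu l)}
  {w w' : ℝ → Eu k} {z z' : ℝ → Eu l} {τ : ℕ → ℝ} {ξ : ℝ → Eu k} {δ T : ℝ}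
  {xb₀ : Eu nb} {v₀ : ℝ → ℝ} {xb : ℝ → Eu nb} {v : ℝ → ℝ → ℝ}

/-- The trajectory of the delay system carries every classical solution of the loop. -/
theorem IsPDESolution.stackedSignal_eqOn (hA1 : P.A1) (hA3 : P.A3) (hx : P.IsTraj φ u x)
    (hφ : P.Generates φ xb₀ v₀) (hT : 0 < T) (hs : P.IsPDESolution T xb₀ v₀ u xb v) :
    EqOn (P.stackedSignal φ xb v) x (Ico (-P.r) T) := by
  obtain ⟨-, -, -, h⟩ := exists_solution_of_delay hA1 hA3 hx.u_cont hφ hx.sol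
  refine (hs.integralForm hA1 hT hx.u_cont hφ).eqOn hA1 hx.u_cont (h T hT) fun p hp => ?_
  rw [stackedSignal_of_nonpos hp.2, P.ev_of_mem φ hp]
  exact ((hx.sol T hT).init ⟨p, hp⟩).symm

theorem IsPDESolution.measured_eq (hA1 : P.A1) (hA3 : P.A3) (hx : P.IsTraj φ u x)
    (hφ : P.Generates φ xb₀ v₀) (hT : 0 < T) (hs : P.IsPDESolution T xb₀ v₀ u xb v) {t : ℝ}
    (ht : t ∈ Ico 0 T) : P.measured (xb t) (v t) = x t := by
  rw [← hs.stackedSignal_of_nonneg hφ ht.1]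
  exact hs.stackedSignal_eqOn hA1 hA3 hx hφ hT ⟨by linarith [ht.1, P.r_pos], ht.2⟩

theorem IsPDESolution.eq_xPart (hA1 : P.A1) (hA3 : P.A3) (hx : P.IsTraj φ u x)
    (hφ : P.Generates φ xb₀ v₀) (hT : 0 < T) (hs : P.IsPDESolution T xb₀ v₀ u xb v) {t : ℝ}
    (ht : t ∈ Ico 0 T) : xb t = xPart (x t) := by
  rw [← hs.measured_eq hA1 hA3 hx hφ hT ht]
  rfl

theorem IsPDESolution.eq_profile_traj (hA1 : P.A1) (hA3 : P.A3) (hx : P.IsTraj φ u x)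
    (hφ : P.Generates φ xb₀ v₀) (hT : 0 < T) (hs : P.IsPDESolution T xb₀ v₀ u xb v) {t : ℝ}
    (ht : t ∈ Ico 0 T) : EqOn (v t) (P.profile (hist P.r x t)) (Icc 0 1) := fun y hy => by
  rw [hs.eq_profile hA1 hT hφ ht hy, hist_congr fun p hp =>
    hs.stackedSignal_eqOn hA1 hA3 hx hφ hT ⟨by linarith [hp.1, ht.1], hp.2.trans_lt ht.2⟩]

/-- The reset value is h(x_{τ_i}) + ξ(τ_i) because the loop is carried by x; between samples the
almost-everywhere equation integrates up, its right-hand side being continuous. -/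
theorem IsSolution.isPredictor (hA1 : P.A1) (hA3 : P.A3) (hΨ : Continuous Ψ)
    (hx : P.IsTraj φ u x) (hφ : P.Generates φ xb₀ v₀) (hτ : IsSampling δ τ) (hT : 0 < T)
    (h : P.IsSolution F Ψ τ xb₀ v₀ z₀ u ξ T xb v z w) :
    IsPredictor P Ψ u (fun s => P.outMap (x s) + ξ s) τ T z w := fun i t ht htT => by
  have h0 := hτ.nonneg i
  have hiT : τ i < T := ht.1.trans_lt htT
  have hreset : w (τ i) = P.outMap (x (τ i)) + ξ (τ i) := by
    rw [h.w_reset i hiT, output_eq, h.pde.measured_eq hA1 hA3 hx hφ hT ⟨h0, hiT⟩]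
  rcases ht.1.eq_or_lt with rfl | hlt
  · rw [intervalIntegral.integral_same, add_zero, hreset]
  have hp : ContinuousOn (P.predRate Ψ u z) (Icc (τ i) t) :=
    (continuousOn_predRate hA1 hA3 hΨ hx.u_cont h.z_eq.cont).mono fun s hs =>
      ⟨h0.trans hs.1, hs.2.trans_lt htT⟩
  obtain ⟨K, hK⟩ := isCompact_Icc.exists_bound_of_continuousOn hp
  have hmin : t < min (τ (i + 1)) T := lt_min ht.2 htT
  beta_reduce
  rw [← hreset, ← ((h.w_eq i hiT).1 t ⟨hlt, hmin⟩).sub_eq_integral (g := P.predRate Ψ u z) hlt.le ?_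
    (hp.mono (by rw [uIcc_of_le hlt.le])).intervalIntegrable hK, add_sub_cancel]
  filter_upwards [(h.w_eq i hiT).2] with s hs hs'
  exact hs ⟨hs'.1, hs'.2.trans hmin⟩

theorem IsPredictor.solvesAE (hA1 : P.A1) (hA3 : P.A3) (hΨ : Continuous Ψ)
    (hu : ContinuousOn u (Ici 0)) (hz : IsObsState F u z₀ w z) (hτ : IsSampling δ τ)
    {y : ℝ → Eu k} (h : IsPredictor P Ψ u y τ T z w) (i : ℕ) :
    SolvesAE w (P.predRate Ψ u z) (τ i) (min (τ (i + 1)) T) := by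
  have h0 := hτ.nonneg i
  have hp := continuousOn_predRate_Ici hA1 hA3 hΨ hu hz
  have heq : ∀ t ∈ Ico (τ i) (min (τ (i + 1)) T),
      w t = y (τ i) + ∫ s in τ i..t, P.predRate Ψ u z s := fun t ht =>
    h i t ⟨ht.1, ht.2.trans_le (min_le_left _ _)⟩ (ht.2.trans_le (min_le_right _ _))
  have hi : ∀ s t, 0 ≤ s → 0 ≤ t → IntervalIntegrable (P.predRate Ψ u z) volume s t :=
    fun s t hs ht => (hp.mono fun p hp => (le_min hs ht).trans hp.1).intervalIntegrable
  refine ⟨fun T' hT' => ?_, Eventually.of_forall fun t ht => ?_⟩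
  · obtain ⟨K, hK⟩ := isCompact_Icc.exists_bound_of_continuousOn
      (hp.mono fun s (hs : s ∈ Icc (τ i) T') => h0.trans hs.1)
    have hK0 : 0 ≤ K := (norm_nonneg _).trans (hK _ (left_mem_Icc.2 hT'.1.le))
    refine LipschitzOnWith.absolutelyContinuousOnInterval (K := ⟨K, hK0⟩)
      (LipschitzOnWith.of_dist_le_mul fun s hs t ht => ?_)
    rw [uIcc_of_le hT'.1.le] at hs ht
    rw [heq s ⟨hs.1, hs.2.trans_lt hT'.2⟩, heq t ⟨ht.1, ht.2.trans_lt hT'.2⟩, dist_eq_norm,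
      add_sub_add_left_eq_sub, intervalIntegral.integral_interval_sub_left
        (hi _ _ h0 (h0.trans hs.1)) (hi _ _ h0 (h0.trans ht.1)), Real.dist_eq]
    exact intervalIntegral.norm_integral_le_of_norm_le_const fun p hp =>
      hK p (uIcc_subset_Icc ht hs (uIoc_subset_uIcc hp))
  · have ht0 : 0 < t := h0.trans_lt ht.1
    have hd : HasDerivAt (fun t => y (τ i) + ∫ s in τ i..t, P.predRate Ψ u z s)
        (P.predRate Ψ u z t) t :=
      (intervalIntegral.integral_hasDerivAt_right (hi _ _ h0 ht0.le)
        (hp.stronglyMeasurableAtFilter_nhdsWithin measurableSet_Ici t |>.filter_mono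
          (by rw [nhdsWithin_eq_nhds.2 (Ici_mem_nhds ht0)]))
        (hp.continuousAt (Ici_mem_nhds ht0))).const_add _
    refine hd.congr_of_eventuallyEq ?_
    filter_upwards [Ioo_mem_nhds ht.1 ht.2] with s hs using heq s ⟨hs.1.le, hs.2⟩

theorem exists_isSolution_of_isPredictor (hA1 : P.A1) (hA3 : P.A3) (hΨ : Continuous Ψ)
    (hx : P.IsTraj φ u x) (hφ : P.Generates φ xb₀ v₀) (hτ : IsSampling δ τ)
    (hz : IsObsState F u z₀ w z)
    (h : ∀ T, IsPredictor P Ψ u (fun s => P.outMap (x s) + ξ s) τ T z w) :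
    ∃ v, (∀ t, 0 ≤ t → EqOn (v t) (P.profile (hist P.r x t)) (Icc 0 1)) ∧
      ∀ T > 0, P.IsSolution F Ψ τ xb₀ v₀ z₀ u ξ T (fun t => xPart (x t)) v z w := by
  obtain ⟨v, hv, hpde, -⟩ := exists_solution_of_delay hA1 hA3 hx.u_cont hφ hx.sol
  refine ⟨v, fun t ht y hy => hv t ht y hy, fun T hT => ⟨hpde T hT, hz T hT, fun i hi => ?_,
    fun i _ => (h T).solvesAE hA1 hA3 hΨ hx.u_cont hz hτ i⟩⟩
  have h1 := h T i (τ i) ⟨le_rfl, by linarith [hτ.step_pos i]⟩ hi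
  rw [intervalIntegral.integral_same, add_zero] at h1
  rw [h1, output_eq, (hpde T hT).measured_eq hA1 hA3 hx hφ hT ⟨hτ.nonneg i, hi⟩]

/-- v[t] and v̂[t] are the profiles of x_t and of Ψ(z_t) under the same map, which is Lipschitz; the
ODE error is the current value of the same history difference. -/
theorem IsPDESolution.error_le (hA1 : P.A1) (hA3 : P.A3) (hx : P.IsTraj φ u x)
    (hφ : P.Generates φ xb₀ v₀) (hT : 0 < T) (hs : P.IsPDESolution T xb₀ v₀ u xb v) {t L : ℝ}
    (hL : 0 ≤ L) (hprof : ∀ z ∈ Icc (0 : ℝ) 1, ∀ φ φ' : Hist P.r (St nb N₁ N₂),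
      |P.profile φ z - P.profile φ' z| ≤ L * ‖φ - φ'‖) (ht : t ∈ Ico 0 T) :
    P.error Ψ xb v z t ≤ (1 + L) * ‖Ψ (hist P.r z t) - hist P.r x t‖ := by
  rw [error, norm_sub_rev (Ψ _), add_mul, one_mul]
  refine add_le_add ?_ ?_
  · have hev : P.ev (hist P.r x t) 0 = x t := by
      rw [P.ev_hist (hx.cont.mono fun p hp => mem_Ici.2 (by linarith [hp.1, ht.1]))
        ⟨by linarith [P.r_pos], le_rfl⟩, add_zero]
    rw [hs.eq_xPart hA1 hA3 hx hφ hT ht, ← hev, ← xPart_sub]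
    exact (norm_xPart_le _).trans (P.norm_ev_sub_le _ _ _)
  · rw [prof_congr (hs.eq_profile_traj hA1 hA3 hx hφ hT ht),
      prof_congr (f' := P.profile (Ψ (hist P.r z t))) fun y _ => vhat_eq _ t y]
    exact norm_prof_profile_sub_le hA1 (by positivity) fun y hy => hprof y hy _ _

theorem exists_sampling_bound {γ L σ : ℝ} (hγ : 0 ≤ γ) (hL : 0 ≤ L) (hσ : 0 ≤ σ) :
    ∃ δ, 0 < δ ∧ γ * L * δ * Real.exp (σ * δ) ≤ 1 / 2 ∧ δ * (L * γ) ≤ 1 / 2 := by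
  -- δ = 1/(2A) is at most 1, so exp(σδ) ≤ exp(σ); the bound with exp(σ) then implies both
  -- requirements.
  set A := γ * L * Real.exp σ + 1 with hA
  have hA1 : 1 ≤ A := by
    have : 0 ≤ γ * L * Real.exp σ := by positivity
    linarith
  have hpos : 0 < 1 / (2 * A) := by positivity
  have hle : 1 / (2 * A) ≤ 1 := by
    rw [div_le_one (by positivity)]
    linarith
  have key : γ * L * (1 / (2 * A)) * Real.exp σ ≤ 1 / 2 := by
    rw [show γ * L * (1 / (2 * A)) * Real.exp σ = (A - 1) / (2 * A) by rw [hA]; ring,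
      div_le_div_iff₀ (by positivity) two_pos]
    linarith
  refine ⟨1 / (2 * A), hpos, le_trans ?_ key, le_trans ?_ key⟩
  · gcongr
    nlinarith
  · rw [show 1 / (2 * A) * (L * γ) = γ * L * (1 / (2 * A)) by ring]
    exact le_mul_of_one_le_right (by positivity) (Real.one_le_exp hσ)

end Loop

end SampledData

end

/-! ### The main theorem -/

theorem theorem3p2 {nb N₁ N₂ m k l : ℕ} (P : Loop nb N₁ N₂ m k)
    (hA1 : P.A1) (hA2 : P.A2) (hA3 : P.A3)
    (F : Hist P.r (Eu l) → Eu k → Eu m → Eu l)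
    (Ψ : Hist P.r (Eu l) → Hist P.r (St nb N₁ N₂))
    (γ σ : ℝ) (g a : ℝ → ℝ)
    (hREO : IsREOWith P.r univ {(0 : Eu nb)} P.f P.h F Ψ γ σ g a)
    (hR : ∀ S : Set (Hist P.r (Eu l) × Eu m), Bornology.IsBounded S →
      ∃ L : ℝ, 0 ≤ L ∧ ∀ (z z' : Hist P.r (Eu l)) (u : Eu m), (z, u) ∈ S → (z', u) ∈ S →
        ‖P.R (Ψ z) u 0 - P.R (Ψ z') u 0‖ ≤ L * ‖z - z'‖) :
    ∃ (δ C ω : ℝ) (abar : ℝ → ℝ), 0 < δ ∧ 0 < C ∧ 0 < ω ∧ ClassKInf abar ∧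
      (IsLinearOnNonneg a → IsLinearOnNonneg abar) ∧
      ∀ τ : ℕ → ℝ, IsSampling δ τ →
      ∀ (v₀ : ℝ → ℝ) (xb₀ : Eu nb), P.Compatible v₀ xb₀ →
      ∀ (z₀ : Hist P.r (Eu l)) (u : ℝ → Eu m) (ξ : ℝ → Eu k),
        ContinuousOn u (Ici 0) → LocBddInput univ ξ →
        (∃ (xb : ℝ → Eu nb) (v : ℝ → ℝ → ℝ) (z : ℝ → Eu l) (w : ℝ → Eu k),
          ∀ T > 0, P.IsSolution F Ψ τ xb₀ v₀ z₀ u ξ T xb v z w) ∧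
        ∀ (T₀ : ℝ) (xb : ℝ → Eu nb) (v : ℝ → ℝ → ℝ) (z : ℝ → Eu l) (w : ℝ → Eu k), 0 < T₀ →
          P.IsSolution F Ψ τ xb₀ v₀ z₀ u ξ T₀ xb v z w →
          (∀ t ∈ Ico 0 T₀, P.error Ψ xb v z t ≤
            Real.exp (-ω * t) *
                abar (‖prof v₀‖ + ‖prof (derivWithin v₀ (Icc 0 1))‖ + ‖xb₀‖ + ‖z₀‖) +
              C * fadingSup ω ξ t) ∧
          ∃ (xb' : ℝ → Eu nb) (v' : ℝ → ℝ → ℝ) (z' : ℝ → Eu l) (w' : ℝ → Eu k),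
            (∀ T > 0, P.IsSolution F Ψ τ xb₀ v₀ z₀ u ξ T xb' v' z' w') ∧
            (∀ t ∈ Ico 0 T₀, xb' t = xb t ∧ w' t = w t ∧ ∀ y ∈ Icc (0 : ℝ) 1, v' t y = v t y) ∧
            ∀ t ∈ Ico (-P.r) T₀, z' t = z t := by
  obtain ⟨G, hG, hgen⟩ := Loop.exists_generates hA2
  obtain ⟨L, hL, hlip⟩ := Loop.exists_lipschitz_R hA1 hA3
  obtain ⟨Lp, hLp, hprof⟩ := Loop.exists_lipschitz_profile hA1
  obtain ⟨δ, hδ, hδ₁, hδ₂⟩ := Loop.exists_sampling_bound hREO.γ_pos.le hL hREO.σ_pos.le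
  have hγ := hREO.γ_pos
  -- The rate is that of the given observer. The factor 2 is the small-gain loss, 1 + Lp passes from
  -- histories to profiles, and G + 1 bounds ‖φ‖ + ‖z₀‖ by the norms of the initial data through
  -- (A2).
  refine ⟨δ, (1 + Lp) * (2 * γ * Real.exp (σ * δ)), σ, fun s => (1 + Lp) * 2 * a ((G + 1) * s), hδ,
    by positivity, hREO.σ_pos, classKInf_comp_mul hREO.a_classKInf (by positivity) (by positivity),
    fun h => h.comp_mul _ (by positivity), fun τ hτ v₀ xb₀ hc z₀ u ξ hu hξ => ?_⟩
  obtain ⟨φ, hφ, hφG⟩ := hgen v₀ xb₀ hc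
  obtain ⟨x, hx⟩ := Loop.exists_isTraj hA1 hA3 hREO hφ hu
  refine ⟨?_, fun T₀ xb v z w hT₀ hs => ⟨fun t ht => ?_, ?_⟩⟩
  · obtain ⟨w, z, hz, hw⟩ := Loop.exists_global_predictor hA1 hA3 hREO hx hL hlip hτ hδ₂
      (fun s => P.outMap (x s) + ξ s) z₀
    obtain ⟨v, -, hv⟩ :=
      Loop.exists_isSolution_of_isPredictor hA1 hA3 hREO.Ψ_cont hx hφ hτ hz hw
    exact ⟨_, v, z, w, hv⟩
  · have hpred := hs.isPredictor hA1 hA3 hREO.Ψ_cont hx hφ hτ hT₀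
    have h1 := hpred.norm_sub_le hA1 hA3 hREO hx hξ hτ hL hlip hδ₁ hs.z_eq ht
    have hmono : a (‖φ‖ + ‖z₀‖) ≤
        a ((G + 1) * (‖prof v₀‖ + ‖prof (derivWithin v₀ (Icc 0 1))‖ + ‖xb₀‖ + ‖z₀‖)) := by
      refine hREO.a_classKInf.mono.monotoneOn (mem_Ici.2 (by positivity))
        (mem_Ici.2 (by positivity)) ?_
      have : 0 ≤ G * ‖z₀‖ := by positivity
      have : 0 ≤ ‖prof v₀‖ + ‖prof (derivWithin v₀ (Icc 0 1))‖ + ‖xb₀‖ := by positivity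
      linarith
    calc _ ≤ _ := hs.pde.error_le hA1 hA3 hx hφ hT₀ hLp hprof ht
      _ ≤ (1 + Lp) * (Real.exp (-σ * t) * (2 * a ((G + 1) * (‖prof v₀‖ +
            ‖prof (derivWithin v₀ (Icc 0 1))‖ + ‖xb₀‖ + ‖z₀‖))) +
          2 * γ * Real.exp (σ * δ) * fadingSup σ ξ t) :=
        mul_le_mul_of_nonneg_left (h1.trans (by gcongr)) (by positivity)
      _ = _ := by ring
  · have hpred := hs.isPredictor hA1 hA3 hREO.Ψ_cont hx hφ hτ hT₀
    obtain ⟨w', z', hz', hw', hww, hzz⟩ := Loop.exists_extension_of_isPredictor hA1 hA3 hREO hx hξ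
      hτ hL hlip hδ₁ hδ₂ hT₀ hs.z_eq hpred
    obtain ⟨v', hv', hsol⟩ :=
      Loop.exists_isSolution_of_isPredictor hA1 hA3 hREO.Ψ_cont hx hφ hτ hz' hw'
    -- The continued plant state is read off x, and the given classical solution agrees with it on
    -- [0, T₀) because x carries both.
    exact ⟨_, v', z', w', hsol, fun t ht => ⟨(hs.pde.eq_xPart hA1 hA3 hx hφ hT₀ ht).symm, hww ht,
      fun y hy => (hv' t ht.1 hy).trans (hs.pde.eq_profile_traj hA1 hA3 hx hφ hT₀ ht hy).symm⟩,
      fun t ht => hzz ht⟩
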